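/- **Setting.** Let $N\ge 1$ and let $\Omega\subset\mathbb R^N$ be a nonempty bounded open set with Lipschitz boundary. For $s\in(0,1)$ let $$c_{N,s}:=\frac{2^{2s-1}\,\Gamma\left(\frac{N+2s}{2}\right)}{\pi^{N/2}\,\Gamma(2-s)}\,s(1-s),$$ $$\langle u,v\rangle_s:=c_{N,s}\iint_{\mathbb R^{2N}}\frac{(u(x)-u(y))(v(x)-v(y))}{|x-y|^{N+2s}}\,dx\,dy,$$ and let $\langle u,v\rangle_0:=\int_{\mathbb R^N}uv\,dx$ and $\langle u,v\rangle_1:=\int_{\mathbb R^N}\nabla u\cdot\nabla v\,dx$ (weak gradients); put $[u]_s^2:=\langle u,u\rangle_s$ for $s\in[0,1]$. Let $\mu^+,\mu^-$ be finite nonnegative Borel measures on $[0,1]$ and let $\mu:=\mu^+-\mu^-$. Let $\overline s\in(0,1]$ and $\gamma\ge0$ be such that $$\mu^+([\overline s,1])>0,\qquad \mu^-([\overline s,1])=0,\qquad \mu^-([0,\overline s))\le\gamma\,\mu^+([\overline s,1]),$$ and let $s_\sharp\in[\overline s,1]$ be such that $\mu^+([s_\sharp,1])>0$ and $N>2s_\sharp$.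 Let $X(\mathbb R^N)$ be the completion of $C_c^\infty(\mathbb R^N)$ with respect to $\|u\|_X:=\big(\int_{[0,1]}[u]_s^2\,d\mu^+(s)\big)^{1/2}$ (its elements being understood as functions: $u$ is in $X(\mathbb R^N)$ if some sequence in $C^\infty_c(\mathbb R^N)$ converges to $u$ both in $\|\cdot\|_X$ and in $L^2_{\mathrm{loc}}(\mathbb R^N)$), and let $X(\Omega)$ be the set of all $u\in X(\mathbb R^N)$ with $u=0$ a.e. in $\mathbb R^N\setminus\Omega$. Set $$\langle u,v\rangle:=\int_{[0,1]}\langle u,v\rangle_s\,d\mu^+(s)-\int_{[0,\overline s)}\langle u,v\rangle_s\,d\mu^-(s).$$ For $L_\mu=\int_{[0,1]}(-\Delta)^s\,d\mu(s)$ consider the problem $$L_\mu u=\lambda u\ \text{ in }\Omega,\qquad u=0\ \text{ in }\mathbb R^N\setminus\Omega. \tag{P}$$ An eigenfunction of (P) for $\lambda\in\mathbb R$ is a function $u\in X(\Omega)$ with $\langle u,v\rangle=\lambda\int_\Omega uv\,dx$ for all $v\in X(\Omega)$; $\lambda$ is an eigenvalue if it has an eigenfunction that is not a.e. zero. **Theorem.**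 There exists $\gamma_0>0$, depending only on $N$ and $\Omega$, such that if $\gamma\in[0,\gamma_0]$ then there exist a sequence $(\lambda_k)_{k\ge1}$ of eigenvalues of (P) and functions $(e_k)_{k\ge1}$ in $X(\Omega)$ with the following properties. 1. $0<\lambda_1\le\lambda_2\le\cdots\le\lambda_k\le\cdots$ and $\lim_{k\to+\infty}\lambda_k=+\infty$. 2. Let $E_1:=X(\Omega)$ and $E_{k+1}:=\{u\in X(\Omega):\langle u,e_j\rangle=0\text{ for all }j=1,\dots,k\}$ for $k\ge1$. Then, for every $k\ge0$, $$\lambda_{k+1}=\min_{u\in E_{k+1}\setminus\{0\}}\frac{\int_{[0,1]}[u]_s^2\,d\mu^+(s)-\int_{[0,\overline s)}[u]_s^2\,d\mu^-(s)}{\|u\|_{L^2(\Omega)}^2},$$ and $e_{k+1}\in E_{k+1}\setminus\{0\}$ is an eigenfunction for $\lambda_{k+1}$ that attains this minimum. 3. $(e_k)$ is an orthonormal basis of $L^2(\Omega)$ and an orthogonal basis of $X(\Omega)$ with respect to $\langle\cdot,\cdot\rangle$, namely $\langle e_i,e_j\rangle=0$ for $i\ne j$ and, for every $f\in X(\Omega)$,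 $$\lim_{n\to+\infty}\Big\|f-\sum_{j=1}^n\frac{\langle f,e_j\rangle}{\langle e_j,e_j\rangle}\,e_j\Big\|_X=0.$$ 4. Each $\lambda_k$ has finite multiplicity: every value occurs only finitely often in the sequence, and if $k\ge1$ and $h\ge0$ are such that $\lambda_{k-1}<\lambda_k=\cdots=\lambda_{k+h}<\lambda_{k+h+1}$ (the first inequality being void for $k=1$), then every eigenfunction for $\lambda_k$ belongs to $\mathrm{span}\{e_k,\dots,e_{k+h}\}$. -/

import Mathlib

open MeasureTheory Set Filter Topology
open scoped ENNReal ContDiff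

noncomputable section

/-- The Euclidean space `ℝ^N`. -/
abbrev Rn (N : ℕ) := EuclideanSpace ℝ (Fin N)

/-- A set with Lipschitz boundary: near each boundary point `x₀`, in suitable orthonormal
coordinates with vertical direction `ν`, the set is the part of a ball that lies strictly above
the graph of a Lipschitz function of the horizontal coordinates `x - ⟪ν, x⟫ ν`. -/
def HasLipschitzBoundary {N : ℕ} (Ω : Set (Rn N)) : Prop :=
  ∀ x₀ ∈ frontier Ω, ∃ (ν : Rn N) (r : ℝ) (K : NNReal) (g : Rn N → ℝ),
    ‖ν‖ = 1 ∧ 0 < r ∧ LipschitzWith K g ∧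
      ∀ x ∈ Metric.ball x₀ r, (x ∈ Ω ↔ g (x - inner ℝ ν x • ν) < inner ℝ ν x)

/-- Test functions: `C_c^∞(ℝ^N)`. -/
def IsTestFunction {N : ℕ} (φ : Rn N → ℝ) : Prop :=
  ContDiff ℝ ∞ φ ∧ HasCompactSupport φ

/-- `g` is a weak (distributional) gradient of `u` on `ℝ^N`. -/
def IsWeakGradient {N : ℕ} (u : Rn N → ℝ) (g : Rn N → Rn N) : Prop :=
  LocallyIntegrable u volume ∧ LocallyIntegrable g volume ∧
    ∀ φ : Rn N → ℝ, IsTestFunction φ → ∀ v : Rn N,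
      ∫ x, u x * fderiv ℝ φ x v = - ∫ x, inner ℝ (g x) v * φ x

open Classical in
/-- The weak gradient of `u` (unique up to null sets), and `0` if there is none. -/
def weakGradient {N : ℕ} (u : Rn N → ℝ) : Rn N → Rn N :=
  if h : ∃ g, IsWeakGradient u g then h.choose else 0

/-- The normalizing constant `c_{N,s}` of the fractional Laplacian. -/
def fracConst (N : ℕ) (s : ℝ) : ℝ :=
  2 ^ (2 * s - 1) * Real.Gamma ((N + 2 * s) / 2) / (Real.pi ^ ((N : ℝ) / 2) * Real.Gamma (2 - s))
    * (s * (1 - s))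

open Classical in
/-- The squared seminorm `[u]_s²`, for `s ∈ [0,1]`, as an extended nonnegative number:
the squared `L²` norm for `s = 0`, the squared `L²` norm of the weak gradient for `s = 1` (infinite
if there is no weak gradient), the normalized Gagliardo double integral for `s ∈ (0,1)`. -/
def seminormSq {N : ℕ} (s : ℝ) (u : Rn N → ℝ) : ℝ≥0∞ :=
  if s = 0 then ∫⁻ x, ENNReal.ofReal (u x ^ 2)
  else if s = 1 then
    if ∃ g, IsWeakGradient u g then ∫⁻ x, ENNReal.ofReal (‖weakGradient u x‖ ^ 2) else ⊤
  else ENNReal.ofReal (fracConst N s) *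
    ∫⁻ z : Rn N × Rn N, ENNReal.ofReal ((u z.1 - u z.2) ^ 2 / ‖z.1 - z.2‖ ^ ((N : ℝ) + 2 * s))

/-- The bilinear form polarizing `[·]_s²`. -/
def seminormForm {N : ℕ} (s : ℝ) (u v : Rn N → ℝ) : ℝ :=
  if s = 0 then ∫ x, u x * v x
  else if s = 1 then ∫ x, inner ℝ (weakGradient u x) (weakGradient v x)
  else fracConst N s *
    ∫ z : Rn N × Rn N, (u z.1 - u z.2) * (v z.1 - v z.2) / ‖z.1 - z.2‖ ^ ((N : ℝ) + 2 * s)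

/-- `∫_S [u]_s² dm(s)`, an extended nonnegative number. -/
def energyOn {N : ℕ} (m : Measure ℝ) (S : Set ℝ) (u : Rn N → ℝ) : ℝ≥0∞ :=
  ∫⁻ s in S, seminormSq s u ∂m

/-- `‖u‖_X² = ∫_{[0,1]} [u]_s² dμ⁺(s)`. -/
def normXSq {N : ℕ} (μp : Measure ℝ) (u : Rn N → ℝ) : ℝ≥0∞ :=
  energyOn μp (Icc 0 1) u

/-- `u` represents an element of `X(ℝ^N)`, the completion of `C_c^∞(ℝ^N)` for `‖·‖_X`:
some sequence of test functions converges to `u` both in `‖·‖_X` and in `L²_loc(ℝ^N)`. (The local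
convergence fixes the function that an abstract element of the completion is identified with,
which `‖·‖_X` alone does not, as it may not see constants.) -/
def MemX {N : ℕ} (μp : Measure ℝ) (u : Rn N → ℝ) : Prop :=
  AEStronglyMeasurable u volume ∧
    ∃ φ : ℕ → Rn N → ℝ, (∀ n, IsTestFunction (φ n)) ∧
      Tendsto (fun n => normXSq μp (u - φ n)) atTop (𝓝 0) ∧
      ∀ K : Set (Rn N), IsCompact K →
        Tendsto (fun n => eLpNorm (u - φ n) 2 (volume.restrict K)) atTop (𝓝 0)

/-- `X(Ω)`: the functions in `X(ℝ^N)` that vanish (a.e.) outside `Ω`. -/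
def MemXOn {N : ℕ} (μp : Measure ℝ) (Ω : Set (Rn N)) (u : Rn N → ℝ) : Prop :=
  MemX μp u ∧ ∀ᵐ x ∂volume, x ∉ Ω → u x = 0

/-- The form `⟨u, v⟩ = ∫_{[0,1]} ⟨u, v⟩_s dμ⁺(s) - ∫_{[0,s̄)} ⟨u, v⟩_s dμ⁻(s)` of `L_μ`. -/
def signedForm {N : ℕ} (μp μm : Measure ℝ) (sbar : ℝ) (u v : Rn N → ℝ) : ℝ :=
  (∫ s in Icc 0 1, seminormForm s u v ∂μp) - ∫ s in Ico 0 sbar, seminormForm s u v ∂μm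

/-- `u ∈ X(Ω)` is a weak solution of `L_μ u = lam u` in `Ω`, `u = 0` outside `Ω`. -/
def IsEigenfunction {N : ℕ} (μp μm : Measure ℝ) (sbar : ℝ) (Ω : Set (Rn N)) (lam : ℝ)
    (u : Rn N → ℝ) : Prop :=
  MemXOn μp Ω u ∧
    ∀ v, MemXOn μp Ω v → signedForm μp μm sbar u v = lam * ∫ x in Ω, u x * v x

/-- `lam` is an eigenvalue: there is a nontrivial weak solution. -/
def IsEigenvalue {N : ℕ} (μp μm : Measure ℝ) (sbar : ℝ) (Ω : Set (Rn N)) (lam : ℝ) : Prop :=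
  ∃ u, IsEigenfunction μp μm sbar Ω lam u ∧ ¬ u =ᵐ[volume] 0

/-- The space `E_{k+1}` of those `u ∈ X(Ω)` with `⟨u, e_j⟩ = 0` for `j = 1, …, k`; the sequence is
indexed from `0` here, so that `e j` is `e_{j+1}`. -/
def orthSpace {N : ℕ} (μp μm : Measure ℝ) (sbar : ℝ) (Ω : Set (Rn N)) (e : ℕ → Rn N → ℝ)
    (k : ℕ) : Set (Rn N → ℝ) :=
  {u | MemXOn μp Ω u ∧ ∀ j < k, signedForm μp μm sbar u (e j) = 0}

/-- The Rayleigh quotient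
`(∫_{[0,1]} [u]_s² dμ⁺(s) - ∫_{[0,s̄)} [u]_s² dμ⁻(s)) / ‖u‖²_{L²(Ω)}`. -/
def rayleigh {N : ℕ} (μp μm : Measure ℝ) (sbar : ℝ) (Ω : Set (Rn N)) (u : Rn N → ℝ) : ℝ :=
  ((energyOn μp (Icc 0 1) u).toReal - (energyOn μm (Ico 0 sbar) u).toReal) / ∫ x in Ω, u x ^ 2

end

/-- A sequence can be chosen recursively so that each term satisfies a condition involving the
earlier terms. -/
theorem exists_seq_of_forall_exists {α : Type*} [Inhabited α] (P : ℕ → (ℕ → α) → α → Prop)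
    (hP : ∀ n f g x, (∀ j < n, f j = g j) → P n f x → P n g x)
    (h : ∀ n f, (∀ j < n, P j f (f j)) → ∃ x, P n f x) : ∃ f : ℕ → α, ∀ n, P n f (f n) := by
  classical
  let G : (n : ℕ) → ((m : ℕ) → m < n → α) → (ℕ → α) :=
    fun n F j => if hj : j < n then F j hj else default
  let step : (n : ℕ) → ((m : ℕ) → m < n → α) → α := fun n F =>
    if hx : ∃ x, P n (G n F) x then hx.choose else default
  let f : ℕ → α := fun n => WellFounded.fix (C := fun _ => α) Nat.lt_wfRel.wf step n
  have hf : ∀ n, f n = step n (fun m _ => f m) := fun n =>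
    WellFounded.fix_eq (C := fun _ => α) Nat.lt_wfRel.wf step n
  refine ⟨f, fun n => ?_⟩
  induction n using Nat.strong_induction_on with
  | _ n ih =>
    have hG : ∀ j < n, G n (fun m _ => f m) j = f j := fun j hj => by simp [G, hj]
    obtain ⟨x, hx⟩ := h n f ih
    have hex : ∃ x, P n (G n (fun m _ => f m)) x :=
      ⟨x, hP n _ _ x (fun j hj => (hG j hj).symm) hx⟩
    have : f n = hex.choose := by rw [hf n]; simp only [step]; rw [dif_pos hex]
    rw [this]
    exact hP n _ _ _ hG hex.choose_spec

/-- A coercive symmetric bilinear form `a` on a real vector space `V`, together with a map `J` to a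
Hilbert space that is compact with respect to `a`. The form is complete, and vanishes exactly on the
kernel of `J`. -/
structure CompactForm (V H : Type*) [AddCommGroup V] [Module ℝ V] [NormedAddCommGroup H]
    [InnerProductSpace ℝ H] where
  J : V →ₗ[ℝ] H
  a : V →ₗ[ℝ] V →ₗ[ℝ] ℝ
  symm : ∀ u v, a u v = a v u
  c : ℝ
  c_pos : 0 < c
  coercive : ∀ u, c * ‖J u‖ ^ 2 ≤ a u u
  ker : ∀ u, J u = 0 → a u u = 0
  complete : ∀ u : ℕ → V,
    Tendsto (fun p : ℕ × ℕ => a (u p.1 - u p.2) (u p.1 - u p.2)) atTop (𝓝 0) →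
    ∃ w, Tendsto (fun n => a (u n - w) (u n - w)) atTop (𝓝 0)
  compact : ∀ (u : ℕ → V) (B : ℝ), (∀ n, a (u n) (u n) ≤ B) →
    ∃ φ : ℕ → ℕ, StrictMono φ ∧ ∃ h : H, Tendsto (fun n => J (u (φ n))) atTop (𝓝 h)
  big : ∀ (e : ℕ → V) (k : ℕ), ∃ u, (∀ j < k, a u (e j) = 0) ∧ J u ≠ 0

namespace CompactForm

variable {V H : Type*} [AddCommGroup V] [Module ℝ V] [NormedAddCommGroup H]
  [InnerProductSpace ℝ H] (A : CompactForm V H)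

theorem nonneg (u : V) : 0 ≤ A.a u u :=
  le_trans (mul_nonneg A.c_pos.le (sq_nonneg _)) (A.coercive u)

theorem apply_neg_neg (u : V) : A.a (-u) (-u) = A.a u u := by
  rw [map_neg, map_neg, LinearMap.neg_apply, neg_neg]

theorem sq_apply_le (u v : V) : A.a u v ^ 2 ≤ A.a u u * A.a v v := by
  have h : ∀ t : ℝ, 0 ≤ A.a v v * (t * t) + 2 * A.a u v * t + A.a u u := by
    intro t
    have := A.nonneg (u + t • v)
    simp only [map_add, map_smul, LinearMap.add_apply, LinearMap.smul_apply, smul_eq_mul,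
      A.symm v u] at this
    linarith
  have := discrim_le_zero h
  rw [discrim] at this
  nlinarith

theorem tendsto_J {u : ℕ → V} {w : V}
    (h : Tendsto (fun n => A.a (u n - w) (u n - w)) atTop (𝓝 0)) :
    Tendsto (fun n => A.J (u n)) atTop (𝓝 (A.J w)) := by
  rw [tendsto_iff_norm_sub_tendsto_zero]
  have h1 : Tendsto (fun n => √(A.c⁻¹ * A.a (u n - w) (u n - w))) atTop (𝓝 0) := by
    simpa using (h.const_mul A.c⁻¹).sqrt
  refine squeeze_zero (fun _ => norm_nonneg _) (fun n => ?_) h1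
  apply Real.le_sqrt_of_sq_le
  rw [← map_sub, le_inv_mul_iff₀ A.c_pos]
  exact A.coercive _

theorem tendsto_apply {u : ℕ → V} {w : V}
    (h : Tendsto (fun n => A.a (u n - w) (u n - w)) atTop (𝓝 0)) (v : V) :
    Tendsto (fun n => A.a (u n) v) atTop (𝓝 (A.a w v)) := by
  rw [tendsto_iff_norm_sub_tendsto_zero]
  have h1 : Tendsto (fun n => √(A.a (u n - w) (u n - w) * A.a v v)) atTop (𝓝 0) := by
    simpa using (h.mul_const (A.a v v)).sqrt
  refine squeeze_zero (fun _ => norm_nonneg _) (fun n => ?_) h1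
  apply Real.le_sqrt_of_sq_le
  have := A.sq_apply_le (u n - w) v
  simpa using this

theorem tendsto_apply_self {u : ℕ → V} {w : V}
    (h : Tendsto (fun n => A.a (u n - w) (u n - w)) atTop (𝓝 0)) :
    Tendsto (fun n => A.a (u n) (u n)) atTop (𝓝 (A.a w w)) := by
  have h1 := (h.add ((A.tendsto_apply h w).const_mul 2)).sub_const (A.a w w)
  have h2 : 0 + 2 * A.a w w - A.a w w = A.a w w := by ring
  rw [h2] at h1
  refine h1.congr fun n => ?_
  simp only [map_sub, LinearMap.sub_apply, A.symm w (u n)]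
  ring

theorem parallelogram (u v : V) :
    A.a (u - v) (u - v) = 2 * A.a u u + 2 * A.a v v - A.a (u + v) (u + v) := by
  simp only [map_sub, map_add, LinearMap.sub_apply, LinearMap.add_apply]
  ring

/-- On a closed subspace the Rayleigh quotient attains its minimum. -/
theorem exists_minimizer (E : Submodule ℝ V)
    (hE : ∀ (u : ℕ → V) (w : V), (∀ n, u n ∈ E) →
      Tendsto (fun n => A.a (u n - w) (u n - w)) atTop (𝓝 0) → w ∈ E)
    (hne : ∃ u ∈ E, A.J u ≠ 0) :
    ∃ e ∈ E, ‖A.J e‖ = 1 ∧ ∀ u ∈ E, A.a e e * ‖A.J u‖ ^ 2 ≤ A.a u u := by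
  let S : Set ℝ := {r | ∃ u ∈ E, ‖A.J u‖ = 1 ∧ A.a u u = r}
  have hscale : ∀ u ∈ E, A.J u ≠ 0 → A.a u u / ‖A.J u‖ ^ 2 ∈ S := by
    intro u hu hJ
    have hn : ‖A.J u‖ ≠ 0 := norm_ne_zero_iff.2 hJ
    refine ⟨‖A.J u‖⁻¹ • u, E.smul_mem _ hu, ?_, ?_⟩
    · rw [map_smul, norm_smul, norm_inv, norm_norm, inv_mul_cancel₀ hn]
    · simp only [map_smul, LinearMap.smul_apply, smul_eq_mul]
      field_simp
  have hSne : S.Nonempty := by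
    obtain ⟨u, hu, hJ⟩ := hne
    exact ⟨_, hscale u hu hJ⟩
  have hSb : BddBelow S := by
    refine ⟨0, ?_⟩
    rintro r ⟨u, -, -, rfl⟩
    exact A.nonneg u
  set l := sInf S with hl
  have hle : ∀ u ∈ E, l * ‖A.J u‖ ^ 2 ≤ A.a u u := by
    intro u hu
    by_cases hJ : A.J u = 0
    · simpa [hJ] using A.nonneg u
    · have hn : 0 < ‖A.J u‖ ^ 2 := by positivity
      exact (le_div_iff₀ hn).1 (csInf_le hSb (hscale u hu hJ))
  obtain ⟨r, -, hr, hrS⟩ := exists_seq_tendsto_sInf hSne hSb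
  choose u huE huJ hur using hrS
  obtain ⟨B, hB⟩ := hr.bddAbove_range
  obtain ⟨φ, hφ, h, hh⟩ := A.compact u B fun n => by
    rw [hur]; exact hB ⟨n, rfl⟩
  have hlim : Tendsto (fun n => A.a (u (φ n)) (u (φ n))) atTop (𝓝 l) := by
    simp_rw [hur]
    exact hr.comp hφ.tendsto_atTop
  have hh1 : ‖h‖ = 1 := by
    have := hh.norm
    simp_rw [huJ] at this
    exact (tendsto_nhds_unique this tendsto_const_nhds)
  obtain ⟨w, hw⟩ := A.complete (fun n => u (φ n)) (by
    have e1 : Tendsto (fun p : ℕ × ℕ => p.1) atTop atTop := by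
      rw [← prod_atTop_atTop_eq]; exact tendsto_fst
    have e2 : Tendsto (fun p : ℕ × ℕ => p.2) atTop atTop := by
      rw [← prod_atTop_atTop_eq]; exact tendsto_snd
    have h1 := (((hlim.comp e1).const_mul 2).add ((hlim.comp e2).const_mul 2)).sub
      ((((hh.comp e1).add (hh.comp e2)).norm.pow 2).const_mul l)
    have h0 : 2 * l + 2 * l - l * ‖h + h‖ ^ 2 = 0 := by
      rw [← two_smul ℝ h, norm_smul, hh1]; norm_num; ring
    rw [h0] at h1
    refine squeeze_zero (fun _ => A.nonneg _) (fun p => ?_) h1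
    have := hle _ (E.add_mem (huE (φ p.1)) (huE (φ p.2)))
    rw [map_add] at this
    rw [A.parallelogram]
    simp only [Function.comp_apply]
    linarith)
  have hwE := hE _ w (fun n => huE (φ n)) hw
  have hwl : A.a w w = l := tendsto_nhds_unique (A.tendsto_apply_self hw) hlim
  refine ⟨w, hwE, ?_, fun v hv => hwl ▸ hle v hv⟩
  rw [tendsto_nhds_unique (A.tendsto_J hw) hh, hh1]

/-- The subspace of vectors that are orthogonal to `e j` for `j < k`. -/
def orth (e : ℕ → V) (k : ℕ) : Submodule ℝ V where
  carrier := {u | ∀ j < k, A.a u (e j) = 0}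
  add_mem' hu hv j hj := by simp [hu j hj, hv j hj]
  zero_mem' j _ := by simp
  smul_mem' c u hu j hj := by simp [hu j hj]

theorem mem_orth {e : ℕ → V} {k : ℕ} {u : V} : u ∈ A.orth e k ↔ ∀ j < k, A.a u (e j) = 0 :=
  Iff.rfl

theorem exists_minimizing_seq : ∃ e : ℕ → V, ∀ k, e k ∈ A.orth e k ∧ ‖A.J (e k)‖ = 1 ∧
    ∀ u ∈ A.orth e k, A.a (e k) (e k) * ‖A.J u‖ ^ 2 ≤ A.a u u := by
  have : Inhabited V := ⟨0⟩
  apply exists_seq_of_forall_exists (fun k e x => x ∈ A.orth e k ∧ ‖A.J x‖ = 1 ∧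
    ∀ u ∈ A.orth e k, A.a x x * ‖A.J u‖ ^ 2 ≤ A.a u u)
  · intro n f g x hfg h
    have : A.orth f n = A.orth g n := by
      ext u
      simp only [mem_orth]
      exact forall₂_congr fun j hj => by rw [hfg j hj]
    simpa only [this] using h
  · intro n f _
    obtain ⟨e, he, h⟩ := A.exists_minimizer (A.orth f n) (fun u w hu hw j hj =>
      tendsto_nhds_unique ((A.tendsto_apply hw (f j)).congr fun m => hu m j hj)
        tendsto_const_nhds) (by
        obtain ⟨u, hu, hJ⟩ := A.big f n
        exact ⟨u, hu, hJ⟩)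
    exact ⟨e, he, h⟩

/-- A choice of eigenvectors obtained by successive minimization. -/
noncomputable def eig : ℕ → V := A.exists_minimizing_seq.choose

/-- The eigenvalues, in nondecreasing order and with multiplicity. -/
noncomputable def lam (k : ℕ) : ℝ := A.a (A.eig k) (A.eig k)

theorem eig_mem (k : ℕ) : A.eig k ∈ A.orth A.eig k := (A.exists_minimizing_seq.choose_spec k).1

theorem norm_J_eig (k : ℕ) : ‖A.J (A.eig k)‖ = 1 := (A.exists_minimizing_seq.choose_spec k).2.1

theorem lam_mul_le {k : ℕ} {u : V} (hu : u ∈ A.orth A.eig k) :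
    A.lam k * ‖A.J u‖ ^ 2 ≤ A.a u u :=
  (A.exists_minimizing_seq.choose_spec k).2.2 u hu

theorem lam_pos (k : ℕ) : 0 < A.lam k := by
  have := A.coercive (A.eig k)
  rw [A.norm_J_eig] at this
  exact lt_of_lt_of_le (by simpa using A.c_pos) this

theorem orth_anti {k l : ℕ} (h : k ≤ l) : A.orth A.eig l ≤ A.orth A.eig k :=
  fun _ hu j hj => hu j (hj.trans_le h)

theorem lam_mono : Monotone A.lam := by
  intro k l h
  have := A.lam_mul_le (A.orth_anti h (A.eig_mem l))
  rwa [A.norm_J_eig, one_pow, mul_one] at this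

theorem apply_eig_eig {i j : ℕ} (h : i ≠ j) : A.a (A.eig i) (A.eig j) = 0 := by
  rcases h.lt_or_gt with h | h
  · rw [A.symm]; exact A.eig_mem j i h
  · exact A.eig_mem i j h

theorem apply_eig_of_mem {k : ℕ} {v : V} (hv : v ∈ A.orth A.eig k) :
    A.a (A.eig k) v = A.lam k * inner ℝ (A.J (A.eig k)) (A.J v) := by
  have h : ∀ t : ℝ, 0 ≤ (A.a v v - A.lam k * ‖A.J v‖ ^ 2) * (t * t) +
      2 * (A.a (A.eig k) v - A.lam k * inner ℝ (A.J (A.eig k)) (A.J v)) * t + 0 := by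
    intro t
    have h1 := A.lam_mul_le (Submodule.add_mem _ (A.eig_mem k) (Submodule.smul_mem _ t hv))
    rw [map_add, map_smul, norm_add_sq_real, norm_smul, inner_smul_right, A.norm_J_eig] at h1
    simp only [map_add, map_smul, LinearMap.add_apply, LinearMap.smul_apply, smul_eq_mul,
      A.symm v (A.eig k), Real.norm_eq_abs, mul_pow, sq_abs] at h1
    have h2 : A.a (A.eig k) (A.eig k) = A.lam k := rfl
    rw [h2] at h1
    linarith
  have := discrim_le_zero h
  rw [discrim] at this
  have h3 : (A.a (A.eig k) v - A.lam k * inner ℝ (A.J (A.eig k)) (A.J v)) ^ 2 ≤ 0 := by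
    nlinarith
  exact sub_eq_zero.1 (pow_eq_zero_iff two_ne_zero |>.1 (le_antisymm h3 (sq_nonneg _)))

/-- The partial sums of the expansion in eigenvectors. -/
noncomputable def partialSum (f : V) (n : ℕ) : V :=
  ∑ j ∈ Finset.range n, (A.a f (A.eig j) / A.a (A.eig j) (A.eig j)) • A.eig j

theorem apply_partialSum_eig (f : V) {n j : ℕ} (hj : j < n) :
    A.a (A.partialSum f n) (A.eig j) = A.a f (A.eig j) := by
  rw [partialSum, map_sum, LinearMap.sum_apply,
    Finset.sum_eq_single_of_mem j (Finset.mem_range.2 hj)]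
  · rw [map_smul, LinearMap.smul_apply, smul_eq_mul, div_mul_cancel₀]
    exact (A.lam_pos j).ne'
  · intro i _ hij
    rw [map_smul, LinearMap.smul_apply, A.apply_eig_eig hij, smul_zero]

theorem sub_partialSum_mem (f : V) (n : ℕ) : f - A.partialSum f n ∈ A.orth A.eig n := by
  intro j hj
  rw [map_sub, LinearMap.sub_apply, A.apply_partialSum_eig f hj, sub_self]

/-- The successive minimizers are eigenvectors. -/
theorem apply_eig (k : ℕ) (v : V) :
    A.a (A.eig k) v = A.lam k * inner ℝ (A.J (A.eig k)) (A.J v) := by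
  have hJ : ∀ j < k, inner ℝ (A.J (A.eig k)) (A.J (A.eig j)) = 0 := by
    intro j hj
    have h1 := A.apply_eig_of_mem (A.orth_anti hj.le (A.eig_mem k))
    rw [A.apply_eig_eig hj.ne] at h1
    rw [real_inner_comm]
    exact (mul_eq_zero.1 h1.symm).resolve_left (A.lam_pos j).ne'
  have h1 := A.apply_eig_of_mem (A.sub_partialSum_mem v k)
  have h2 : A.a (A.eig k) (A.partialSum v k) = 0 := by
    rw [partialSum, map_sum]
    refine Finset.sum_eq_zero fun j hj => ?_
    rw [map_smul, A.apply_eig_eig (Finset.mem_range.1 hj).ne', smul_zero]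
  have h3 : inner ℝ (A.J (A.eig k)) (A.J (A.partialSum v k)) = 0 := by
    rw [partialSum, map_sum, inner_sum]
    refine Finset.sum_eq_zero fun j hj => ?_
    rw [map_smul, inner_smul_right, hJ j (Finset.mem_range.1 hj), mul_zero]
  rwa [map_sub, h2, map_sub, inner_sub_right, h3, sub_zero, sub_zero] at h1

theorem orthonormal_J_eig : Orthonormal ℝ fun k => A.J (A.eig k) := by
  refine ⟨A.norm_J_eig, fun i j hij => ?_⟩
  have h := A.apply_eig i (A.eig j)
  rw [A.apply_eig_eig hij] at h
  exact (mul_eq_zero.1 h.symm).resolve_left (A.lam_pos i).ne'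

theorem tendsto_lam : Tendsto A.lam atTop atTop := by
  refine tendsto_atTop_atTop_of_monotone A.lam_mono fun B => ?_
  by_contra! hB
  obtain ⟨φ, hφ, h, hh⟩ := A.compact A.eig B fun n => (hB n).le
  have hc := hh.cauchySeq
  rw [Metric.cauchySeq_iff'] at hc
  obtain ⟨n, hn⟩ := hc 1 one_pos
  have h1 := hn (n + 1) n.le_succ
  have hne : φ (n + 1) ≠ φ n := (hφ n.lt_succ_self).ne'
  have h2 : ‖A.J (A.eig (φ (n + 1))) - A.J (A.eig (φ n))‖ ^ 2 = 2 := by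
    have h3 := A.orthonormal_J_eig.2 hne
    simp only at h3
    rw [norm_sub_sq_real, A.norm_J_eig, A.norm_J_eig, h3]
    norm_num
  rw [dist_eq_norm] at h1
  nlinarith [norm_nonneg (A.J (A.eig (φ (n + 1))) - A.J (A.eig (φ n)))]

theorem apply_partialSum_sub {f : V} {m n : ℕ} (h : m ≤ n) :
    A.a (A.partialSum f n - A.partialSum f m) (A.partialSum f n - A.partialSum f m) =
      A.a (f - A.partialSum f m) (f - A.partialSum f m) -
        A.a (f - A.partialSum f n) (f - A.partialSum f n) := by
  have h1 : ∀ k ≤ n, A.a (f - A.partialSum f n) (A.partialSum f k) = 0 := by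
    intro k hk
    conv_lhs => rw [partialSum.eq_def A f k, map_sum]
    refine Finset.sum_eq_zero fun j hj => ?_
    rw [map_smul, A.sub_partialSum_mem f n j ((Finset.mem_range.1 hj).trans_le hk), smul_zero]
  have h2 : f - A.partialSum f m = (f - A.partialSum f n) +
      (A.partialSum f n - A.partialSum f m) := by abel
  have h3 : A.a (f - A.partialSum f n) (A.partialSum f n - A.partialSum f m) = 0 := by
    rw [map_sub, h1 n le_rfl, h1 m h, sub_zero]
  rw [h2]
  generalize f - A.partialSum f n = x at *
  generalize A.partialSum f n - A.partialSum f m = y at *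
  simp only [map_add, LinearMap.add_apply, A.symm y x, h3]
  ring

/-- The eigenvectors form an orthogonal basis with respect to the form. -/
theorem tendsto_sub_partialSum (f : V) :
    Tendsto (fun n => A.a (f - A.partialSum f n) (f - A.partialSum f n)) atTop (𝓝 0) := by
  set g : ℕ → V := fun n => f - A.partialSum f n with hg
  have hanti : Antitone fun n => A.a (g n) (g n) := by
    intro m n h
    have h1 := A.apply_partialSum_sub (f := f) h
    have h2 := A.nonneg (A.partialSum f n - A.partialSum f m)
    simp only [hg]
    linarith
  have hbdd : BddBelow (range fun n => A.a (g n) (g n)) :=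
    ⟨0, by rintro _ ⟨n, rfl⟩; exact A.nonneg _⟩
  have hlim := tendsto_atTop_ciInf hanti hbdd
  set L := ⨅ n, A.a (g n) (g n) with hL
  have hdiff : ∀ m n, A.a (g m - g n) (g m - g n) = |A.a (g m) (g m) - A.a (g n) (g n)| := by
    intro m n
    have e1 : g m - g n = A.partialSum f n - A.partialSum f m := by simp only [hg]; abel
    rcases le_total m n with h | h
    · rw [e1, A.apply_partialSum_sub h, abs_of_nonneg (sub_nonneg.2 (hanti h))]
    · rw [e1, ← neg_sub, A.apply_neg_neg,
        A.apply_partialSum_sub h, abs_sub_comm, abs_of_nonneg (sub_nonneg.2 (hanti h))]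
  obtain ⟨w, hw⟩ := A.complete g (by
    simp_rw [hdiff]
    have e1 : Tendsto (fun p : ℕ × ℕ => p.1) atTop atTop := by
      rw [← prod_atTop_atTop_eq]; exact tendsto_fst
    have e2 : Tendsto (fun p : ℕ × ℕ => p.2) atTop atTop := by
      rw [← prod_atTop_atTop_eq]; exact tendsto_snd
    simpa using ((hlim.comp e1).sub (hlim.comp e2)).abs)
  have hJ0 : Tendsto (fun n => A.J (g n)) atTop (𝓝 0) := by
    rw [tendsto_zero_iff_norm_tendsto_zero]
    have h1 : Tendsto (fun n => √(A.a (g 0) (g 0) / A.lam n)) atTop (𝓝 0) := by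
      simpa using (A.tendsto_lam.const_div_atTop (A.a (g 0) (g 0))).sqrt
    refine squeeze_zero (fun _ => norm_nonneg _) (fun n => ?_) h1
    apply Real.le_sqrt_of_sq_le
    rw [le_div_iff₀ (A.lam_pos n), mul_comm]
    exact (A.lam_mul_le (A.sub_partialSum_mem f n)).trans (hanti (Nat.zero_le n))
  have hw0 : A.a w w = 0 := A.ker w (tendsto_nhds_unique (A.tendsto_J hw) hJ0)
  have := A.tendsto_apply_self hw
  rwa [hw0] at this

theorem finite_lam_eq (k : ℕ) : {j | A.lam j = A.lam k}.Finite := by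
  obtain ⟨n, hn⟩ := (A.tendsto_lam.eventually_gt_atTop (A.lam k)).exists_forall_of_atTop
  refine (Set.finite_lt_nat n).subset fun j hj => ?_
  by_contra h
  exact (hn j (not_lt.1 h)).ne' hj

/-- Eigenvectors are finite combinations of the chosen ones with the same eigenvalue. -/
theorem J_eq_sum_of_isEigenvector {k h : ℕ} (hlt : ∀ i < k, A.lam i < A.lam k)
    (hgt : A.lam k < A.lam (k + h + 1)) {φ : V}
    (hφ : ∀ v, A.a φ v = A.lam k * inner ℝ (A.J φ) (A.J v)) :
    A.J φ = A.J (∑ j ∈ Finset.Icc k (k + h),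
      (A.a φ (A.eig j) / A.a (A.eig j) (A.eig j)) • A.eig j) := by
  have h0 : ∀ j, A.lam j ≠ A.lam k → A.a φ (A.eig j) = 0 := by
    intro j hj
    have h1 := hφ (A.eig j)
    have h2 := A.apply_eig j φ
    rw [A.symm, h1, real_inner_comm] at h2
    have h3 : (A.lam k - A.lam j) * inner ℝ (A.J φ) (A.J (A.eig j)) = 0 := by
      rw [real_inner_comm]; linarith
    rw [h1, (mul_eq_zero.1 h3).resolve_left (sub_ne_zero.2 hj.symm), mul_zero]
  have hsum : ∀ n, k + h + 1 ≤ n → A.partialSum φ n = ∑ j ∈ Finset.Icc k (k + h),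
      (A.a φ (A.eig j) / A.a (A.eig j) (A.eig j)) • A.eig j := by
    intro n hn
    symm
    apply Finset.sum_subset
    · intro j hj
      rw [Finset.mem_Icc] at hj
      rw [Finset.mem_range]; omega
    · intro j _ hj
      rw [Finset.mem_Icc, not_and_or, not_le, not_le] at hj
      rw [h0, zero_div, zero_smul]
      rcases hj with hj | hj
      · exact (hlt j hj).ne
      · exact (hgt.trans_le (A.lam_mono hj)).ne'
  have h1 := A.tendsto_sub_partialSum φ
  have h2 : Tendsto (fun n => A.a (φ - A.partialSum φ n) (φ - A.partialSum φ n)) atTop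
      (𝓝 (A.a (φ - A.partialSum φ (k + h + 1)) (φ - A.partialSum φ (k + h + 1)))) := by
    refine tendsto_const_nhds.congr' ?_
    filter_upwards [eventually_ge_atTop (k + h + 1)] with n hn
    rw [hsum n hn, hsum _ le_rfl]
  have h3 := tendsto_nhds_unique h1 h2
  have h4 := A.coercive (φ - A.partialSum φ (k + h + 1))
  rw [← h3] at h4
  have h5 : ‖A.J (φ - A.partialSum φ (k + h + 1))‖ ^ 2 ≤ 0 := by
    by_contra! h
    nlinarith [A.c_pos]
  have h6 : A.J (φ - A.partialSum φ (k + h + 1)) = 0 :=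
    norm_eq_zero.1 (pow_eq_zero_iff two_ne_zero |>.1 (le_antisymm h5 (sq_nonneg _)))
  rw [map_sub, sub_eq_zero, hsum _ le_rfl] at h6
  exact h6

/-- If `J` has dense range, the images of the eigenvectors form a Hilbert basis. -/
theorem exists_hilbertBasis [CompleteSpace H]
    (hd : ∀ h : H, (∀ u, inner ℝ (A.J u) h = 0) → h = 0) :
    ∃ b : HilbertBasis ℕ ℝ H, ∀ k, b k = A.J (A.eig k) := by
  refine ⟨HilbertBasis.mkOfOrthogonalEqBot A.orthonormal_J_eig ?_, fun k => ?_⟩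
  · rw [Submodule.eq_bot_iff]
    intro h hh
    rw [Submodule.mem_orthogonal] at hh
    refine hd h fun u => ?_
    have h1 := A.tendsto_sub_partialSum u
    have h2 : Tendsto (fun n => A.J (A.partialSum u n)) atTop (𝓝 (A.J u)) := by
      apply A.tendsto_J
      refine h1.congr fun n => ?_
      rw [← neg_sub, A.apply_neg_neg]
    have h3 : Tendsto (fun n => inner ℝ (A.J (A.partialSum u n)) h) atTop
      (𝓝 (inner ℝ (A.J u) h)) := h2.inner tendsto_const_nhds
    refine tendsto_nhds_unique h3 (tendsto_const_nhds.congr fun n => ?_)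
    symm
    apply hh
    rw [partialSum, map_sum]
    refine Submodule.sum_mem _ fun j _ => ?_
    rw [map_smul]
    exact Submodule.smul_mem _ _ (Submodule.subset_span ⟨j, rfl⟩)
  · simp

end CompactForm

section Plancherel

open scoped FourierTransform SchwartzMap

variable {N : ℕ}

theorem integral_mul_fourier_of_integrable {f : Rn N → ℂ} (hf : Integrable f) (g : 𝓢(Rn N, ℂ)) :
    ∫ ξ, g ξ * 𝓕 f ξ = ∫ x, 𝓕 g x * f x := by
  have h := VectorFourier.integral_fourierIntegral_smul_eq_flip (L := innerₗ (Rn N))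
    (μ := volume) (ν := volume) Real.continuous_fourierChar continuous_inner g.integrable hf
  rw [flip_innerₗ] at h
  exact h.symm

theorem integral_mul_fourier_Lp (F : Lp ℂ 2 (volume : Measure (Rn N))) (g : 𝓢(Rn N, ℂ)) :
    ∫ ξ, g ξ * (𝓕 F : Lp ℂ 2 (volume : Measure (Rn N))) ξ = ∫ x, 𝓕 g x * F x := by
  have h := DFunLike.congr_fun (Lp.fourier_toTemperedDistribution_eq F) g
  rw [TemperedDistribution.fourier_apply, Lp.toTemperedDistribution_apply,
    Lp.toTemperedDistribution_apply] at h
  exact h.symm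

/-- Two locally integrable functions agree if they agree as tempered distributions. -/
theorem ae_eq_of_integral_schwartz_mul_eq {f g : Rn N → ℂ} (hf : LocallyIntegrable f)
    (hg : LocallyIntegrable g) (h : ∀ φ : 𝓢(Rn N, ℂ), ∫ x, φ x * f x = ∫ x, φ x * g x) :
    f =ᵐ[volume] g := by
  refine ae_eq_of_integral_contDiff_smul_eq hf hg fun φ hφ hφc => ?_
  have h1 : HasCompactSupport (Complex.ofRealCLM ∘ φ) := hφc.comp_left rfl
  have h2 : ContDiff ℝ ∞ (Complex.ofRealCLM ∘ φ) := by fun_prop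
  simpa using h (h1.toSchwartzMap h2)

theorem continuous_fourier_of_integrable {f : Rn N → ℂ} (hf : Integrable f) :
    Continuous (𝓕 f) :=
  VectorFourier.fourierIntegral_continuous Real.continuous_fourierChar
    (innerSL ℝ).continuous₂ hf

theorem fourier_toLp_ae_eq {f : Rn N → ℂ} (hf1 : Integrable f) (hf2 : MemLp f 2) :
    (𝓕 (hf2.toLp f) : Lp ℂ 2 (volume : Measure (Rn N))) =ᵐ[volume] 𝓕 f := by
  apply ae_eq_of_integral_schwartz_mul_eq
  · exact (Lp.memLp _).locallyIntegrable (by norm_num)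
  · exact (continuous_fourier_of_integrable hf1).locallyIntegrable
  · intro φ
    rw [integral_mul_fourier_Lp, integral_mul_fourier_of_integrable hf1]
    apply integral_congr_ae
    filter_upwards [hf2.coeFn_toLp] with x hx
    rw [hx]

theorem lintegral_enorm_sq_fourier_Lp (F : Lp ℂ 2 (volume : Measure (Rn N))) :
    ∫⁻ ξ, ‖(𝓕 F : Lp ℂ 2 (volume : Measure (Rn N))) ξ‖ₑ ^ 2 = ∫⁻ x, ‖F x‖ₑ ^ 2 := by
  have h := congrArg ENNReal.ofReal (Lp.norm_fourier_eq F)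
  rw [Lp.norm_def, Lp.norm_def, ENNReal.ofReal_toReal (Lp.eLpNorm_ne_top _),
    ENNReal.ofReal_toReal (Lp.eLpNorm_ne_top _)] at h
  have h2 := congrArg (· ^ (2 : ℝ)) h
  simp only [eLpNorm_eq_lintegral_rpow_enorm_toReal two_ne_zero ENNReal.ofNat_ne_top,
    ENNReal.toReal_ofNat, ← ENNReal.rpow_mul] at h2
  norm_num at h2
  exact h2

/-- Plancherel's theorem for integrable square integrable functions. -/
theorem lintegral_enorm_sq_fourier {f : Rn N → ℂ} (hf1 : Integrable f) (hf2 : MemLp f 2) :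
    ∫⁻ ξ, ‖𝓕 f ξ‖ₑ ^ 2 = ∫⁻ x, ‖f x‖ₑ ^ 2 := by
  have h1 : ∫⁻ ξ, ‖(𝓕 (hf2.toLp f) : Lp ℂ 2 (volume : Measure (Rn N))) ξ‖ₑ ^ 2 =
      ∫⁻ ξ, ‖𝓕 f ξ‖ₑ ^ 2 :=
    lintegral_congr_ae (μ := volume)
      ((fourier_toLp_ae_eq hf1 hf2).mono fun x hx => by simp only [hx])
  have h2 : ∫⁻ x, ‖(hf2.toLp f) x‖ₑ ^ 2 = ∫⁻ x, ‖f x‖ₑ ^ 2 :=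
    lintegral_congr_ae (hf2.coeFn_toLp.mono fun x hx => by simp only [hx])
  rw [← h1, ← h2, lintegral_enorm_sq_fourier_Lp]

/-- The functions in `L¹ ∩ L²`. -/
def MemL12 (u : Rn N → ℝ) : Prop := Integrable u ∧ MemLp u 2

/-- The Fourier transform of a real function. -/
noncomputable def ft (u : Rn N → ℝ) : Rn N → ℂ := 𝓕 fun x => (u x : ℂ)

theorem MemL12.add {u v : Rn N → ℝ} (hu : MemL12 u) (hv : MemL12 v) : MemL12 (u + v) :=
  ⟨hu.1.add hv.1, hu.2.add hv.2⟩

theorem MemL12.sub {u v : Rn N → ℝ} (hu : MemL12 u) (hv : MemL12 v) : MemL12 (u - v) :=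
  ⟨hu.1.sub hv.1, hu.2.sub hv.2⟩

theorem MemL12.smul {u : Rn N → ℝ} (hu : MemL12 u) (c : ℝ) : MemL12 (c • u) :=
  ⟨hu.1.smul c, hu.2.const_smul c⟩

theorem IsTestFunction.memL12 {φ : Rn N → ℝ} (h : IsTestFunction φ) : MemL12 φ :=
  ⟨h.1.continuous.integrable_of_hasCompactSupport h.2,
    h.1.continuous.memLp_of_hasCompactSupport h.2⟩

theorem ft_congr_ae {u v : Rn N → ℝ} (h : u =ᵐ[volume] v) : ft u = ft v := by
  funext ξ
  exact Real.fourier_congr_ae (h.mono fun x hx => by simp only [hx]) ξ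

theorem ft_apply (u : Rn N → ℝ) (ξ : Rn N) :
    ft u ξ = ∫ x, (Real.fourierChar (-inner ℝ x ξ) : ℂ) * (u x : ℂ) := by
  rw [ft, Real.fourier_eq]; rfl

theorem integrable_fourierChar_mul {f : Rn N → ℂ} (hf : Integrable f) (ξ : Rn N) :
    Integrable fun x => (Real.fourierChar (-inner ℝ x ξ) : ℂ) * f x :=
  (Real.fourierIntegral_convergent_iff ξ).2 hf

theorem ft_add {u v : Rn N → ℝ} (hu : Integrable u) (hv : Integrable v) :
    ft (u + v) = ft u + ft v := by
  funext ξ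
  simp only [ft_apply, Pi.add_apply, Complex.ofReal_add, mul_add]
  exact integral_add (integrable_fourierChar_mul hu.ofReal ξ)
    (integrable_fourierChar_mul hv.ofReal ξ)

theorem ft_smul (c : ℝ) (u : Rn N → ℝ) : ft (c • u) = (c : ℂ) • ft u := by
  funext ξ
  simp only [ft_apply, Pi.smul_apply, smul_eq_mul, Complex.ofReal_mul]
  rw [← integral_const_mul]
  congr 1
  funext x
  ring

theorem ft_sub {u v : Rn N → ℝ} (hu : Integrable u) (hv : Integrable v) :
    ft (u - v) = ft u - ft v := by
  have h : u - v = u + (-1 : ℝ) • v := by simp [sub_eq_add_neg]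
  rw [h, ft_add hu (hv.smul (-1 : ℝ)), ft_smul]
  simp [sub_eq_add_neg]

theorem continuous_ft {u : Rn N → ℝ} (hu : Integrable u) : Continuous (ft u) :=
  continuous_fourier_of_integrable hu.ofReal

theorem norm_ft_le (u : Rn N → ℝ) (ξ : Rn N) : ‖ft u ξ‖ ≤ ∫ x, |u x| := by
  rw [ft_apply]
  refine (norm_integral_le_integral_norm _).trans_eq ?_
  simp [Circle.norm_coe]

theorem MemL12.memLp_ofReal {u : Rn N → ℝ} (hu : MemL12 u) : MemLp (fun x => (u x : ℂ)) 2 :=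
  hu.2.ofReal

theorem lintegral_enorm_sq_ft {u : Rn N → ℝ} (hu : MemL12 u) :
    ∫⁻ ξ, ‖ft u ξ‖ₑ ^ 2 = ∫⁻ x, ‖u x‖ₑ ^ 2 := by
  rw [ft, lintegral_enorm_sq_fourier (f := fun x => (u x : ℂ)) hu.1.ofReal hu.memLp_ofReal]
  simp [enorm_eq_nnnorm]

/-- Plancherel's theorem, in the normalization of the seminorms. -/
theorem lintegral_norm_sq_ft {u : Rn N → ℝ} (hu : MemL12 u) :
    ∫⁻ ξ, ENNReal.ofReal (‖ft u ξ‖ ^ 2) = ∫⁻ x, ENNReal.ofReal (u x ^ 2) := by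
  convert lintegral_enorm_sq_ft hu using 2
  · funext ξ
    rw [ENNReal.ofReal_pow (norm_nonneg _), ofReal_norm]
  · funext x
    rw [← sq_abs, ENNReal.ofReal_pow (abs_nonneg _), ← Real.norm_eq_abs, ofReal_norm]

theorem lintegral_sq_lt_top {u : Rn N → ℝ} (hu : MemLp u 2) :
    ∫⁻ x, ENNReal.ofReal (u x ^ 2) < ⊤ :=
  hu.integrable_sq.lintegral_lt_top

theorem ft_translate {u : Rn N → ℝ} (h ξ : Rn N) :
    ft (fun x => u (x + h)) ξ = (Real.fourierChar (inner ℝ h ξ) : ℂ) * ft u ξ :=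
  congrFun (VectorFourier.fourierIntegral_comp_add_right Real.fourierChar volume
    (innerₗ (Rn N)) (fun x => (u x : ℂ)) h) ξ

theorem norm_fourierChar_sub_one_sq (t : ℝ) :
    ‖(Real.fourierChar t : ℂ) - 1‖ ^ 2 = 2 - 2 * Real.cos (2 * Real.pi * t) := by
  rw [Real.fourierChar_apply, ← Complex.normSq_eq_norm_sq, Complex.normSq_apply, Complex.sub_re,
    Complex.sub_im, Complex.exp_ofReal_mul_I_re, Complex.exp_ofReal_mul_I_im, Complex.one_re,
    Complex.one_im]
  nlinarith [Real.sin_sq_add_cos_sq (2 * Real.pi * t)]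

/-- Plancherel's theorem for the increments of a function. -/
theorem lintegral_translate_sub_sq {u : Rn N → ℝ} (hu : MemL12 u) (h : Rn N) :
    ∫⁻ x, ENNReal.ofReal ((u (x + h) - u x) ^ 2) =
      ∫⁻ ξ, ENNReal.ofReal ((2 - 2 * Real.cos (2 * Real.pi * inner ℝ h ξ)) * ‖ft u ξ‖ ^ 2) := by
  have hmp := measurePreserving_add_right (volume : Measure (Rn N)) h
  have hu' : MemL12 (fun x => u (x + h)) := ⟨hu.1.comp_add_right h, hu.2.comp_measurePreserving hmp⟩
  have := lintegral_norm_sq_ft (hu'.sub hu)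
  rw [ft_sub hu'.1 hu.1] at this
  simp only [Pi.sub_apply] at this
  rw [← this]
  congr 1
  funext ξ
  rw [ft_translate, ← norm_fourierChar_sub_one_sq, ← mul_pow, ← norm_mul, sub_mul, one_mul]

end Plancherel

section Gagliardo

variable {N : ℕ}

theorem lintegral_rpow_mul_exp_neg {a r : ℝ} (ha : 0 < a) (hr : 0 < r) :
    ∫⁻ t in Ioi (0 : ℝ), ENNReal.ofReal (t ^ (a - 1) * Real.exp (-(r * t))) =
      ENNReal.ofReal ((1 / r) ^ a * Real.Gamma a) := by
  have h := Real.integral_rpow_mul_exp_neg_mul_Ioi ha hr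
  have hpos : 0 < (1 / r) ^ a * Real.Gamma a :=
    mul_pos (Real.rpow_pos_of_pos (one_div_pos.2 hr) _) (Real.Gamma_pos_of_pos ha)
  have hint : IntegrableOn (fun t : ℝ => t ^ (a - 1) * Real.exp (-(r * t))) (Ioi 0) := by
    by_contra hn
    rw [integral_undef hn] at h
    exact hpos.ne h
  rw [← h, ofReal_integral_eq_lintegral_ofReal hint]
  filter_upwards [ae_restrict_mem measurableSet_Ioi] with t ht
  exact mul_nonneg (Real.rpow_nonneg (le_of_lt ht) _) (Real.exp_pos _).le

theorem lintegral_one_sub_cos_mul_gaussian {t : ℝ} (ht : 0 < t) (ξ : Rn N) :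
    ∫⁻ h : Rn N, ENNReal.ofReal ((2 - 2 * Real.cos (2 * Real.pi * inner ℝ h ξ)) *
        Real.exp (-(Real.pi * ‖h‖ ^ 2 * t))) =
      ENNReal.ofReal (2 * t ^ (-((N : ℝ) / 2)) * (1 - Real.exp (-(Real.pi * ‖ξ‖ ^ 2 / t)))) := by
  have hb : 0 < Real.pi * t := by positivity
  have hbre : 0 < ((Real.pi * t : ℝ) : ℂ).re := hb
  have hfin : (Module.finrank ℝ (Rn N) : ℝ) = N := by simp
  have e1 : ∀ h : Rn N, -(Real.pi * ‖h‖ ^ 2 * t) = -(Real.pi * t) * ‖h‖ ^ 2 := fun h => by ring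
  have hd : Real.pi / (Real.pi * t) = t⁻¹ := by field_simp
  have hI0 : ∫ h : Rn N, Real.exp (-(Real.pi * ‖h‖ ^ 2 * t)) = t ^ (-((N : ℝ) / 2)) := by
    simp_rw [e1]
    rw [GaussianFourier.integral_rexp_neg_mul_sq_norm hb, hfin, hd, Real.inv_rpow ht.le,
      Real.rpow_neg ht.le]
  have hint0 : Integrable fun h : Rn N => Real.exp (-(Real.pi * ‖h‖ ^ 2 * t)) := by
    by_contra hn
    rw [integral_undef hn] at hI0
    exact (Real.rpow_pos_of_pos ht _).ne hI0
  have hint1 : Integrable fun h : Rn N => Real.cos (2 * Real.pi * inner ℝ h ξ) *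
      Real.exp (-(Real.pi * ‖h‖ ^ 2 * t)) := by
    refine hint0.mono' (by fun_prop) (Eventually.of_forall fun h => ?_)
    rw [norm_mul, Real.norm_eq_abs, Real.norm_eq_abs, Real.abs_exp]
    exact mul_le_of_le_one_left (Real.exp_pos _).le (Real.abs_cos_le_one _)
  have hI1 : ∫ h : Rn N, Real.cos (2 * Real.pi * inner ℝ h ξ) *
      Real.exp (-(Real.pi * ‖h‖ ^ 2 * t)) =
      t ^ (-((N : ℝ) / 2)) * Real.exp (-(Real.pi * ‖ξ‖ ^ 2 / t)) := by
    have hF := congrArg Complex.re (fourier_gaussian_innerProductSpace hbre ξ)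
    rw [Real.fourier_eq'] at hF
    have hF1 : (∫ v : Rn N, Complex.exp (↑(-2 * Real.pi * inner ℝ v ξ) * Complex.I) •
        Complex.exp (-((Real.pi * t : ℝ) : ℂ) * ‖v‖ ^ 2)).re =
        ∫ h : Rn N, Real.cos (2 * Real.pi * inner ℝ h ξ) *
          Real.exp (-(Real.pi * ‖h‖ ^ 2 * t)) := by
      have hre : ∀ v : Rn N, (Complex.exp (↑(-2 * Real.pi * inner ℝ v ξ) * Complex.I) •
          Complex.exp (-((Real.pi * t : ℝ) : ℂ) * ‖v‖ ^ 2)).re =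
          Real.cos (2 * Real.pi * inner ℝ v ξ) * Real.exp (-(Real.pi * ‖v‖ ^ 2 * t)) := by
        intro v
        have h2 : Complex.exp (-((Real.pi * t : ℝ) : ℂ) * ‖v‖ ^ 2) =
            ((Real.exp (-(Real.pi * ‖v‖ ^ 2 * t)) : ℝ) : ℂ) := by
          push_cast
          congr 1
          ring
        rw [h2, smul_eq_mul, Complex.re_mul_ofReal, Complex.exp_ofReal_mul_I_re]
        congr 1
        rw [← Real.cos_neg]
        congr 1
        ring
      have hint : Integrable fun v : Rn N =>
          Complex.exp (↑(-2 * Real.pi * inner ℝ v ξ) * Complex.I) •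
          Complex.exp (-((Real.pi * t : ℝ) : ℂ) * ‖v‖ ^ 2) := by
        refine hint0.mono' (by fun_prop) (Eventually.of_forall fun v => ?_)
        rw [norm_smul, Complex.norm_exp_ofReal_mul_I, one_mul, Complex.norm_exp]
        apply le_of_eq
        congr 1
        rw [e1, ← Complex.ofReal_pow, ← Complex.ofReal_neg, ← Complex.ofReal_mul,
          Complex.ofReal_re]
      rw [← RCLike.re_eq_complex_re, ← integral_re hint]
      simp only [RCLike.re_eq_complex_re, hre]
    rw [hF1] at hF
    rw [hF]
    have h3 : ((Real.pi : ℂ) / ((Real.pi * t : ℝ) : ℂ)) ^ ((Module.finrank ℝ (Rn N) : ℂ) / 2) *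
        Complex.exp (-(Real.pi : ℂ) ^ 2 * ‖ξ‖ ^ 2 / ((Real.pi * t : ℝ) : ℂ)) =
        ((t ^ (-((N : ℝ) / 2)) * Real.exp (-(Real.pi * ‖ξ‖ ^ 2 / t)) : ℝ) : ℂ) := by
      rw [← Complex.ofReal_div, hd, Complex.ofReal_mul (t ^ _), Complex.ofReal_exp,
        finrank_euclideanSpace,
        Fintype.card_fin, Real.rpow_neg ht.le, ← Real.inv_rpow ht.le,
        Complex.ofReal_cpow (inv_nonneg.2 ht.le)]
      congr 2
      · push_cast; ring
      · push_cast
        have hpi : (Real.pi : ℂ) ≠ 0 := Complex.ofReal_ne_zero.2 Real.pi_ne_zero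
        have htc : (t : ℂ) ≠ 0 := Complex.ofReal_ne_zero.2 ht.ne'
        field_simp
    rw [h3, Complex.ofReal_re]
  have hsplit : ∀ h : Rn N, (2 - 2 * Real.cos (2 * Real.pi * inner ℝ h ξ)) *
      Real.exp (-(Real.pi * ‖h‖ ^ 2 * t)) = 2 * Real.exp (-(Real.pi * ‖h‖ ^ 2 * t)) -
      2 * (Real.cos (2 * Real.pi * inner ℝ h ξ) * Real.exp (-(Real.pi * ‖h‖ ^ 2 * t))) :=
    fun h => by ring
  have hI : ∫ h : Rn N, (2 - 2 * Real.cos (2 * Real.pi * inner ℝ h ξ)) *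
        Real.exp (-(Real.pi * ‖h‖ ^ 2 * t)) =
      2 * t ^ (-((N : ℝ) / 2)) * (1 - Real.exp (-(Real.pi * ‖ξ‖ ^ 2 / t))) := by
    simp_rw [hsplit]
    rw [integral_sub (hint0.const_mul 2) (hint1.const_mul 2), integral_const_mul,
      integral_const_mul, hI0, hI1]
    ring
  rw [← hI, ofReal_integral_eq_lintegral_ofReal]
  · simp_rw [hsplit]
    exact (hint0.const_mul 2).sub (hint1.const_mul 2)
  · refine Eventually.of_forall fun h => mul_nonneg ?_ (Real.exp_pos _).le
    linarith [Real.cos_le_one (2 * Real.pi * inner ℝ h ξ)]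

theorem lintegral_Ioi_comp_inv (G : ℝ → ℝ≥0∞) :
    ∫⁻ t in Ioi (0 : ℝ), G t = ∫⁻ τ in Ioi (0 : ℝ), ENNReal.ofReal ((τ ^ 2)⁻¹) * G τ⁻¹ := by
  have him : (fun τ : ℝ => τ⁻¹) '' Ioi 0 = Ioi 0 := by
    ext x
    constructor
    · rintro ⟨y, hy, rfl⟩
      exact mem_Ioi.2 (inv_pos.2 (mem_Ioi.1 hy))
    · exact fun hx => ⟨x⁻¹, mem_Ioi.2 (inv_pos.2 (mem_Ioi.1 hx)), inv_inv x⟩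
  have h := lintegral_image_eq_lintegral_abs_deriv_mul (s := Ioi (0 : ℝ)) (f := fun τ => τ⁻¹)
    (f' := fun τ => -(τ ^ 2)⁻¹) measurableSet_Ioi
    (fun x hx => (hasDerivAt_inv (ne_of_gt hx)).hasDerivWithinAt) inv_injective.injOn G
  rw [him] at h
  rw [h]
  refine lintegral_congr fun τ => ?_
  rw [abs_neg, abs_of_nonneg (by positivity)]

theorem ofReal_one_sub_exp_neg {A t : ℝ} (hA : 0 ≤ A) (ht : 0 < t) :
    ENNReal.ofReal (1 - Real.exp (-(A / t))) =
      ∫⁻ r in Ioc 0 A, ENNReal.ofReal (t⁻¹ * Real.exp (-(r / t))) := by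
  have hc : Continuous fun r : ℝ => t⁻¹ * Real.exp (-(r / t)) := by fun_prop
  have h : ∫ r in (0 : ℝ)..A, t⁻¹ * Real.exp (-(r / t)) = 1 - Real.exp (-(A / t)) := by
    rw [intervalIntegral.integral_eq_sub_of_hasDerivAt (f := fun r => -Real.exp (-(r / t)))]
    · simp; ring
    · intro x _
      have h1 : HasDerivAt (fun r : ℝ => -(r / t)) (-(1 / t)) x :=
        ((hasDerivAt_id x).div_const t).neg
      have := h1.exp.neg
      convert! this using 1
      ring
    · exact hc.intervalIntegrable _ _
  rw [← h, intervalIntegral.integral_of_le hA, ofReal_integral_eq_lintegral_ofReal]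
  · exact (hc.integrableOn_Icc).mono_set Ioc_subset_Icc_self
  · exact Eventually.of_forall fun r => by positivity

theorem lintegral_rpow_mul_one_sub_exp {s A : ℝ} (hs0 : 0 < s) (hs1 : s < 1) (hA : 0 ≤ A) :
    ∫⁻ t in Ioi (0 : ℝ), ENNReal.ofReal (t ^ (s - 1) * (1 - Real.exp (-(A / t)))) =
      ENNReal.ofReal (A ^ s * (Real.Gamma (1 - s) / s)) := by
  have hG : 0 < Real.Gamma (1 - s) := Real.Gamma_pos_of_pos (by linarith)
  have h1 : ∀ t ∈ Ioi (0 : ℝ), ENNReal.ofReal (t ^ (s - 1) * (1 - Real.exp (-(A / t)))) =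
      ∫⁻ r in Ioc 0 A, ENNReal.ofReal (t ^ (s - 2) * Real.exp (-(r / t))) := by
    intro t ht
    have ht' : 0 < t := ht
    rw [ENNReal.ofReal_mul (Real.rpow_nonneg ht'.le _), ofReal_one_sub_exp_neg hA ht',
      ← lintegral_const_mul _ (by fun_prop)]
    refine lintegral_congr fun r => ?_
    rw [← ENNReal.ofReal_mul (Real.rpow_nonneg ht'.le _), ← mul_assoc, ← Real.rpow_neg_one,
      ← Real.rpow_add ht']
    congr 3
    ring
  have h2 : ∀ r ∈ Ioc 0 A, ∫⁻ t in Ioi (0 : ℝ),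
      ENNReal.ofReal (t ^ (s - 2) * Real.exp (-(r / t))) =
      ENNReal.ofReal (r ^ (s - 1) * Real.Gamma (1 - s)) := by
    intro r hr
    have hr' : 0 < r := hr.1
    rw [lintegral_Ioi_comp_inv]
    have h3 : ∀ τ ∈ Ioi (0 : ℝ), ENNReal.ofReal ((τ ^ 2)⁻¹) *
        ENNReal.ofReal (τ⁻¹ ^ (s - 2) * Real.exp (-(r / τ⁻¹))) =
        ENNReal.ofReal (τ ^ (1 - s - 1) * Real.exp (-(r * τ))) := by
      intro τ hτ
      have hτ' : 0 < τ := hτ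
      rw [← ENNReal.ofReal_mul (by positivity), ← mul_assoc, div_inv_eq_mul,
        Real.inv_rpow hτ'.le, ← Real.rpow_neg hτ'.le, ← Real.rpow_natCast, ← Real.rpow_neg hτ'.le,
        ← Real.rpow_add hτ']
      congr 3
      push_cast
      ring
    rw [setLIntegral_congr_fun measurableSet_Ioi h3,
      lintegral_rpow_mul_exp_neg (by linarith) hr', one_div, Real.inv_rpow hr'.le,
      ← Real.rpow_neg hr'.le]
    congr 3
    ring
  rw [setLIntegral_congr_fun measurableSet_Ioi h1, lintegral_lintegral_swap,
    setLIntegral_congr_fun measurableSet_Ioc h2]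
  · have h4 : ∫ r in (0 : ℝ)..A, r ^ (s - 1) * Real.Gamma (1 - s) =
        A ^ s * (Real.Gamma (1 - s) / s) := by
      rw [intervalIntegral.integral_mul_const, integral_rpow (Or.inl (by linarith)),
        sub_add_cancel, Real.zero_rpow hs0.ne']
      ring
    have hii : IntervalIntegrable (fun r : ℝ => r ^ (s - 1) * Real.Gamma (1 - s)) volume 0 A :=
      (intervalIntegral.intervalIntegrable_rpow' (by linarith)).mul_const _
    rw [← h4, intervalIntegral.integral_of_le hA, ofReal_integral_eq_lintegral_ofReal]
    · exact (intervalIntegrable_iff_integrableOn_Ioc_of_le hA).1 hii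
    · filter_upwards [ae_restrict_mem measurableSet_Ioc] with r hr
      exact mul_nonneg (Real.rpow_nonneg hr.1.le _) hG.le
  · apply Measurable.aemeasurable
    simp only [Function.uncurry_def]
    fun_prop

theorem fracConst_pos {s : ℝ} (hs0 : 0 < s) (hs1 : s < 1) : 0 < fracConst N s := by
  unfold fracConst
  have h1 : 0 < Real.Gamma ((N + 2 * s) / 2) := Real.Gamma_pos_of_pos (by positivity)
  have h2 : 0 < Real.Gamma (2 - s) := Real.Gamma_pos_of_pos (by linarith)
  have h3 : 0 < 1 - s := by linarith
  positivity

/-- The multiplier of the Gagliardo seminorm. -/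
theorem lintegral_one_sub_cos_div_norm_rpow {s : ℝ} (hs0 : 0 < s) (hs1 : s < 1) (ξ : Rn N) :
    ∫⁻ h : Rn N, ENNReal.ofReal ((2 - 2 * Real.cos (2 * Real.pi * inner ℝ h ξ)) /
        ‖h‖ ^ ((N : ℝ) + 2 * s)) =
      ENNReal.ofReal ((2 * Real.pi * ‖ξ‖) ^ (2 * s) / fracConst N s) := by
  set a : ℝ := (N + 2 * s) / 2 with ha
  have ha0 : 0 < a := by positivity
  have hGa : 0 < Real.Gamma a := Real.Gamma_pos_of_pos ha0
  have hpi := Real.pi_pos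
  have hcos : ∀ h : Rn N, 0 ≤ 2 - 2 * Real.cos (2 * Real.pi * inner ℝ h ξ) := fun h => by
    linarith [Real.cos_le_one (2 * Real.pi * inner ℝ h ξ)]
  have h1 : ∀ h : Rn N, ENNReal.ofReal ((2 - 2 * Real.cos (2 * Real.pi * inner ℝ h ξ)) /
      ‖h‖ ^ ((N : ℝ) + 2 * s)) = ∫⁻ t in Ioi (0 : ℝ), ENNReal.ofReal (Real.pi ^ a / Real.Gamma a *
        t ^ (a - 1)) * ENNReal.ofReal ((2 - 2 * Real.cos (2 * Real.pi * inner ℝ h ξ)) *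
        Real.exp (-(Real.pi * ‖h‖ ^ 2 * t))) := by
    intro h
    by_cases hh : h = 0
    · simp [hh]
    have hn : 0 < ‖h‖ := norm_pos_iff.2 hh
    have h2 : ∀ t ∈ Ioi (0 : ℝ), ENNReal.ofReal (Real.pi ^ a / Real.Gamma a *
        t ^ (a - 1)) * ENNReal.ofReal ((2 - 2 * Real.cos (2 * Real.pi * inner ℝ h ξ)) *
        Real.exp (-(Real.pi * ‖h‖ ^ 2 * t))) =
        ENNReal.ofReal (Real.pi ^ a / Real.Gamma a *
          (2 - 2 * Real.cos (2 * Real.pi * inner ℝ h ξ))) *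
          ENNReal.ofReal (t ^ (a - 1) * Real.exp (-(Real.pi * ‖h‖ ^ 2 * t))) := by
      intro t ht
      have ht' : 0 < t := ht
      rw [← ENNReal.ofReal_mul (by positivity),
        ← ENNReal.ofReal_mul (mul_nonneg (by positivity) (hcos h))]
      congr 1
      ring
    rw [setLIntegral_congr_fun measurableSet_Ioi h2, lintegral_const_mul _ (by fun_prop),
      lintegral_rpow_mul_exp_neg ha0 (by positivity),
      ← ENNReal.ofReal_mul (mul_nonneg (by positivity) (hcos h))]
    congr 1
    have h3 : ‖h‖ ^ ((N : ℝ) + 2 * s) = (‖h‖ ^ 2) ^ a := by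
      rw [← Real.rpow_natCast ‖h‖ 2, ← Real.rpow_mul hn.le]
      congr 1
      rw [ha]; push_cast; ring
    rw [h3, one_div, Real.inv_rpow (by positivity), Real.mul_rpow hpi.le (by positivity)]
    field_simp
  simp_rw [h1]
  rw [lintegral_lintegral_swap (by
    apply Measurable.aemeasurable
    simp only [Function.uncurry_def]
    fun_prop)]
  have h4 : ∀ t ∈ Ioi (0 : ℝ), ∫⁻ h : Rn N, ENNReal.ofReal (Real.pi ^ a / Real.Gamma a *
        t ^ (a - 1)) * ENNReal.ofReal ((2 - 2 * Real.cos (2 * Real.pi * inner ℝ h ξ)) *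
        Real.exp (-(Real.pi * ‖h‖ ^ 2 * t))) =
      ENNReal.ofReal (2 * Real.pi ^ a / Real.Gamma a) *
        ENNReal.ofReal (t ^ (s - 1) * (1 - Real.exp (-(Real.pi * ‖ξ‖ ^ 2 / t)))) := by
    intro t ht
    have ht' : 0 < t := ht
    rw [lintegral_const_mul _ (by fun_prop), lintegral_one_sub_cos_mul_gaussian ht',
      ← ENNReal.ofReal_mul (by positivity), ← ENNReal.ofReal_mul (by positivity)]
    congr 1
    have h5 : t ^ (s - 1) = t ^ (a - 1) * t ^ (-((N : ℝ) / 2)) := by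
      rw [← Real.rpow_add ht']
      congr 1
      rw [ha]; ring
    rw [h5]
    ring
  rw [setLIntegral_congr_fun measurableSet_Ioi h4, lintegral_const_mul _ (by fun_prop),
    lintegral_rpow_mul_one_sub_exp hs0 hs1 (by positivity),
    ← ENNReal.ofReal_mul (by positivity)]
  congr 1
  have hG2 : Real.Gamma (2 - s) = (1 - s) * Real.Gamma (1 - s) := by
    rw [← Real.Gamma_add_one (by linarith)]
    congr 1
    ring
  have hG1 : 0 < Real.Gamma (1 - s) := Real.Gamma_pos_of_pos (by linarith)
  have e1 : (2 * Real.pi * ‖ξ‖) ^ (2 * s) = 2 ^ (2 * s) * Real.pi ^ s * (Real.pi * ‖ξ‖ ^ 2) ^ s := by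
    rw [Real.mul_rpow (by positivity) (by positivity), Real.mul_rpow (by positivity) hpi.le,
      Real.mul_rpow hpi.le (by positivity), ← Real.rpow_natCast ‖ξ‖ 2,
      ← Real.rpow_mul (norm_nonneg _), two_mul s, Real.rpow_add hpi]
    push_cast
    rw [two_mul s]
    ring
  have e2 : (2 : ℝ) ^ (2 * s) = 2 * 2 ^ (2 * s - 1) := by
    rw [Real.rpow_sub_one two_ne_zero]; ring
  have e3 : Real.pi ^ a = Real.pi ^ ((N : ℝ) / 2) * Real.pi ^ s := by
    rw [← Real.rpow_add hpi]
    congr 1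
    rw [ha]; ring
  have h1s : 0 < 1 - s := by linarith
  rw [e1, e2, e3, fracConst, hG2, ← ha]
  field_simp

theorem seminormSq_of_mem_Ioo {s : ℝ} (hs0 : 0 < s) (hs1 : s < 1) (u : Rn N → ℝ) :
    seminormSq s u = ENNReal.ofReal (fracConst N s) *
    ∫⁻ z : Rn N × Rn N,
      ENNReal.ofReal ((u z.1 - u z.2) ^ 2 / ‖z.1 - z.2‖ ^ ((N : ℝ) + 2 * s)) := by
  rw [seminormSq, if_neg hs0.ne', if_neg hs1.ne]

theorem ae_fst_eq {u v : Rn N → ℝ} (h : u =ᵐ[volume] v) :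
    ∀ᵐ z : Rn N × Rn N, u z.1 = v z.1 :=
  Measure.quasiMeasurePreserving_fst.ae h

theorem ae_snd_eq {u v : Rn N → ℝ} (h : u =ᵐ[volume] v) :
    ∀ᵐ z : Rn N × Rn N, u z.2 = v z.2 :=
  Measure.quasiMeasurePreserving_snd.ae h

theorem isWeakGradient_congr {u v : Rn N → ℝ} (h : u =ᵐ[volume] v) :
    IsWeakGradient u = IsWeakGradient v := by
  funext g
  have h1 : LocallyIntegrable u volume ↔ LocallyIntegrable v volume :=
    ⟨fun H => H.congr h, fun H => H.congr h.symm⟩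
  have h2 : ∀ φ : Rn N → ℝ, ∀ w : Rn N,
      ∫ x, u x * fderiv ℝ φ x w = ∫ x, v x * fderiv ℝ φ x w := fun φ w =>
    integral_congr_ae (h.mono fun x hx => by simp only [hx])
  simp only [IsWeakGradient, h1, h2]

theorem weakGradient_congr {u v : Rn N → ℝ} (h : u =ᵐ[volume] v) :
    weakGradient u = weakGradient v := by
  unfold weakGradient
  rw [isWeakGradient_congr h]

theorem seminormSq_congr {u v : Rn N → ℝ} (h : u =ᵐ[volume] v) (s : ℝ) :
    seminormSq s u = seminormSq s v := by
  unfold seminormSq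
  rw [isWeakGradient_congr h, weakGradient_congr h,
    lintegral_congr_ae (h.mono fun x hx => by simp only [hx] :
      (fun x => ENNReal.ofReal (u x ^ 2)) =ᵐ[volume] fun x => ENNReal.ofReal (v x ^ 2)),
    lintegral_congr_ae (μ := volume) (f := fun z : Rn N × Rn N =>
      ENNReal.ofReal ((u z.1 - u z.2) ^ 2 / ‖z.1 - z.2‖ ^ ((N : ℝ) + 2 * s)))
      (g := fun z : Rn N × Rn N =>
      ENNReal.ofReal ((v z.1 - v z.2) ^ 2 / ‖z.1 - z.2‖ ^ ((N : ℝ) + 2 * s)))]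
  filter_upwards [ae_fst_eq h, ae_snd_eq h] with z h1 h2
  rw [h1, h2]

/-- The Gagliardo seminorm in terms of the Fourier transform. -/
theorem seminormSq_eq_lintegral_ft_of_mem_Ioo {s : ℝ} (hs0 : 0 < s) (hs1 : s < 1) {u : Rn N → ℝ}
    (hu : MemL12 u) : seminormSq s u =
      ∫⁻ ξ, ENNReal.ofReal ((2 * Real.pi * ‖ξ‖) ^ (2 * s) * ‖ft u ξ‖ ^ 2) := by
  wlog hm : Measurable u generalizing u
  · have hae : u =ᵐ[volume] hu.1.1.mk u := hu.1.1.ae_eq_mk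
    rw [seminormSq_congr hae, ft_congr_ae hae]
    exact this ⟨hu.1.congr hae, hu.2.ae_eq hae⟩ hu.1.1.stronglyMeasurable_mk.measurable
  have hft := (continuous_ft hu.1).measurable
  have hc := fracConst_pos (N := N) hs0 hs1
  rw [seminormSq_of_mem_Ioo hs0 hs1, Measure.volume_eq_prod,
    lintegral_prod_symm' _ (by fun_prop)]
  have h1 : ∀ y : Rn N, ∫⁻ x : Rn N,
      ENNReal.ofReal ((u x - u y) ^ 2 / ‖x - y‖ ^ ((N : ℝ) + 2 * s)) =
      ∫⁻ h : Rn N, ENNReal.ofReal ((u (y + h) - u y) ^ 2 / ‖h‖ ^ ((N : ℝ) + 2 * s)) := by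
    intro y
    rw [← lintegral_add_left_eq_self _ y]
    simp
  simp only [h1]
  rw [lintegral_lintegral_swap (by
    apply Measurable.aemeasurable
    simp only [Function.uncurry_def]
    fun_prop)]
  have h2 : ∀ h : Rn N, ∫⁻ y : Rn N,
      ENNReal.ofReal ((u (y + h) - u y) ^ 2 / ‖h‖ ^ ((N : ℝ) + 2 * s)) =
      ∫⁻ ξ : Rn N, ENNReal.ofReal (‖ft u ξ‖ ^ 2) *
        ENNReal.ofReal ((2 - 2 * Real.cos (2 * Real.pi * inner ℝ h ξ)) /
        ‖h‖ ^ ((N : ℝ) + 2 * s)) := by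
    intro h
    have hn : 0 ≤ (‖h‖ ^ ((N : ℝ) + 2 * s))⁻¹ := by positivity
    simp_rw [div_eq_mul_inv, ENNReal.ofReal_mul' hn]
    rw [lintegral_mul_const _ (by fun_prop), lintegral_translate_sub_sq hu,
      ← lintegral_mul_const _ (by fun_prop)]
    refine lintegral_congr fun ξ => ?_
    rw [ENNReal.ofReal_mul' (by positivity)]
    ring
  simp only [h2]
  rw [lintegral_lintegral_swap (by
    apply Measurable.aemeasurable
    simp only [Function.uncurry_def]
    fun_prop), ← lintegral_const_mul _ (by
      apply Measurable.lintegral_prod_right'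
        (f := fun z : Rn N × Rn N => ENNReal.ofReal (‖ft u z.1‖ ^ 2) *
        ENNReal.ofReal ((2 - 2 * Real.cos (2 * Real.pi * inner ℝ z.2 z.1)) /
        ‖z.2‖ ^ ((N : ℝ) + 2 * s)))
      fun_prop)]
  refine lintegral_congr fun ξ => ?_
  rw [lintegral_const_mul _ (by fun_prop), lintegral_one_sub_cos_div_norm_rpow hs0 hs1,
    ← ENNReal.ofReal_mul (by positivity), ← ENNReal.ofReal_mul hc.le]
  congr 1
  field_simp

end Gagliardo

section WeakGradient

open scoped FourierTransform SchwartzMap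

variable {N : ℕ}

theorem integral_smul_eq_of_isWeakGradient {u : Rn N → ℝ} {g : Rn N → Rn N}
    (h : IsWeakGradient u g) {φ : Rn N → ℝ} (hφ : IsTestFunction φ) (v : Rn N) :
    inner ℝ (∫ x, φ x • g x) v = - ∫ x, u x * fderiv ℝ φ x v := by
  have hint : Integrable fun x => φ x • g x :=
    h.2.1.integrable_smul_left_of_hasCompactSupport hφ.1.continuous hφ.2
  rw [h.2.2 φ hφ v, neg_neg, real_inner_comm, ← integral_inner hint]
  congr 1
  funext x
  rw [real_inner_smul_right, real_inner_comm, mul_comm]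

theorem IsWeakGradient.ae_eq {u : Rn N → ℝ} {g g' : Rn N → Rn N} (h : IsWeakGradient u g)
    (h' : IsWeakGradient u g') : g =ᵐ[volume] g' := by
  refine ae_eq_of_integral_contDiff_smul_eq h.2.1 h'.2.1 fun φ hφ hφc => ?_
  refine ext_inner_right ℝ fun v => ?_
  rw [integral_smul_eq_of_isWeakGradient h ⟨hφ, hφc⟩,
    integral_smul_eq_of_isWeakGradient h' ⟨hφ, hφc⟩]

theorem isWeakGradient_weakGradient {u : Rn N → ℝ} (h : ∃ g, IsWeakGradient u g) :
    IsWeakGradient u (weakGradient u) := by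
  rw [weakGradient, dif_pos h]
  exact h.choose_spec

theorem IsTestFunction.memLp_fderiv {φ : Rn N → ℝ} (h : IsTestFunction φ) (v : Rn N) :
    MemLp (fun x => fderiv ℝ φ x v) 2 := by
  have h1 : Continuous fun x => fderiv ℝ φ x v :=
    (h.1.continuous_fderiv (by simp)).clm_apply continuous_const
  exact h1.memLp_of_hasCompactSupport (h.2.fderiv_apply ℝ v)

/-- The identity defining the weak gradient extends from test functions to square integrable
functions with square integrable derivative. -/
theorem IsWeakGradient.integral_mul_fderiv_eq {u : Rn N → ℝ} {g : Rn N → Rn N}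
    (h : IsWeakGradient u g) (hu : MemLp u 2) {v : Rn N}
    (hg : MemLp (fun x => inner ℝ (g x) v) 2) {φ : Rn N → ℝ} (hφ : ContDiff ℝ ∞ φ)
    (hφ2 : MemLp φ 2) (hφ' : MemLp (fun x => fderiv ℝ φ x v) 2) :
    ∫ x, u x * fderiv ℝ φ x v = - ∫ x, inner ℝ (g x) v * φ x := by
  let χ : ContDiffBump (0 : Rn N) := ⟨1, 2, one_pos, one_lt_two⟩
  have hχs : ContDiff ℝ ∞ (χ : Rn N → ℝ) := χ.contDiff
  have hχ0 : Continuous (fderiv ℝ (χ : Rn N → ℝ)) := hχs.continuous_fderiv (by simp)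
  obtain ⟨C, hC⟩ := hχ0.bounded_above_of_compact_support (χ.hasCompactSupport.fderiv ℝ)
  let a : ℕ → ℝ := fun n => 1 / ((n : ℝ) + 1)
  have ha0 : ∀ n, 0 < a n := fun n => by positivity
  have ha1 : ∀ n, a n ≤ 1 := fun n => by
    rw [div_le_one (by positivity)]
    linarith [(Nat.cast_nonneg n : (0 : ℝ) ≤ n)]
  have halim : Tendsto a atTop (𝓝 0) := tendsto_one_div_add_atTop_nhds_zero_nat
  let ψ : ℕ → Rn N → ℝ := fun n x => χ (a n • x) * φ x
  have hχn : ∀ n, ContDiff ℝ ∞ fun x : Rn N => χ (a n • x) := fun n =>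
    hχs.comp (contDiff_const_smul (a n))
  have hψ : ∀ n, IsTestFunction (ψ n) := fun n => by
    refine ⟨(hχn n).mul hφ, HasCompactSupport.mul_right ?_⟩
    exact χ.hasCompactSupport.comp_homeomorph (Homeomorph.smulOfNeZero (a n) (ha0 n).ne')
  have hder : ∀ n x, fderiv ℝ (ψ n) x v =
      χ (a n • x) * fderiv ℝ φ x v + a n * fderiv ℝ χ (a n • x) v * φ x := by
    intro n x
    have h1 : HasFDerivAt (fun x : Rn N => χ (a n • x))
        ((fderiv ℝ χ (a n • x)).comp (a n • ContinuousLinearMap.id ℝ (Rn N))) x :=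
      ((hχs.differentiable (by simp)) (a n • x)).hasFDerivAt.comp x
        ((hasFDerivAt_id x).const_smul (a n))
    have h2 := h1.mul ((hφ.differentiable (by simp)) x).hasFDerivAt
    have h3 : fderiv ℝ (ψ n) x = _ := h2.fderiv
    rw [h3]
    simp
    ring
  have hlim1 : ∀ x : Rn N, Tendsto (fun n => χ (a n • x)) atTop (𝓝 1) := by
    intro x
    have h1 : Tendsto (fun n => a n • x) atTop (𝓝 0) := by
      simpa using halim.smul_const x
    have h2 := (χ.continuous.tendsto 0).comp h1
    rwa [χ.one_of_mem_closedBall (by simp [χ.rIn_pos.le])] at h2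
  have hlim2 : ∀ x : Rn N, Tendsto (fun n => a n * fderiv ℝ χ (a n • x) v) atTop (𝓝 0) := by
    intro x
    refine squeeze_zero_norm (a := fun n => a n * (C * ‖v‖)) (fun n => ?_) ?_
    · rw [norm_mul, Real.norm_of_nonneg (ha0 n).le]
      gcongr
      exact (ContinuousLinearMap.le_opNorm _ _).trans (by gcongr; exact hC _)
    · simpa using halim.mul_const (C * ‖v‖)
  have hC0 : 0 ≤ C := (norm_nonneg _).trans (hC 0)
  have L1 : Tendsto (fun n => ∫ x, u x * fderiv ℝ (ψ n) x v) atTop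
      (𝓝 (∫ x, u x * fderiv ℝ φ x v)) := by
    refine tendsto_integral_of_dominated_convergence
      (fun x => |u x * fderiv ℝ φ x v| + C * ‖v‖ * |u x * φ x|) (fun n => ?_) ?_ (fun n => ?_) ?_
    · exact hu.1.mul ((hψ n).memLp_fderiv v).1
    · exact (hu.integrable_mul hφ').abs.add ((hu.integrable_mul hφ2).abs.const_mul _)
    · refine Eventually.of_forall fun x => ?_
      rw [hder, mul_add, ← mul_assoc, ← mul_assoc]
      refine (norm_add_le _ _).trans (add_le_add ?_ ?_)
      · rw [mul_comm (u x), mul_assoc, norm_mul, Real.norm_of_nonneg χ.nonneg, Real.norm_eq_abs]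
        exact mul_le_of_le_one_left (abs_nonneg _) χ.le_one
      · have e : u x * (a n * fderiv ℝ χ (a n • x) v) * φ x =
          a n * (fderiv ℝ χ (a n • x) v * (u x * φ x)) := by ring
        rw [e, norm_mul, norm_mul, Real.norm_of_nonneg (ha0 n).le, Real.norm_eq_abs (u x * φ x)]
        refine (mul_le_of_le_one_left (by positivity) (ha1 n)).trans ?_
        gcongr
        exact (ContinuousLinearMap.le_opNorm _ _).trans (by gcongr; exact hC _)
    · refine Eventually.of_forall fun x => ?_
      have := (((hlim1 x).mul_const (fderiv ℝ φ x v)).add ((hlim2 x).mul_const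
        (φ x))).const_mul (u x)
      simp only [one_mul, zero_mul, add_zero] at this
      simpa only [hder] using this
  have L2 : Tendsto (fun n => ∫ x, inner ℝ (g x) v * ψ n x) atTop
      (𝓝 (∫ x, inner ℝ (g x) v * φ x)) := by
    refine tendsto_integral_of_dominated_convergence
      (fun x => |inner ℝ (g x) v * φ x|) (fun n => ?_) ?_ (fun n => ?_) ?_
    · exact hg.1.mul (hψ n).1.continuous.aestronglyMeasurable
    · exact (hg.integrable_mul hφ2).abs
    · refine Eventually.of_forall fun x => ?_
      have e : inner ℝ (g x) v * ψ n x = χ (a n • x) * (inner ℝ (g x) v * φ x) := by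
        simp only [ψ]; ring
      rw [e, norm_mul, Real.norm_of_nonneg χ.nonneg, Real.norm_eq_abs]
      exact mul_le_of_le_one_left (abs_nonneg _) χ.le_one
    · refine Eventually.of_forall fun x => ?_
      simpa using ((hlim1 x).mul_const (φ x)).const_mul (inner ℝ (g x) v)
  refine tendsto_nhds_unique L1 (L2.neg.congr fun n => ?_)
  exact (h.2.2 (ψ n) (hψ n) v).symm

open LineDeriv

theorem IsWeakGradient.integral_mul_lineDeriv_schwartz {u : Rn N → ℝ} {g : Rn N → Rn N}
    (h : IsWeakGradient u g) (hu : MemLp u 2) {v : Rn N}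
    (hg : MemLp (fun x => inner ℝ (g x) v) 2) (φ : 𝓢(Rn N, ℂ)) :
    ∫ x, (∂_{v} φ) x * (u x : ℂ) = - ∫ x, φ x * ((inner ℝ (g x) v : ℝ) : ℂ) := by
  have hφ2 : MemLp φ 2 := φ.memLp 2 volume
  have hφ'2 : MemLp (⇑(∂_{v} φ : 𝓢(Rn N, ℂ))) 2 volume :=
    SchwartzMap.memLp (∂_{v} φ : 𝓢(Rn N, ℂ)) 2 volume
  have hd : ∀ x, HasFDerivAt φ (fderiv ℝ φ x) x := fun x => φ.hasFDerivAt x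
  have hre : ∀ x, fderiv ℝ (fun y => (φ y).re) x v = ((∂_{v} φ) x).re := fun x => by
    have h0 : fderiv ℝ (fun y => (φ y).re) x = _ :=
      (Complex.reCLM.hasFDerivAt.comp x (hd x)).fderiv
    rw [h0]
    rfl
  have him : ∀ x, fderiv ℝ (fun y => (φ y).im) x v = ((∂_{v} φ) x).im := fun x => by
    have h0 : fderiv ℝ (fun y => (φ y).im) x = _ :=
      (Complex.imCLM.hasFDerivAt.comp x (hd x)).fderiv
    rw [h0]
    rfl
  have h1 := h.integral_mul_fderiv_eq hu hg (φ := fun y => (φ y).re)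
    (Complex.reCLM.contDiff.comp (φ.smooth ⊤)) hφ2.re
    (by simp only [hre]; exact hφ'2.re)
  have h2 := h.integral_mul_fderiv_eq hu hg (φ := fun y => (φ y).im)
    (Complex.imCLM.contDiff.comp (φ.smooth ⊤)) hφ2.im
    (by simp only [him]; exact hφ'2.im)
  simp only [hre] at h1
  simp only [him] at h2
  have hi1 : Integrable fun x => (∂_{v} φ) x * (u x : ℂ) := hφ'2.integrable_mul hu.ofReal
  have hi2 : Integrable fun x => φ x * ((inner ℝ (g x) v : ℝ) : ℂ) :=
    hφ2.integrable_mul hg.ofReal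
  apply Complex.ext
  · rw [Complex.neg_re, ← RCLike.re_eq_complex_re, ← integral_re hi1, ← integral_re hi2]
    simp only [RCLike.re_eq_complex_re, Complex.re_mul_ofReal, mul_comm _ (u _),
      mul_comm (φ _).re]
    exact h1
  · rw [Complex.neg_im, ← RCLike.im_eq_complex_im, ← integral_im hi1, ← integral_im hi2]
    simp only [RCLike.im_eq_complex_im, Complex.im_mul_ofReal, mul_comm _ (u _),
      mul_comm (φ _).im]
    exact h2

theorem integral_lineDeriv_fourier_mul {u : Rn N → ℝ} (hu : Integrable u) (v : Rn N)
    (ψ : 𝓢(Rn N, ℂ)) : ∫ x, (∂_{v} (𝓕 ψ)) x * (u x : ℂ) =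
      - ∫ ξ, ψ ξ * ((2 * Real.pi * Complex.I) * ((inner ℝ ξ v : ℝ) : ℂ) * ft u ξ) := by
  have htg : (inner ℝ · v : Rn N → ℝ).HasTemperateGrowth := by fun_prop
  rw [SchwartzMap.lineDerivOp_fourier_eq,
    ← integral_mul_fourier_of_integrable (f := fun x => (u x : ℂ)) hu.ofReal, ← integral_neg]
  congr 1
  funext ξ
  rw [smul_apply, SchwartzMap.smulLeftCLM_apply_apply htg, Complex.real_smul,
    smul_eq_mul]
  change _ * ft u ξ = _
  ring

/-- The Fourier transform of a square integrable weak derivative. -/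
theorem IsWeakGradient.fourier_ae_eq {u : Rn N → ℝ} {g : Rn N → Rn N}
    (h : IsWeakGradient u g) (hu : MemL12 u) {v : Rn N}
    (hg : MemLp (fun x => ((inner ℝ (g x) v : ℝ) : ℂ)) 2) :
    (𝓕 (hg.toLp _) : Lp ℂ 2 (volume : Measure (Rn N))) =ᵐ[volume]
      fun ξ => (2 * Real.pi * Complex.I) * ((inner ℝ ξ v : ℝ) : ℂ) * ft u ξ := by
  apply ae_eq_of_integral_schwartz_mul_eq
  · exact (Lp.memLp _).locallyIntegrable (by norm_num)
  · have := continuous_ft hu.1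
    exact (by fun_prop : Continuous fun ξ =>
      (2 * Real.pi * Complex.I) * ((inner ℝ ξ v : ℝ) : ℂ) * ft u ξ).locallyIntegrable
  · intro ψ
    have hg' : MemLp (fun x => inner ℝ (g x) v) 2 := hg.re
    rw [integral_mul_fourier_Lp, ← neg_inj, ← integral_lineDeriv_fourier_mul hu.1,
      h.integral_mul_lineDeriv_schwartz hu.2 hg']
    congr 1
    apply integral_congr_ae
    filter_upwards [hg.coeFn_toLp] with x hx
    rw [hx]

theorem norm_sq_eq_sum_inner (x : Rn N) :
    ‖x‖ ^ 2 = ∑ i, (inner ℝ x (EuclideanSpace.single i (1 : ℝ))) ^ 2 := by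
  rw [EuclideanSpace.norm_sq_eq]
  simp [EuclideanSpace.inner_single_right]

theorem lintegral_norm_sq_weakGradient {u : Rn N → ℝ} {g : Rn N → Rn N}
    (h : IsWeakGradient u g) (hu : MemL12 u) (hg : MemLp g 2) :
    ∫⁻ x, ENNReal.ofReal (‖g x‖ ^ 2) =
      ∫⁻ ξ, ENNReal.ofReal ((2 * Real.pi * ‖ξ‖) ^ 2 * ‖ft u ξ‖ ^ 2) := by
  have hgv : ∀ v : Rn N, MemLp (fun x => inner ℝ (g x) v) 2 := fun v => hg.inner_const v
  have hgvc : ∀ v : Rn N, MemLp (fun x => ((inner ℝ (g x) v : ℝ) : ℂ)) 2 := fun v => (hgv v).ofReal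
  have hft := (continuous_ft hu.1).measurable
  have key : ∀ v : Rn N, ∫⁻ x, ENNReal.ofReal ((inner ℝ (g x) v) ^ 2) =
      ∫⁻ ξ, ENNReal.ofReal ((2 * Real.pi * inner ℝ ξ v) ^ 2 * ‖ft u ξ‖ ^ 2) := by
    intro v
    have h1 := lintegral_enorm_sq_fourier_Lp ((hgvc v).toLp _)
    have h2 : ∫⁻ ξ, ‖(𝓕 ((hgvc v).toLp _) : Lp ℂ 2 (volume : Measure (Rn N))) ξ‖ₑ ^ 2 =
        ∫⁻ ξ, ENNReal.ofReal ((2 * Real.pi * inner ℝ ξ v) ^ 2 * ‖ft u ξ‖ ^ 2) := by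
      refine lintegral_congr_ae (μ := volume) ((h.fourier_ae_eq hu (hgvc v)).mono fun ξ hξ => ?_)
      simp only [hξ]
      rw [← ofReal_norm, ← ENNReal.ofReal_pow (norm_nonneg _)]
      congr 1
      simp [mul_pow, abs_of_pos Real.pi_pos]
    have h3 : ∫⁻ x, ‖((hgvc v).toLp _) x‖ₑ ^ 2 =
        ∫⁻ x, ENNReal.ofReal ((inner ℝ (g x) v) ^ 2) := by
      refine lintegral_congr_ae (μ := volume) ((hgvc v).coeFn_toLp.mono fun x hx => ?_)
      simp only [hx]
      rw [← ofReal_norm, ← ENNReal.ofReal_pow (norm_nonneg _)]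
      simp
    rw [← h3, ← h1, h2]
  have e1 : ∀ x, ENNReal.ofReal (‖g x‖ ^ 2) =
      ∑ i, ENNReal.ofReal ((inner ℝ (g x) (EuclideanSpace.single i (1 : ℝ))) ^ 2) := fun x => by
    rw [norm_sq_eq_sum_inner, ENNReal.ofReal_sum_of_nonneg fun i _ => sq_nonneg _]
  have e2 : ∀ ξ : Rn N, ENNReal.ofReal ((2 * Real.pi * ‖ξ‖) ^ 2 * ‖ft u ξ‖ ^ 2) =
      ∑ i, ENNReal.ofReal ((2 * Real.pi * inner ℝ ξ (EuclideanSpace.single i (1 : ℝ))) ^ 2 *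
        ‖ft u ξ‖ ^ 2) := fun ξ => by
    rw [← ENNReal.ofReal_sum_of_nonneg fun i _ => by positivity, mul_pow _ ‖ξ‖,
      norm_sq_eq_sum_inner, Finset.mul_sum, Finset.sum_mul]
    simp only [mul_pow]
  simp_rw [e1, e2]
  rw [lintegral_finsetSum' _ fun i _ => ((hgv _).1.aemeasurable.pow_const 2).ennreal_ofReal,
    lintegral_finsetSum _ fun i _ => by fun_prop]
  exact Finset.sum_congr rfl fun i _ => key _

/-- A function whose Fourier transform is square integrable against `|ξ|²` has a square integrable
weak gradient. -/
theorem exists_isWeakGradient {u : Rn N → ℝ} (hu : MemL12 u)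
    (hfin : ∫⁻ ξ, ENNReal.ofReal ((2 * Real.pi * ‖ξ‖) ^ 2 * ‖ft u ξ‖ ^ 2) ≠ ⊤) :
    ∃ g, IsWeakGradient u g ∧ MemLp g 2 := by
  have hft := continuous_ft hu.1
  let m : Fin N → Rn N → ℂ := fun i ξ =>
    (2 * Real.pi * Complex.I) * ((inner ℝ ξ (EuclideanSpace.single i (1 : ℝ)) : ℝ) : ℂ) * ft u ξ
  have hmc : ∀ i, Continuous (m i) := fun i => by simp only [m]; fun_prop
  have hm : ∀ i, MemLp (m i) 2 := by
    intro i
    refine ⟨(hmc i).aestronglyMeasurable, ?_⟩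
    rw [eLpNorm_lt_top_iff_lintegral_rpow_enorm_lt_top two_ne_zero ENNReal.ofNat_ne_top]
    refine lt_of_le_of_lt (lintegral_mono fun ξ => ?_) hfin.lt_top
    rw [ENNReal.toReal_ofNat, ENNReal.rpow_ofNat, ← ofReal_norm,
      ← ENNReal.ofReal_pow (norm_nonneg _)]
    apply ENNReal.ofReal_le_ofReal
    simp only [m, norm_mul, mul_pow, Complex.norm_real, Complex.norm_I, Real.norm_eq_abs,
      mul_one, sq_abs, Complex.norm_ofNat]
    refine mul_le_mul_of_nonneg_right (mul_le_mul_of_nonneg_left ?_ (by positivity))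
      (sq_nonneg _)
    rw [norm_sq_eq_sum_inner ξ]
    exact Finset.single_le_sum (f := fun i => (inner ℝ ξ (EuclideanSpace.single i (1 : ℝ))) ^ 2)
      (fun j _ => sq_nonneg _) (Finset.mem_univ i)
  let G : Fin N → Lp ℂ 2 (volume : Measure (Rn N)) := fun i => 𝓕⁻ ((hm i).toLp (m i))
  have hG : ∀ i, MemLp (fun x => (G i x).re) 2 := fun i => (Lp.memLp (G i)).re
  have hGφ : ∀ (i) (φ : Rn N → ℝ), IsTestFunction φ →
      ∫ x, u x * fderiv ℝ φ x (EuclideanSpace.single i 1) = - ∫ x, (G i x).re * φ x := by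
    intro i φ hφ
    have c1 : HasCompactSupport (Complex.ofRealCLM ∘ φ) := hφ.2.comp_left rfl
    have c2 : ContDiff ℝ ∞ (Complex.ofRealCLM ∘ φ) := Complex.ofRealCLM.contDiff.comp hφ.1
    let Φ : 𝓢(Rn N, ℂ) := c1.toSchwartzMap c2
    have hΦ : ∀ x, Φ x = (φ x : ℂ) := fun x => rfl
    have hΦd : ∀ v x, (∂_{v} Φ) x = ((fderiv ℝ φ x v : ℝ) : ℂ) := fun v x => by
      rw [SchwartzMap.lineDerivOp_apply_eq_fderiv]
      have h1 : HasFDerivAt (fun y => ((φ y : ℝ) : ℂ))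
          (Complex.ofRealCLM.comp (fderiv ℝ φ x)) x :=
        Complex.ofRealCLM.hasFDerivAt.comp x ((hφ.1.differentiable (by simp)) x).hasFDerivAt
      have h2 : fderiv ℝ Φ x = Complex.ofRealCLM.comp (fderiv ℝ φ x) := h1.fderiv
      rw [h2]; rfl
    have h1 := integral_lineDeriv_fourier_mul hu.1 (EuclideanSpace.single i (1 : ℝ)) (𝓕⁻ Φ)
    have h2 := integral_mul_fourier_Lp (G i) (𝓕⁻ Φ)
    have e1 : 𝓕 (𝓕⁻ Φ) = Φ := FourierTransform.fourier_fourierInv_eq Φ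
    have e2 : 𝓕 (G i) = (hm i).toLp (m i) := FourierTransform.fourier_fourierInv_eq _
    rw [e1] at h1
    rw [e1, e2] at h2
    have e3 : ∫ ξ, (𝓕⁻ Φ) ξ * ((hm i).toLp (m i)) ξ = ∫ ξ, (𝓕⁻ Φ) ξ * m i ξ :=
      integral_congr_ae ((hm i).coeFn_toLp.mono fun ξ hξ => by simp only [hξ])
    rw [e3] at h2
    have h3 : ∫ x, (∂_{EuclideanSpace.single i (1 : ℝ)} Φ) x * (u x : ℂ) =
        - ∫ x, Φ x * G i x := by rw [h1, ← h2]
    have hi1 : Integrable fun x => (∂_{EuclideanSpace.single i (1 : ℝ)} Φ) x * (u x : ℂ) :=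
      ((∂_{EuclideanSpace.single i (1 : ℝ)} Φ).memLp 2 volume).integrable_mul hu.memLp_ofReal
    have hi2 : Integrable fun x => Φ x * G i x :=
      (Φ.memLp 2 volume).integrable_mul (Lp.memLp (G i))
    have h4 := congrArg Complex.re h3
    rw [Complex.neg_re, ← RCLike.re_eq_complex_re, ← integral_re hi1, ← integral_re hi2] at h4
    simp only [RCLike.re_eq_complex_re, Complex.re_mul_ofReal, hΦ, hΦd, Complex.re_ofReal_mul,
      Complex.ofReal_re] at h4
    simp only [mul_comm (u _), mul_comm (G i _).re]
    exact h4
  let g : Rn N → Rn N := fun x => ∑ i, (G i x).re • EuclideanSpace.single i (1 : ℝ)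
  have hgi : ∀ x v, inner ℝ (g x) v = ∑ i, v i * (G i x).re := by
    intro x v
    simp only [g, sum_inner, real_inner_smul_left, EuclideanSpace.inner_single_left]
    refine Finset.sum_congr rfl fun i _ => ?_
    simp [mul_comm]
  have hgL : MemLp g 2 := memLp_finsetSum _ fun i _ =>
    ((ContinuousLinearMap.id ℝ ℝ).smulRight (EuclideanSpace.single i (1 : ℝ))).comp_memLp' (hG i)
  refine ⟨g, ⟨hu.1.locallyIntegrable, hgL.locallyIntegrable (by norm_num), fun φ hφ v => ?_⟩, hgL⟩
  have hv : v = ∑ i, v i • EuclideanSpace.single i (1 : ℝ) := by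
    ext j
    simp [Finset.sum_apply, Pi.single_apply]
  have e1 : ∀ x, u x * fderiv ℝ φ x v =
      ∑ i, v i * (u x * fderiv ℝ φ x (EuclideanSpace.single i 1)) := by
    intro x
    conv_lhs => rw [hv]
    rw [map_sum, Finset.mul_sum]
    refine Finset.sum_congr rfl fun i _ => ?_
    rw [map_smul, smul_eq_mul]
    ring
  have e2 : ∀ x, inner ℝ (g x) v * φ x = ∑ i, v i * ((G i x).re * φ x) := by
    intro x
    rw [hgi, Finset.sum_mul]
    exact Finset.sum_congr rfl fun i _ => mul_assoc _ _ _
  have hi1 : ∀ i, Integrable fun x =>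
      v i * (u x * fderiv ℝ φ x (EuclideanSpace.single i 1)) := fun i =>
    (hu.2.integrable_mul (hφ.memLp_fderiv (EuclideanSpace.single i 1))).const_mul (v i)
  have hi2 : ∀ i, Integrable fun x => v i * ((G i x).re * φ x) := fun i =>
    ((hG i).integrable_mul hφ.memL12.2).const_mul (v i)
  simp_rw [e1, e2]
  rw [integral_finsetSum _ fun i _ => hi1 i, integral_finsetSum _ fun i _ => hi2 i,
    ← Finset.sum_neg_distrib]
  refine Finset.sum_congr rfl fun i _ => ?_
  rw [integral_const_mul, integral_const_mul, hGφ i φ hφ, mul_neg]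

theorem memLp_two_of_lintegral_ne_top {g : Rn N → Rn N} (hg : LocallyIntegrable g)
    (h : ∫⁻ x, ENNReal.ofReal (‖g x‖ ^ 2) ≠ ⊤) : MemLp g 2 := by
  refine ⟨hg.aestronglyMeasurable, ?_⟩
  rw [eLpNorm_lt_top_iff_lintegral_rpow_enorm_lt_top two_ne_zero ENNReal.ofNat_ne_top]
  refine lt_of_le_of_lt (lintegral_mono fun ξ => ?_) h.lt_top
  rw [ENNReal.toReal_ofNat, ENNReal.rpow_ofNat, ← ofReal_norm, ← ENNReal.ofReal_pow (norm_nonneg _)]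

theorem seminormSq_one (u : Rn N → ℝ) [Decidable (∃ g, IsWeakGradient u g)] :
    seminormSq 1 u = if ∃ g, IsWeakGradient u g then
      ∫⁻ x, ENNReal.ofReal (‖weakGradient u x‖ ^ 2) else ⊤ := by
  rw [seminormSq, if_neg one_ne_zero, if_pos rfl]
  congr

theorem exists_weakGradient_of_seminormSq_one_ne_top {u : Rn N → ℝ} (h : seminormSq 1 u ≠ ⊤) :
    IsWeakGradient u (weakGradient u) ∧ MemLp (weakGradient u) 2 := by
  classical
  rw [seminormSq_one] at h
  by_cases hex : ∃ g, IsWeakGradient u g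
  · rw [if_pos hex] at h
    have h1 := isWeakGradient_weakGradient hex
    exact ⟨h1, memLp_two_of_lintegral_ne_top h1.2.1 h⟩
  · rw [if_neg hex] at h
    exact absurd rfl h

theorem seminormSq_one_of_exists {u : Rn N → ℝ} {g : Rn N → Rn N} (h : IsWeakGradient u g) :
    seminormSq 1 u = ∫⁻ x, ENNReal.ofReal (‖weakGradient u x‖ ^ 2) := by
  classical
  rw [seminormSq_one, if_pos ⟨g, h⟩]

theorem seminormSq_one_eq_lintegral_ft {u : Rn N → ℝ} (hu : MemL12 u) : seminormSq 1 u =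
    ∫⁻ ξ, ENNReal.ofReal ((2 * Real.pi * ‖ξ‖) ^ 2 * ‖ft u ξ‖ ^ 2) := by
  by_cases hL : seminormSq 1 u = ⊤
  · rw [hL]
    by_contra hR
    obtain ⟨g, hg, hg2⟩ := exists_isWeakGradient hu (Ne.symm hR)
    have h1 := isWeakGradient_weakGradient ⟨g, hg⟩
    rw [seminormSq_one_of_exists hg, lintegral_norm_sq_weakGradient h1 hu
      (hg2.ae_eq (hg.ae_eq h1))] at hL
    exact hR hL.symm
  · obtain ⟨h1, h2⟩ := exists_weakGradient_of_seminormSq_one_ne_top hL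
    rw [seminormSq_one_of_exists h1, lintegral_norm_sq_weakGradient h1 hu h2]

/-- The seminorms in terms of the Fourier transform. -/
theorem seminormSq_eq_lintegral_ft {s : ℝ} (hs : s ∈ Icc (0 : ℝ) 1) {u : Rn N → ℝ}
    (hu : MemL12 u) : seminormSq s u =
      ∫⁻ ξ, ENNReal.ofReal ((2 * Real.pi * ‖ξ‖) ^ (2 * s) * ‖ft u ξ‖ ^ 2) := by
  rcases hs.1.eq_or_lt with rfl | h0
  · rw [seminormSq, if_pos rfl, ← lintegral_norm_sq_ft hu]
    simp
  rcases hs.2.eq_or_lt with rfl | h1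
  · rw [seminormSq_one_eq_lintegral_ft hu]
    simp
  · exact seminormSq_eq_lintegral_ft_of_mem_Ioo h0 h1 hu

end WeakGradient

section Spectral

open ComplexConjugate

variable {N : ℕ}

/-- The Fourier multiplier of the seminorms, as a function of the order and the frequency. -/
noncomputable def weight (z : ℝ × Rn N) : ℝ := (2 * Real.pi * ‖z.2‖) ^ (2 * z.1)

theorem weight_nonneg (z : ℝ × Rn N) : 0 ≤ weight z :=
  Real.rpow_nonneg (by positivity) _

theorem measurable_weight : Measurable (weight (N := N)) := by
  unfold weight
  fun_prop

/-- The spectral energy with respect to a measure on orders and frequencies. -/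
noncomputable def specEnergy (ν : Measure (ℝ × Rn N)) (u : Rn N → ℝ) : ℝ≥0∞ :=
  ∫⁻ z, ENNReal.ofReal (weight z * ‖ft u z.2‖ ^ 2) ∂ν

/-- The spectral bilinear form with respect to a measure on orders and frequencies. -/
noncomputable def specForm (ν : Measure (ℝ × Rn N)) (u v : Rn N → ℝ) : ℝ :=
  ∫ z, weight z * (ft u z.2 * conj (ft v z.2)).re ∂ν

theorem measurable_ft_snd {u : Rn N → ℝ} (hu : Integrable u) :
    Measurable fun z : ℝ × Rn N => ft u z.2 :=
  (continuous_ft hu).measurable.comp measurable_snd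

theorem measurable_specEnergy_integrand {u : Rn N → ℝ} (hu : Integrable u) :
    Measurable fun z : ℝ × Rn N => weight z * ‖ft u z.2‖ ^ 2 :=
  measurable_weight.mul ((measurable_ft_snd hu).norm.pow_const 2)

theorem specEnergy_smul (ν : Measure (ℝ × Rn N)) {u : Rn N → ℝ} (hu : Integrable u) (c : ℝ) :
    specEnergy ν (c • u) = ENNReal.ofReal (c ^ 2) * specEnergy ν u := by
  rw [specEnergy, specEnergy,
    ← lintegral_const_mul _ (measurable_specEnergy_integrand hu).ennreal_ofReal]
  refine lintegral_congr fun z => ?_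
  rw [← ENNReal.ofReal_mul (sq_nonneg _), ft_smul]
  congr 1
  simp [mul_pow]
  ring

theorem specEnergy_add_le (ν : Measure (ℝ × Rn N)) {u v : Rn N → ℝ} (hu : Integrable u)
    (hv : Integrable v) :
    specEnergy ν (u + v) ≤ 2 * specEnergy ν u + 2 * specEnergy ν v := by
  have h1 := (measurable_specEnergy_integrand hu).ennreal_ofReal
  have h2 := (measurable_specEnergy_integrand hv).ennreal_ofReal
  rw [specEnergy, specEnergy, specEnergy, ← lintegral_const_mul _ h1, ← lintegral_const_mul _ h2,
    ← lintegral_add_left (h1.const_mul _)]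
  refine lintegral_mono fun z => ?_
  have h3 : 0 ≤ weight z * ‖ft u z.2‖ ^ 2 := mul_nonneg (weight_nonneg z) (sq_nonneg _)
  have h4 : 0 ≤ weight z * ‖ft v z.2‖ ^ 2 := mul_nonneg (weight_nonneg z) (sq_nonneg _)
  have e : (2 : ℝ≥0∞) = ENNReal.ofReal 2 := by simp
  rw [e, ← ENNReal.ofReal_mul zero_le_two, ← ENNReal.ofReal_mul zero_le_two,
    ← ENNReal.ofReal_add (by positivity) (by positivity), ft_add hu hv]
  apply ENNReal.ofReal_le_ofReal
  have h5 : ‖ft u z.2 + ft v z.2‖ ^ 2 ≤ 2 * ‖ft u z.2‖ ^ 2 + 2 * ‖ft v z.2‖ ^ 2 := by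
    have := norm_add_le (ft u z.2) (ft v z.2)
    nlinarith [norm_nonneg (ft u z.2 + ft v z.2), sq_nonneg (‖ft u z.2‖ - ‖ft v z.2‖)]
  have := mul_le_mul_of_nonneg_left h5 (weight_nonneg z)
  simp only [Pi.add_apply]
  linarith

theorem specEnergy_neg (ν : Measure (ℝ × Rn N)) {u : Rn N → ℝ} (hu : Integrable u) :
    specEnergy ν (-u) = specEnergy ν u := by
  have := specEnergy_smul ν hu (-1)
  simpa using this

theorem specEnergy_sub_le (ν : Measure (ℝ × Rn N)) {u v : Rn N → ℝ} (hu : Integrable u)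
    (hv : Integrable v) :
    specEnergy ν (u - v) ≤ 2 * specEnergy ν u + 2 * specEnergy ν v := by
  have := specEnergy_add_le ν hu hv.neg
  rwa [specEnergy_neg ν hv, ← sub_eq_add_neg] at this

theorem specEnergy_add_ne_top {ν : Measure (ℝ × Rn N)} {u v : Rn N → ℝ} (hu : Integrable u)
    (hv : Integrable v) (h : specEnergy ν u ≠ ⊤) (h' : specEnergy ν v ≠ ⊤) :
    specEnergy ν (u + v) ≠ ⊤ :=
  ne_top_of_le_ne_top (by finiteness) (specEnergy_add_le ν hu hv)

theorem specEnergy_sub_ne_top {ν : Measure (ℝ × Rn N)} {u v : Rn N → ℝ} (hu : Integrable u)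
    (hv : Integrable v) (h : specEnergy ν u ≠ ⊤) (h' : specEnergy ν v ≠ ⊤) :
    specEnergy ν (u - v) ≠ ⊤ :=
  ne_top_of_le_ne_top (by finiteness) (specEnergy_sub_le ν hu hv)

/-- Polarization of an integral. -/
theorem integral_eq_of_polarization {α : Type*} [MeasurableSpace α] {m : Measure α}
    {f a b : α → ℝ} (hf : ∀ x, f x = (a x - b x) / 4) (ha : ∀ x, 0 ≤ a x) (hb : ∀ x, 0 ≤ b x)
    (ham : AEStronglyMeasurable a m) (hbm : AEStronglyMeasurable b m)
    (hai : ∫⁻ x, ENNReal.ofReal (a x) ∂m ≠ ⊤) (hbi : ∫⁻ x, ENNReal.ofReal (b x) ∂m ≠ ⊤) :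
    Integrable f m ∧ ∫ x, f x ∂m =
      ((∫⁻ x, ENNReal.ofReal (a x) ∂m).toReal - (∫⁻ x, ENNReal.ofReal (b x) ∂m).toReal) / 4 := by
  have h1 : Integrable a m := (lintegral_ofReal_ne_top_iff_integrable ham (ae_of_all _ ha)).1 hai
  have h2 : Integrable b m := (lintegral_ofReal_ne_top_iff_integrable hbm (ae_of_all _ hb)).1 hbi
  have hfe : f = fun x => (a x - b x) / 4 := funext hf
  refine ⟨hfe ▸ (h1.sub h2).div_const 4, ?_⟩
  rw [hfe, integral_div, integral_sub h1 h2, integral_eq_lintegral_of_nonneg_ae (ae_of_all _ ha) ham,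
    integral_eq_lintegral_of_nonneg_ae (ae_of_all _ hb) hbm]

theorem re_mul_conj_polarization (x y : ℂ) :
    (x * conj y).re = (‖x + y‖ ^ 2 - ‖x - y‖ ^ 2) / 4 := by
  rw [← Complex.normSq_eq_norm_sq, ← Complex.normSq_eq_norm_sq, Complex.normSq_add,
    Complex.normSq_sub]
  ring

theorem specForm_polarization {ν : Measure (ℝ × Rn N)} {u v : Rn N → ℝ} (hu : Integrable u)
    (hv : Integrable v) (h : specEnergy ν u ≠ ⊤) (h' : specEnergy ν v ≠ ⊤) :
    Integrable (fun z => weight z * (ft u z.2 * conj (ft v z.2)).re) ν ∧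
    specForm ν u v = ((specEnergy ν (u + v)).toReal - (specEnergy ν (u - v)).toReal) / 4 :=
  integral_eq_of_polarization (a := fun z => weight z * ‖ft (u + v) z.2‖ ^ 2)
    (b := fun z => weight z * ‖ft (u - v) z.2‖ ^ 2)
    (fun z => by
      rw [re_mul_conj_polarization, ft_add hu hv, ft_sub hu hv]
      simp only [Pi.add_apply, Pi.sub_apply]
      ring)
    (fun z => mul_nonneg (weight_nonneg z) (sq_nonneg _))
    (fun z => mul_nonneg (weight_nonneg z) (sq_nonneg _))
    (measurable_specEnergy_integrand (hu.add hv)).aestronglyMeasurable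
    (measurable_specEnergy_integrand (hu.sub hv)).aestronglyMeasurable
    (specEnergy_add_ne_top hu hv h h') (specEnergy_sub_ne_top hu hv h h')

theorem specForm_comm (ν : Measure (ℝ × Rn N)) (u v : Rn N → ℝ) :
    specForm ν u v = specForm ν v u := by
  unfold specForm
  congr 1
  funext z
  congr 1
  simp
  ring

theorem specForm_add_left {ν : Measure (ℝ × Rn N)} {u v w : Rn N → ℝ} (hu : Integrable u)
    (hv : Integrable v) (hw : Integrable w) (h : specEnergy ν u ≠ ⊤) (h' : specEnergy ν v ≠ ⊤)
    (h'' : specEnergy ν w ≠ ⊤) :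
    specForm ν (u + v) w = specForm ν u w + specForm ν v w := by
  unfold specForm
  rw [← integral_add (specForm_polarization hu hw h h'').1 (specForm_polarization hv hw h' h'').1,
    ft_add hu hv]
  congr 1
  funext z
  simp
  ring

theorem specForm_smul_left (ν : Measure (ℝ × Rn N)) (c : ℝ) (u w : Rn N → ℝ) :
    specForm ν (c • u) w = c * specForm ν u w := by
  unfold specForm
  rw [← integral_const_mul, ft_smul]
  congr 1
  funext z
  simp
  ring

theorem specForm_self (ν : Measure (ℝ × Rn N)) {u : Rn N → ℝ} (hu : Integrable u) :
    specForm ν u u = (specEnergy ν u).toReal := by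
  rw [specForm, specEnergy, ← integral_eq_lintegral_of_nonneg_ae
    (ae_of_all _ fun z => mul_nonneg (weight_nonneg z) (sq_nonneg _))
    (measurable_specEnergy_integrand hu).aestronglyMeasurable]
  congr 1
  funext z
  rw [Complex.mul_conj, Complex.ofReal_re, Complex.normSq_eq_norm_sq]

theorem specEnergy_prod (m : Measure ℝ) [SFinite m] {u : Rn N → ℝ} (hu : Integrable u) :
    specEnergy (m.prod volume) u =
      ∫⁻ s, (∫⁻ ξ : Rn N, ENNReal.ofReal (weight (s, ξ) * ‖ft u ξ‖ ^ 2)) ∂m :=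
  lintegral_prod _ (measurable_specEnergy_integrand hu).ennreal_ofReal.aemeasurable

theorem seminormSq_eq_lintegral_weight {s : ℝ} (hs : s ∈ Icc (0 : ℝ) 1) {u : Rn N → ℝ}
    (hu : MemL12 u) :
    seminormSq s u = ∫⁻ ξ, ENNReal.ofReal (weight (s, ξ) * ‖ft u ξ‖ ^ 2) :=
  seminormSq_eq_lintegral_ft hs hu

theorem energyOn_eq_specEnergy (m : Measure ℝ) [SFinite m] {S : Set ℝ} (hS : MeasurableSet S)
    (hS1 : S ⊆ Icc 0 1) {u : Rn N → ℝ} (hu : MemL12 u) :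
    energyOn m S u = specEnergy ((m.restrict S).prod volume) u := by
  rw [energyOn, specEnergy_prod _ hu.1]
  exact setLIntegral_congr_fun hS fun s hs => seminormSq_eq_lintegral_weight (hS1 hs) hu

theorem specEnergy_dirac_prod (s : ℝ) {u : Rn N → ℝ} (hu : Integrable u) :
    specEnergy ((Measure.dirac s).prod volume) u =
      ∫⁻ ξ, ENNReal.ofReal (weight (s, ξ) * ‖ft u ξ‖ ^ 2) := by
  rw [specEnergy_prod _ hu, lintegral_dirac]

theorem seminormSq_eq_specEnergy {s : ℝ} (hs : s ∈ Icc (0 : ℝ) 1) {u : Rn N → ℝ}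
    (hu : MemL12 u) : seminormSq s u = specEnergy ((Measure.dirac s).prod volume) u := by
  rw [seminormSq_eq_lintegral_weight hs hu, specEnergy_dirac_prod s hu.1]

theorem IsWeakGradient.add {u v : Rn N → ℝ} {g h : Rn N → Rn N} (hg : IsWeakGradient u g)
    (hh : IsWeakGradient v h) : IsWeakGradient (u + v) (g + h) := by
  refine ⟨hg.1.add hh.1, hg.2.1.add hh.2.1, fun φ hφ w => ?_⟩
  have hd : Continuous fun x => fderiv ℝ φ x w :=
    (hφ.1.continuous_fderiv (by simp)).clm_apply continuous_const
  have hdc : HasCompactSupport fun x => fderiv ℝ φ x w := hφ.2.fderiv_apply ℝ w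
  have i1 : Integrable fun x => u x * fderiv ℝ φ x w :=
    hg.1.integrable_smul_right_of_hasCompactSupport hd hdc
  have i2 : Integrable fun x => v x * fderiv ℝ φ x w :=
    hh.1.integrable_smul_right_of_hasCompactSupport hd hdc
  have i3 : ∀ {k : Rn N → Rn N}, LocallyIntegrable k →
      Integrable fun x => inner ℝ (k x) w * φ x := fun {k} hk => by
    have := (hk.integrable_smul_left_of_hasCompactSupport hφ.1.continuous hφ.2).inner_const
      (𝕜 := ℝ) w
    refine this.congr (ae_of_all _ fun x => ?_)
    simp only [real_inner_smul_left]
    ring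
  simp only [Pi.add_apply, add_mul, inner_add_left]
  rw [integral_add i1 i2, integral_add (i3 hg.2.1) (i3 hh.2.1), hg.2.2 φ hφ w, hh.2.2 φ hφ w]
  ring

theorem IsWeakGradient.neg {u : Rn N → ℝ} {g : Rn N → Rn N} (hg : IsWeakGradient u g) :
    IsWeakGradient (-u) (-g) := by
  refine ⟨hg.1.neg, hg.2.1.neg, fun φ hφ w => ?_⟩
  simp only [Pi.neg_apply, neg_mul, inner_neg_left, integral_neg, hg.2.2 φ hφ w]

theorem IsWeakGradient.sub {u v : Rn N → ℝ} {g h : Rn N → Rn N} (hg : IsWeakGradient u g)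
    (hh : IsWeakGradient v h) : IsWeakGradient (u - v) (g - h) := by
  rw [sub_eq_add_neg, sub_eq_add_neg]
  exact hg.add hh.neg

theorem seminormForm_polarization {s : ℝ} (hs : s ∈ Icc (0 : ℝ) 1) {u v : Rn N → ℝ}
    (hu : MemL12 u) (hv : MemL12 v) (hfu : seminormSq s u ≠ ⊤) (hfv : seminormSq s v ≠ ⊤) :
    seminormForm s u v = ((seminormSq s (u + v)).toReal - (seminormSq s (u - v)).toReal) / 4 := by
  have hadd : seminormSq s (u + v) ≠ ⊤ := by
    rw [seminormSq_eq_specEnergy hs (hu.add hv)]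
    rw [seminormSq_eq_specEnergy hs hu] at hfu
    rw [seminormSq_eq_specEnergy hs hv] at hfv
    exact specEnergy_add_ne_top hu.1 hv.1 hfu hfv
  have hsub : seminormSq s (u - v) ≠ ⊤ := by
    rw [seminormSq_eq_specEnergy hs (hu.sub hv)]
    rw [seminormSq_eq_specEnergy hs hu] at hfu
    rw [seminormSq_eq_specEnergy hs hv] at hfv
    exact specEnergy_sub_ne_top hu.1 hv.1 hfu hfv
  rcases hs.1.eq_or_lt with rfl | h0
  · simp only [seminormForm, seminormSq, if_true] at *
    refine (integral_eq_of_polarization (a := fun x => (u + v) x ^ 2) (b := fun x => (u - v) x ^ 2)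
      (fun x => ?_) (fun _ => sq_nonneg _) (fun _ => sq_nonneg _)
      ((hu.1.add hv.1).1.pow 2) ((hu.1.sub hv.1).1.pow 2) hadd hsub).2
    simp only [Pi.add_apply, Pi.sub_apply]
    ring
  rcases hs.2.eq_or_lt with rfl | h1
  · obtain ⟨gu, hgu⟩ := exists_weakGradient_of_seminormSq_one_ne_top hfu
    obtain ⟨gv, hgv⟩ := exists_weakGradient_of_seminormSq_one_ne_top hfv
    obtain ⟨ga, hga⟩ := exists_weakGradient_of_seminormSq_one_ne_top hadd
    obtain ⟨gs, hgs⟩ := exists_weakGradient_of_seminormSq_one_ne_top hsub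
    rw [seminormForm, if_neg one_ne_zero, if_pos rfl]
    rw [seminormSq_one_of_exists ga] at hadd ⊢
    rw [seminormSq_one_of_exists gs] at hsub ⊢
    have ea := ga.ae_eq (gu.add gv)
    have es := gs.ae_eq (gu.sub gv)
    have ea' : ∫⁻ x, ENNReal.ofReal (‖weakGradient (u + v) x‖ ^ 2) =
        ∫⁻ x, ENNReal.ofReal (‖weakGradient u x + weakGradient v x‖ ^ 2) :=
      lintegral_congr_ae (ea.mono fun x hx => by simp only [hx, Pi.add_apply])
    have es' : ∫⁻ x, ENNReal.ofReal (‖weakGradient (u - v) x‖ ^ 2) =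
        ∫⁻ x, ENNReal.ofReal (‖weakGradient u x - weakGradient v x‖ ^ 2) :=
      lintegral_congr_ae (es.mono fun x hx => by simp only [hx, Pi.sub_apply])
    rw [ea'] at hadd ⊢
    rw [es'] at hsub ⊢
    refine (integral_eq_of_polarization (fun x => ?_) (fun _ => sq_nonneg _) (fun _ => sq_nonneg _)
      ((hgu.1.add hgv.1).norm.pow 2) ((hgu.1.sub hgv.1).norm.pow 2) hadd hsub).2
    rw [Pi.add_apply, Pi.sub_apply, norm_add_sq_real, norm_sub_sq_real]
    ring
  · have hc := fracConst_pos (N := N) h0 h1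
    have hc' : ENNReal.ofReal (fracConst N s) ≠ 0 := by simpa using hc
    rw [seminormForm, if_neg h0.ne', if_neg h1.ne]
    rw [seminormSq_of_mem_Ioo h0 h1] at hadd hsub ⊢
    rw [seminormSq_of_mem_Ioo h0 h1, ENNReal.toReal_mul, ENNReal.toReal_mul,
      ENNReal.toReal_ofReal hc.le]
    have hm : ∀ {w : Rn N → ℝ}, MemL12 w → AEStronglyMeasurable (fun z : Rn N × Rn N =>
        (w z.1 - w z.2) ^ 2 / ‖z.1 - z.2‖ ^ ((N : ℝ) + 2 * s)) := fun {w} hw => by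
      have h1 : AEStronglyMeasurable (fun z : Rn N × Rn N => w z.1) := hw.1.1.comp_fst
      have h2 : AEStronglyMeasurable (fun z : Rn N × Rn N => w z.2) := hw.1.1.comp_snd
      have h3 : AEStronglyMeasurable (fun z : Rn N × Rn N => ‖z.1 - z.2‖ ^ ((N : ℝ) + 2 * s)) :=
        (by fun_prop : Measurable _).aestronglyMeasurable
      exact ((h1.sub h2).pow 2).div₀ h3
    rw [(integral_eq_of_polarization (fun z => ?_) (fun z => ?_) (fun z => ?_)
      (hm (hu.add hv)) (hm (hu.sub hv)) (fun h => hadd ?_) (fun h => hsub ?_)).2]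
    · ring
    · simp only [Pi.add_apply, Pi.sub_apply]
      ring
    · positivity
    · positivity
    · rw [h, ENNReal.mul_top hc']
    · rw [h, ENNReal.mul_top hc']

theorem seminormForm_eq_integral {s : ℝ} (hs : s ∈ Icc (0 : ℝ) 1) {u v : Rn N → ℝ}
    (hu : MemL12 u) (hv : MemL12 v) (hfu : seminormSq s u ≠ ⊤) (hfv : seminormSq s v ≠ ⊤) :
    seminormForm s u v = ∫ ξ, weight (s, ξ) * (ft u ξ * conj (ft v ξ)).re := by
  rw [seminormForm_polarization hs hu hv hfu hfv, seminormSq_eq_specEnergy hs (hu.add hv),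
    seminormSq_eq_specEnergy hs (hu.sub hv)]
  rw [seminormSq_eq_specEnergy hs hu] at hfu
  rw [seminormSq_eq_specEnergy hs hv] at hfv
  obtain ⟨h1, h2⟩ := specForm_polarization hu.1 hv.1 hfu hfv
  rw [← h2, specForm, integral_prod _ h1, integral_dirac]

theorem integral_seminormForm_eq_specForm (m : Measure ℝ) [SFinite m] {S : Set ℝ}
    (hS : MeasurableSet S) (hS1 : S ⊆ Icc 0 1) {u v : Rn N → ℝ} (hu : MemL12 u) (hv : MemL12 v)
    (hfu : energyOn m S u ≠ ⊤) (hfv : energyOn m S v ≠ ⊤) :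
    ∫ s in S, seminormForm s u v ∂m = specForm ((m.restrict S).prod volume) u v := by
  rw [energyOn_eq_specEnergy m hS hS1 hu] at hfu
  rw [energyOn_eq_specEnergy m hS hS1 hv] at hfv
  obtain ⟨h1, -⟩ := specForm_polarization hu.1 hv.1 hfu hfv
  rw [specForm, integral_prod _ h1]
  have key : ∀ {w : Rn N → ℝ}, MemL12 w → specEnergy ((m.restrict S).prod volume) w ≠ ⊤ →
      ∀ᵐ s ∂(m.restrict S), seminormSq s w ≠ ⊤ := fun {w} hw hf => by
    rw [specEnergy_prod _ hw.1] at hf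
    have hmeas : Measurable fun s : ℝ => ∫⁻ ξ, ENNReal.ofReal (weight (s, ξ) * ‖ft w ξ‖ ^ 2) :=
      (measurable_specEnergy_integrand hw.1).ennreal_ofReal.lintegral_prod_right'
    filter_upwards [ae_lt_top hmeas hf, ae_restrict_mem hS] with s h hs
    rw [seminormSq_eq_lintegral_weight (hS1 hs) hw]
    exact h.ne
  apply integral_congr_ae
  filter_upwards [key hu hfu, key hv hfv, ae_restrict_mem hS] with s h2 h3 hs
  exact seminormForm_eq_integral (hS1 hs) hu hv h2 h3

end Spectral

section Poincare

variable {N : ℕ}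

theorem lintegral_enorm_sq_le_of_support {Ω : Set (Rn N)} (hΩ : MeasurableSet Ω) {u : Rn N → ℝ}
    (hu : AEStronglyMeasurable u volume) (h0 : ∀ᵐ x ∂volume, x ∉ Ω → u x = 0) :
    (∫⁻ x, ‖u x‖ₑ) ^ 2 ≤ volume Ω * ∫⁻ x, ‖u x‖ₑ ^ 2 := by
  have h1 : ∫⁻ x, ‖u x‖ₑ = ∫⁻ x, ‖u x‖ₑ * Ω.indicator 1 x := by
    refine lintegral_congr_ae (h0.mono fun x hx => ?_)
    by_cases hxΩ : x ∈ Ω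
    · simp [hxΩ]
    · simp [hxΩ, hx hxΩ]
  have h2 := ENNReal.lintegral_mul_le_Lp_mul_Lq (volume : Measure (Rn N))
    Real.HolderConjugate.two_two (f := fun x => ‖u x‖ₑ) (g := Ω.indicator 1) hu.enorm
    (measurable_one.indicator hΩ).aemeasurable
  have h3 : ∫⁻ x, Ω.indicator (1 : Rn N → ℝ≥0∞) x ^ (2 : ℝ) = volume Ω := by
    rw [← lintegral_indicator_one hΩ]
    refine lintegral_congr fun x => ?_
    by_cases hx : x ∈ Ω <;> simp [hx]
  rw [h1]
  refine (pow_le_pow_left' h2 2).trans_eq ?_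
  rw [h3, mul_pow, ← ENNReal.rpow_natCast, ← ENNReal.rpow_mul, ← ENNReal.rpow_natCast,
    ← ENNReal.rpow_mul, mul_comm]
  norm_num

theorem enorm_ft_sq_le {Ω : Set (Rn N)} (hΩ : MeasurableSet Ω) {u : Rn N → ℝ}
    (hu : AEStronglyMeasurable u volume) (h0 : ∀ᵐ x ∂volume, x ∉ Ω → u x = 0) (ξ : Rn N) :
    ‖ft u ξ‖ₑ ^ 2 ≤ volume Ω * ∫⁻ x, ‖u x‖ₑ ^ 2 := by
  refine le_trans (pow_le_pow_left' ?_ 2) (lintegral_enorm_sq_le_of_support hΩ hu h0)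
  rw [ft_apply]
  refine (enorm_integral_le_lintegral_enorm _).trans_eq (lintegral_congr fun x => ?_)
  rw [← ofReal_norm, ← ofReal_norm, norm_mul, Circle.norm_coe, one_mul, Complex.norm_real]

theorem ofReal_weight_mul (z : ℝ × Rn N) (w : ℂ) :
    ENNReal.ofReal (weight z * ‖w‖ ^ 2) = ENNReal.ofReal (weight z) * ‖w‖ₑ ^ 2 := by
  rw [ENNReal.ofReal_mul (weight_nonneg z), ENNReal.ofReal_pow (norm_nonneg _), ofReal_norm]

theorem exists_small_ball (hN : N ≠ 0) {c : ℝ≥0∞} (hc : c ≠ ⊤) :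
    ∃ ρ : ℝ, 0 < ρ ∧ 2 * Real.pi * ρ ≤ 1 ∧
      volume (Metric.ball (0 : Rn N) ρ) * c ≤ 2⁻¹ := by
  have h1 : Tendsto (fun ρ : ℝ => ENNReal.ofReal (ρ ^ N) *
      volume (Metric.ball (0 : Rn N) 1) * c) (𝓝 0) (𝓝 0) := by
    have h2 : Tendsto (fun ρ : ℝ => ENNReal.ofReal (ρ ^ N)) (𝓝 0) (𝓝 0) := by
      have : Continuous fun ρ : ℝ => ENNReal.ofReal (ρ ^ N) :=
        ENNReal.continuous_ofReal.comp (continuous_pow N)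
      simpa [hN] using this.tendsto 0
    have h3 := ENNReal.Tendsto.mul_const (b := volume (Metric.ball (0 : Rn N) 1) * c) h2
      (Or.inr (ENNReal.mul_ne_top measure_ball_lt_top.ne hc))
    simpa [mul_assoc] using h3
  have h2 : ∀ᶠ ρ : ℝ in 𝓝 0, ENNReal.ofReal (ρ ^ N) *
      volume (Metric.ball (0 : Rn N) 1) * c ≤ 2⁻¹ :=
    (h1.eventually_lt_const (by simp)).mono fun _ h => h.le
  have h3 : ∀ᶠ ρ : ℝ in 𝓝 0, 2 * Real.pi * ρ ≤ 1 := by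
    have : Continuous fun ρ : ℝ => 2 * Real.pi * ρ := by fun_prop
    have h4 := this.tendsto 0
    exact (h4.eventually_lt_const (by simp)).mono fun _ h => h.le
  obtain ⟨ρ, ⟨h4, h5⟩, h6⟩ := (((h2.and h3).filter_mono nhdsWithin_le_nhds).and
    (self_mem_nhdsWithin : Ioi (0 : ℝ) ∈ 𝓝[>] 0)).exists
  refine ⟨ρ, h6, h5, ?_⟩
  rw [Measure.addHaar_ball_of_pos _ _ h6, finrank_euclideanSpace, Fintype.card_fin]
  exact h4

theorem one_le_mul_weight {ρ : ℝ} (hρ : 0 < ρ) (hρ1 : 2 * Real.pi * ρ ≤ 1) {t : ℝ} (ht0 : 0 ≤ t)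
    (ht1 : t ≤ 1) {ξ : Rn N} (hξ : ρ ≤ ‖ξ‖) :
    1 ≤ ((2 * Real.pi * ρ) ^ 2)⁻¹ * weight (t, ξ) := by
  have hpi := Real.pi_pos
  have h1 : 0 < 2 * Real.pi * ρ := by positivity
  rw [inv_mul_eq_div, one_le_div (by positivity), weight, ← Real.rpow_natCast]
  calc (2 * Real.pi * ρ) ^ ((2 : ℕ) : ℝ) ≤ (2 * Real.pi * ρ) ^ (2 * t) :=
        Real.rpow_le_rpow_of_exponent_ge h1 hρ1 (by push_cast; linarith)
    _ ≤ (2 * Real.pi * ‖ξ‖) ^ (2 * t) := by gcongr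

theorem weight_le {s t : ℝ} (hs : 0 ≤ s) (hst : s ≤ t) (ξ : Rn N) :
    weight (s, ξ) ≤ 1 + weight (t, ξ) := by
  have h0 : 0 ≤ 2 * Real.pi * ‖ξ‖ := by positivity
  rcases le_total (2 * Real.pi * ‖ξ‖) 1 with h | h
  · exact (Real.rpow_le_one h0 h (by linarith)).trans (le_add_of_nonneg_right (weight_nonneg _))
  · refine le_trans ?_ (le_add_of_nonneg_left zero_le_one)
    exact Real.rpow_le_rpow_of_exponent_le h (by linarith)

/-- The seminorms of functions that vanish outside a bounded set are monotone in the order, up to a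
constant that depends on the set only. -/
theorem exists_seminormSq_le (hN : N ≠ 0) {Ω : Set (Rn N)} (hΩ : MeasurableSet Ω)
    (hΩv : volume Ω ≠ ⊤) : ∃ C : ℝ, 0 < C ∧ ∀ u : Rn N → ℝ, MemL12 u →
      (∀ᵐ x ∂volume, x ∉ Ω → u x = 0) → ∀ s t : ℝ, 0 ≤ s → s ≤ t → t ≤ 1 →
        seminormSq s u ≤ ENNReal.ofReal C * seminormSq t u := by
  obtain ⟨ρ, hρ, hρ1, hvol⟩ := exists_small_ball hN hΩv
  have hpi := Real.pi_pos
  set K : ℝ := ((2 * Real.pi * ρ) ^ 2)⁻¹ with hK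
  have hK0 : 0 < K := by positivity
  refine ⟨2 * K + 1, by positivity, fun u hu h0 s t hs hst ht => ?_⟩
  have hft := (continuous_ft hu.1).measurable
  rw [seminormSq_eq_lintegral_weight ⟨hs, hst.trans ht⟩ hu,
    seminormSq_eq_lintegral_weight ⟨hs.trans hst, ht⟩ hu]
  simp only [ofReal_weight_mul]
  have hmt : Measurable fun ξ : Rn N => ENNReal.ofReal (weight (t, ξ)) * ‖ft u ξ‖ₑ ^ 2 :=
    ((measurable_weight.comp (by fun_prop : Measurable fun ξ : Rn N => (t, ξ))).ennreal_ofReal).mul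
      (hft.enorm.pow_const 2)
  set Et := ∫⁻ ξ : Rn N, ENNReal.ofReal (weight (t, ξ)) * ‖ft u ξ‖ₑ ^ 2 with hEt
  set T := ∫⁻ ξ, ‖ft u ξ‖ₑ ^ 2 with hT
  have hTu : T = ∫⁻ x, ‖u x‖ₑ ^ 2 := lintegral_enorm_sq_ft hu
  have hTfin : T ≠ ⊤ := by
    have h1 := lintegral_norm_sq_ft hu
    have h2 := (lintegral_sq_lt_top hu.2).ne
    rw [← h1] at h2
    convert h2 using 3
    rw [ENNReal.ofReal_pow (norm_nonneg _), ofReal_norm]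
  have hsplit := lintegral_add_compl (μ := volume) (fun ξ => ‖ft u ξ‖ₑ ^ 2)
    (Metric.isOpen_ball (x := (0 : Rn N)) (ε := ρ)).measurableSet
  have hin : ∫⁻ ξ in Metric.ball (0 : Rn N) ρ, ‖ft u ξ‖ₑ ^ 2 ≤ 2⁻¹ * T := by
    calc ∫⁻ ξ in Metric.ball (0 : Rn N) ρ, ‖ft u ξ‖ₑ ^ 2
        ≤ ∫⁻ _ξ in Metric.ball (0 : Rn N) ρ, volume Ω * T :=
          lintegral_mono fun ξ => hTu ▸ enorm_ft_sq_le hΩ hu.1.1 h0 ξ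
      _ = volume (Metric.ball (0 : Rn N) ρ) * volume Ω * T := by
          rw [setLIntegral_const]; ring
      _ ≤ 2⁻¹ * T := by gcongr
  have hout : ∫⁻ ξ in (Metric.ball (0 : Rn N) ρ)ᶜ, ‖ft u ξ‖ₑ ^ 2 ≤ ENNReal.ofReal K * Et := by
    rw [hEt, ← lintegral_const_mul _ hmt]
    refine le_trans (setLIntegral_mono' Metric.isOpen_ball.measurableSet.compl fun ξ hξ => ?_)
      (setLIntegral_le_lintegral _ _)
    have hξ' : ρ ≤ ‖ξ‖ := by simpa using hξ
    have h1 := one_le_mul_weight hρ hρ1 (hs.trans hst) ht hξ'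
    rw [← mul_assoc, ← ENNReal.ofReal_mul hK0.le]
    calc ‖ft u ξ‖ₑ ^ 2 = 1 * ‖ft u ξ‖ₑ ^ 2 := (one_mul _).symm
      _ ≤ _ := by
        gcongr
        rw [← ENNReal.ofReal_one]
        exact ENNReal.ofReal_le_ofReal h1
  have hTle : T ≤ 2 * (ENNReal.ofReal K * Et) := by
    by_cases hE : ENNReal.ofReal K * Et = ⊤
    · rw [hE]; simp
    have h1 : T ≤ 2⁻¹ * T + ENNReal.ofReal K * Et :=
      hsplit.symm.trans_le (add_le_add hin hout)
    have h2 : 2⁻¹ * T ≠ ⊤ := by finiteness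
    have h3 := (ENNReal.toReal_le_toReal hTfin (by finiteness)).2 h1
    rw [ENNReal.toReal_add h2 hE, ENNReal.toReal_mul, ENNReal.toReal_inv, ENNReal.toReal_ofNat] at h3
    rw [← ENNReal.toReal_le_toReal hTfin (by finiteness), ENNReal.toReal_mul,
      ENNReal.toReal_ofNat]
    linarith
  calc ∫⁻ ξ : Rn N, ENNReal.ofReal (weight (s, ξ)) * ‖ft u ξ‖ₑ ^ 2
      ≤ ∫⁻ ξ : Rn N, (‖ft u ξ‖ₑ ^ 2 + ENNReal.ofReal (weight (t, ξ)) * ‖ft u ξ‖ₑ ^ 2) := by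
        refine lintegral_mono fun ξ => ?_
        have h1 := ENNReal.ofReal_le_ofReal (weight_le hs hst ξ)
        rw [ENNReal.ofReal_add zero_le_one (weight_nonneg _), ENNReal.ofReal_one] at h1
        calc _ ≤ (1 + ENNReal.ofReal (weight (t, ξ))) * ‖ft u ξ‖ₑ ^ 2 := by gcongr
          _ = _ := by ring
    _ = T + Et := lintegral_add_left (hft.enorm.pow_const 2) _
    _ ≤ 2 * (ENNReal.ofReal K * Et) + Et := by gcongr
    _ = ENNReal.ofReal (2 * K + 1) * Et := by
        rw [ENNReal.ofReal_add (by positivity) zero_le_one, ENNReal.ofReal_mul zero_le_two,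
          ENNReal.ofReal_one, ENNReal.ofReal_ofNat]
        ring

end Poincare

section Compactness

variable {N : ℕ}

theorem norm_fourierChar_sub_le (s t : ℝ) :
    ‖(Real.fourierChar s : ℂ) - Real.fourierChar t‖ ≤ 2 * Real.pi * |s - t| := by
  have h1 : (Real.fourierChar s : ℂ) - Real.fourierChar t =
      Real.fourierChar t * (Complex.exp (Complex.I * ((2 * Real.pi * (s - t) : ℝ) : ℂ)) - 1) := by
    rw [Real.fourierChar_apply, Real.fourierChar_apply, mul_sub, ← Complex.exp_add, mul_one]
    congr 2
    push_cast
    ring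
  rw [h1, norm_mul, Circle.norm_coe, one_mul]
  refine Real.norm_exp_I_mul_ofReal_sub_one_le.trans_eq ?_
  rw [Real.norm_eq_abs, abs_mul, abs_of_pos (by positivity)]

theorem norm_ft_sub_le {u : Rn N → ℝ} (hu : Integrable u) {r : ℝ}
    (h0 : ∀ᵐ x ∂volume, r < ‖x‖ → u x = 0) (ξ η : Rn N) :
    ‖ft u ξ - ft u η‖ ≤ 2 * Real.pi * r * (∫ x, |u x|) * ‖ξ - η‖ := by
  have hc : Integrable (fun x => (u x : ℂ)) := hu.ofReal
  rw [ft_apply, ft_apply, ← integral_sub (integrable_fourierChar_mul hc ξ)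
    (integrable_fourierChar_mul hc η)]
  have h1 : ∀ᵐ x ∂volume, ‖(Real.fourierChar (-inner ℝ x ξ) : ℂ) * (u x : ℂ) -
      (Real.fourierChar (-inner ℝ x η) : ℂ) * (u x : ℂ)‖ ≤
      2 * Real.pi * r * ‖ξ - η‖ * |u x| := by
    filter_upwards [h0] with x hx
    rw [← sub_mul, norm_mul, Complex.norm_real, Real.norm_eq_abs]
    by_cases hr : r < ‖x‖
    · simp [hx hr]
    refine mul_le_mul_of_nonneg_right ((norm_fourierChar_sub_le _ _).trans ?_) (abs_nonneg _)
    rw [mul_assoc (2 * Real.pi)]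
    refine mul_le_mul_of_nonneg_left ?_ (by positivity)
    rw [neg_sub_neg, ← inner_sub_right, norm_sub_rev]
    exact (abs_real_inner_le_norm _ _).trans
      (mul_le_mul_of_nonneg_right (not_lt.1 hr) (norm_nonneg _))
  refine (norm_integral_le_of_norm_le (hu.abs.const_mul _) h1).trans_eq ?_
  rw [integral_const_mul]
  ring

/-- A uniformly bounded and uniformly Lipschitz sequence of functions on a separable space has a
pointwise convergent subsequence. -/
theorem exists_subseq_tendsto_of_lipschitz {X : Type*} [PseudoMetricSpace X]
    [TopologicalSpace.SeparableSpace X] [Nonempty X] (f : ℕ → X → ℂ) {R L : ℝ}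
    (hR : ∀ n x, ‖f n x‖ ≤ R) (hL : ∀ n x y, ‖f n x - f n y‖ ≤ L * dist x y) :
    ∃ φ : ℕ → ℕ, StrictMono φ ∧ ∀ x, CauchySeq fun n => f (φ n) x := by
  let d := TopologicalSpace.denseSeq X
  have hcomp : IsCompact (Set.pi univ fun _ : ℕ => Metric.closedBall (0 : ℂ) R) :=
    isCompact_univ_pi fun _ => isCompact_closedBall _ _
  obtain ⟨g, -, φ, hφ, hg⟩ := hcomp.isSeqCompact (x := fun n k => f n (d k))
    fun n k _ => by simpa using hR n (d k)
  refine ⟨φ, hφ, fun x => ?_⟩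
  rw [Metric.cauchySeq_iff]
  intro ε hε
  have hL1 : 0 < |L| + 1 := by positivity
  obtain ⟨k, hk⟩ := (TopologicalSpace.denseRange_denseSeq X).exists_dist_lt x
    (show 0 < ε / (4 * (|L| + 1)) by positivity)
  have hclose : ∀ n, ‖f n x - f n (d k)‖ ≤ ε / 4 := by
    intro n
    refine (hL n x (d k)).trans ?_
    calc L * dist x (d k) ≤ (|L| + 1) * (ε / (4 * (|L| + 1))) := by
          refine mul_le_mul (by linarith [le_abs_self L]) hk.le dist_nonneg hL1.le
      _ = ε / 4 := by field_simp
  have hc : CauchySeq fun n => f (φ n) (d k) := ((tendsto_pi_nhds.1 hg) k).cauchySeq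
  obtain ⟨n0, hn0⟩ := Metric.cauchySeq_iff.1 hc (ε / 4) (by positivity)
  refine ⟨n0, fun m hm n hn => ?_⟩
  have h1 := hn0 m hm n hn
  rw [dist_eq_norm] at h1 ⊢
  have h2 : f (φ m) x - f (φ n) x = (f (φ m) x - f (φ m) (d k)) +
      (f (φ m) (d k) - f (φ n) (d k)) - (f (φ n) x - f (φ n) (d k)) := by ring
  rw [h2]
  refine (norm_sub_le _ _).trans_lt ?_
  have := norm_add_le (f (φ m) x - f (φ m) (d k)) (f (φ m) (d k) - f (φ n) (d k))
  linarith [hclose (φ m), hclose (φ n)]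

theorem rpow_le_weight {R : ℝ} (hR : 1 ≤ 2 * Real.pi * R) {σ s : ℝ} (hσ : 0 ≤ σ) (hs : σ ≤ s)
    {ξ : Rn N} (hξ : R ≤ ‖ξ‖) : (2 * Real.pi * R) ^ (2 * σ) ≤ weight (s, ξ) := by
  have hpi := Real.pi_pos
  calc (2 * Real.pi * R) ^ (2 * σ) ≤ (2 * Real.pi * R) ^ (2 * s) :=
        Real.rpow_le_rpow_of_exponent_le hR (by linarith)
    _ ≤ (2 * Real.pi * ‖ξ‖) ^ (2 * s) := by
        refine Real.rpow_le_rpow (by linarith) ?_ (by linarith)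
        gcongr

/-- The high frequencies are controlled by the energy. -/
theorem lintegral_compl_ball_le (m : Measure ℝ) [SFinite m] {σ R : ℝ} (hσ : 0 ≤ σ)
    (hR : 1 ≤ 2 * Real.pi * R) {u : Rn N → ℝ} (hu : MemL12 u) :
    m (Icc σ 1) * (ENNReal.ofReal ((2 * Real.pi * R) ^ (2 * σ)) *
      ∫⁻ ξ in (Metric.ball (0 : Rn N) R)ᶜ, ‖ft u ξ‖ₑ ^ 2) ≤ energyOn m (Icc 0 1) u := by
  have hft := (continuous_ft hu.1).measurable
  calc _ = ∫⁻ _s in Icc σ 1, ENNReal.ofReal ((2 * Real.pi * R) ^ (2 * σ)) *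
        (∫⁻ ξ in (Metric.ball (0 : Rn N) R)ᶜ, ‖ft u ξ‖ₑ ^ 2) ∂m := by
        rw [setLIntegral_const, mul_comm]
    _ ≤ ∫⁻ s in Icc σ 1, seminormSq s u ∂m := by
        refine setLIntegral_mono' measurableSet_Icc fun s hs => ?_
        rw [seminormSq_eq_lintegral_weight ⟨hσ.trans hs.1, hs.2⟩ hu,
          ← lintegral_const_mul _ (hft.enorm.pow_const 2)]
        refine le_trans (setLIntegral_mono' Metric.isOpen_ball.measurableSet.compl fun ξ hξ => ?_)
          (setLIntegral_le_lintegral _ _)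
        have hξ' : R ≤ ‖ξ‖ := by simpa using hξ
        rw [ofReal_weight_mul]
        gcongr
        exact rpow_le_weight hR hσ hs.1 hξ'
    _ ≤ energyOn m (Icc 0 1) u := lintegral_mono_set (Icc_subset_Icc_left hσ)

theorem energyOn_sub_le (m : Measure ℝ) [SFinite m] {S : Set ℝ} (hS : MeasurableSet S)
    (hS1 : S ⊆ Icc 0 1) {u v : Rn N → ℝ} (hu : MemL12 u) (hv : MemL12 v) :
    energyOn m S (u - v) ≤ 2 * energyOn m S u + 2 * energyOn m S v := by
  rw [energyOn_eq_specEnergy m hS hS1 hu, energyOn_eq_specEnergy m hS hS1 hv,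
    energyOn_eq_specEnergy m hS hS1 (hu.sub hv)]
  exact specEnergy_sub_le _ hu.1 hv.1

/-- Sequences of functions that vanish outside a bounded set and are bounded in energy have
subsequences that converge in `L²`. -/
theorem exists_subseq_cauchy_L2 {Ω : Set (Rn N)} (hΩ : MeasurableSet Ω)
    (hΩb : Bornology.IsBounded Ω) (m : Measure ℝ) [SFinite m] {σ : ℝ} (hσ : 0 < σ)
    (hm : m (Icc σ 1) ≠ 0) {u : ℕ → Rn N → ℝ} (hu : ∀ n, MemL12 (u n))
    (h0 : ∀ n, ∀ᵐ x ∂volume, x ∉ Ω → u n x = 0) {B : ℝ≥0∞} (hB : B ≠ ⊤)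
    (hB2 : ∀ n, ∫⁻ x, ‖u n x‖ₑ ^ 2 ≤ B) (hBE : ∀ n, energyOn m (Icc 0 1) (u n) ≤ B) :
    ∃ φ : ℕ → ℕ, StrictMono φ ∧
      Tendsto (fun p : ℕ × ℕ => ∫⁻ x, ‖(u (φ p.1) - u (φ p.2)) x‖ₑ ^ 2) atTop (𝓝 0) := by
  have hpi := Real.pi_pos
  have hvol : volume Ω ≠ ⊤ := hΩb.measure_lt_top.ne
  obtain ⟨r, hr0, hr⟩ := hΩb.subset_closedBall_lt 0 0
  have hKfin : (volume Ω * B) ^ (1 / 2 : ℝ) ≠ ⊤ := by finiteness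
  set K : ℝ := ((volume Ω * B) ^ (1 / 2 : ℝ)).toReal with hK
  have hint : ∀ n, ∫ x, |u n x| ≤ K := by
    intro n
    have h1 : ∫⁻ x, ‖u n x‖ₑ ≤ (volume Ω * B) ^ (1 / 2 : ℝ) := by
      have h2 := (lintegral_enorm_sq_le_of_support hΩ (hu n).1.1 (h0 n)).trans
        (mul_le_mul_right (hB2 n) (volume Ω))
      rw [← ENNReal.rpow_le_rpow_iff (z := 2) two_pos, ← ENNReal.rpow_mul]
      norm_num
      exact h2
    have h3 : ∫ x, |u n x| = (∫⁻ x, ‖u n x‖ₑ).toReal := by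
      rw [← integral_norm_eq_lintegral_enorm (hu n).1.1]
      rfl
    rw [h3]
    exact ENNReal.toReal_mono hKfin h1
  have hK0 : 0 ≤ K := ENNReal.toReal_nonneg
  obtain ⟨φ, hφ, hcauchy⟩ := exists_subseq_tendsto_of_lipschitz (fun n => ft (u n)) (R := K)
    (L := 2 * Real.pi * r * K) (fun n ξ => (norm_ft_le _ _).trans (hint n)) (fun n ξ η => by
      refine (norm_ft_sub_le (r := r) (hu n).1
        ((h0 n).mono fun x hx hxr => hx fun hxΩ => ?_) ξ η).trans ?_
      · exact absurd (by simpa using hr hxΩ) (not_le.2 hxr)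
      · rw [dist_eq_norm]
        gcongr
        exact hint n)
  refine ⟨φ, hφ, ?_⟩
  have hmem : ∀ p : ℕ × ℕ, MemL12 (u (φ p.1) - u (φ p.2)) := fun p => (hu _).sub (hu _)
  rw [ENNReal.tendsto_nhds_zero]
  intro ε hε
  obtain ⟨ε', hε', hε'top, hε'le⟩ : ∃ ε' : ℝ≥0∞, 0 < ε' ∧ ε' ≠ ⊤ ∧ ε' ≤ ε :=
    ⟨min ε 1, lt_min hε one_pos, ne_top_of_le_ne_top ENNReal.one_ne_top (min_le_right _ _),
      min_le_left _ _⟩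
  have hhalf : 0 < ε' / 2 := ENNReal.half_pos hε'.ne'
  obtain ⟨R, hR1, hRtail⟩ : ∃ R : ℝ, 1 ≤ 2 * Real.pi * R ∧ 4 * B / (m (Icc σ 1) *
      ENNReal.ofReal ((2 * Real.pi * R) ^ (2 * σ))) ≤ ε' / 2 := by
    have h1 : Tendsto (fun R : ℝ => m (Icc σ 1) * ENNReal.ofReal ((2 * Real.pi * R) ^ (2 * σ)))
        atTop (𝓝 ⊤) := by
      have h2 : Tendsto (fun R : ℝ => (2 * Real.pi * R) ^ (2 * σ)) atTop atTop :=
        (tendsto_rpow_atTop (by positivity)).comp (tendsto_id.const_mul_atTop (by positivity))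
      have h3 := ENNReal.Tendsto.const_mul (a := m (Icc σ 1))
        (ENNReal.tendsto_ofReal_atTop.comp h2) (Or.inl ENNReal.top_ne_zero)
      rwa [ENNReal.mul_top hm] at h3
    have h4 := ENNReal.Tendsto.const_div (a := 4 * B) h1 (Or.inr (by finiteness))
    rw [ENNReal.div_top] at h4
    have h5 := (h4.eventually_lt_const hhalf).and (eventually_ge_atTop (2 * Real.pi)⁻¹)
    obtain ⟨R, hR, hR'⟩ := h5.exists
    refine ⟨R, ?_, hR.le⟩
    rwa [inv_le_iff_one_le_mul₀' (by positivity)] at hR'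
  have hnear : Tendsto (fun p : ℕ × ℕ => ∫⁻ ξ in Metric.ball (0 : Rn N) R,
      ‖ft (u (φ p.1)) ξ - ft (u (φ p.2)) ξ‖ₑ ^ 2) atTop (𝓝 0) := by
    have h1 := tendsto_lintegral_filter_of_dominated_convergence (l := (atTop : Filter (ℕ × ℕ)))
      (μ := volume.restrict (Metric.ball (0 : Rn N) R))
      (F := fun p ξ => ‖ft (u (φ p.1)) ξ - ft (u (φ p.2)) ξ‖ₑ ^ 2) (f := fun _ => 0)
      (fun _ => ENNReal.ofReal (2 * K) ^ 2) (Eventually.of_forall fun p => by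
        have h1 := (continuous_ft (hu (φ p.1)).1).measurable
        have h2 := (continuous_ft (hu (φ p.2)).1).measurable
        exact (h1.sub h2).enorm.pow_const 2)
      (Eventually.of_forall fun p => ae_of_all _ fun ξ => by
        gcongr
        rw [← ofReal_norm]
        apply ENNReal.ofReal_le_ofReal
        refine (norm_sub_le _ _).trans ?_
        linarith [(norm_ft_le (u (φ p.1)) ξ).trans (hint _),
          (norm_ft_le (u (φ p.2)) ξ).trans (hint _)])
      (by
        rw [setLIntegral_const]
        exact ENNReal.mul_ne_top (by finiteness) measure_ball_lt_top.ne)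
      (ae_of_all _ fun ξ => by
        have h2 := (cauchySeq_iff_tendsto_dist_atTop_0.1 (hcauchy ξ))
        have h3 := (ENNReal.continuous_ofReal.tendsto 0).comp h2
        have h4 := ((ENNReal.continuous_pow 2).tendsto _).comp h3
        simp only [ENNReal.ofReal_zero, ne_eq, OfNat.ofNat_ne_zero, not_false_eq_true,
          zero_pow] at h4
        refine h4.congr fun p => ?_
        simp only [Function.comp_apply]
        rw [dist_eq_norm, ofReal_norm])
    simpa using h1
  filter_upwards [hnear.eventually_lt_const hhalf] with p hp
  refine le_trans ?_ hε'le
  rw [← lintegral_enorm_sq_ft (hmem p), ← lintegral_add_compl (μ := volume) _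
    (Metric.isOpen_ball (x := (0 : Rn N)) (ε := R)).measurableSet, ← ENNReal.add_halves ε']
  refine add_le_add ?_ ?_
  · rw [ft_sub (hu _).1 (hu _).1]
    exact hp.le
  · refine le_trans ?_ hRtail
    have h1 := lintegral_compl_ball_le m hσ.le hR1 (hmem p)
    have h2 := h1.trans ((energyOn_sub_le m measurableSet_Icc subset_rfl (hu _) (hu _)).trans
      (add_le_add (mul_le_mul_right (hBE _) 2) (mul_le_mul_right (hBE _) 2)))
    have hpos : 0 < (2 * Real.pi * R) ^ (2 * σ) := Real.rpow_pos_of_pos (by linarith) _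
    rw [ENNReal.le_div_iff_mul_le (Or.inl (mul_ne_zero hm (by simpa using hpos)))
      (Or.inr (by finiteness))]
    refine le_trans (le_of_eq ?_) (h2.trans_eq ?_) <;> ring

end Compactness

section Space

open scoped FourierTransform SchwartzMap

variable {N : ℕ}

theorem IsTestFunction.add {φ ψ : Rn N → ℝ} (hφ : IsTestFunction φ) (hψ : IsTestFunction ψ) :
    IsTestFunction (φ + ψ) :=
  ⟨hφ.1.add hψ.1, hφ.2.add hψ.2⟩

theorem IsTestFunction.smul {φ : Rn N → ℝ} (hφ : IsTestFunction φ) (c : ℝ) :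
    IsTestFunction (c • φ) :=
  ⟨hφ.1.const_smul c, hφ.2.smul_left (f := fun _ => c)⟩

theorem energyOn_congr (m : Measure ℝ) (S : Set ℝ) {u v : Rn N → ℝ} (h : u =ᵐ[volume] v) :
    energyOn m S u = energyOn m S v := by
  simp only [energyOn, seminormSq_congr h]

theorem energyOn_add_le (m : Measure ℝ) [SFinite m] {S : Set ℝ} (hS : MeasurableSet S)
    (hS1 : S ⊆ Icc 0 1) {u v : Rn N → ℝ} (hu : MemL12 u) (hv : MemL12 v) :
    energyOn m S (u + v) ≤ 2 * energyOn m S u + 2 * energyOn m S v := by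
  rw [energyOn_eq_specEnergy m hS hS1 hu, energyOn_eq_specEnergy m hS hS1 hv,
    energyOn_eq_specEnergy m hS hS1 (hu.add hv)]
  exact specEnergy_add_le _ hu.1 hv.1

theorem energyOn_smul (m : Measure ℝ) [SFinite m] {S : Set ℝ} (hS : MeasurableSet S)
    (hS1 : S ⊆ Icc 0 1) {u : Rn N → ℝ} (hu : MemL12 u) (c : ℝ) :
    energyOn m S (c • u) = ENNReal.ofReal (c ^ 2) * energyOn m S u := by
  rw [energyOn_eq_specEnergy m hS hS1 hu, energyOn_eq_specEnergy m hS hS1 (hu.smul c)]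
  exact specEnergy_smul _ hu.1 c

theorem IsTestFunction.seminormSq_one_lt_top {φ : Rn N → ℝ} (hφ : IsTestFunction φ) :
    seminormSq 1 φ < ⊤ := by
  rw [seminormSq_eq_lintegral_ft ⟨zero_le_one, le_rfl⟩ hφ.memL12]
  have hc : HasCompactSupport (fun x => (φ x : ℂ)) := hφ.2.comp_left (g := Complex.ofReal) rfl
  have hs : ContDiff ℝ ∞ (fun x => (φ x : ℂ)) := Complex.ofRealCLM.contDiff.comp hφ.1
  have h1 := (𝓕 (hc.toSchwartzMap hs)).integrable_pow_mul volume 2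
  have h2 : ∀ ξ, (𝓕 (hc.toSchwartzMap hs)) ξ = ft φ ξ := fun ξ => by
    rw [SchwartzMap.fourier_coe]; rfl
  simp only [h2] at h1
  have h3 := (h1.const_mul ((2 * Real.pi) ^ 2 * ∫ x, |φ x|)).lintegral_lt_top
  refine lt_of_le_of_lt (lintegral_mono fun ξ => ENNReal.ofReal_le_ofReal ?_) h3
  rw [mul_one, Real.rpow_two, mul_pow]
  calc (2 * Real.pi) ^ 2 * ‖ξ‖ ^ 2 * ‖ft φ ξ‖ ^ 2
      = ((2 * Real.pi) ^ 2 * ‖ξ‖ ^ 2 * ‖ft φ ξ‖) * ‖ft φ ξ‖ := by ring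
    _ ≤ ((2 * Real.pi) ^ 2 * ‖ξ‖ ^ 2 * ‖ft φ ξ‖) * ∫ x, |φ x| :=
        mul_le_mul_of_nonneg_left (norm_ft_le φ ξ) (by positivity)
    _ = _ := by ring

theorem seminormSq_le_add {s t : ℝ} (hs : 0 ≤ s) (hst : s ≤ t) (ht : t ≤ 1) {u : Rn N → ℝ}
    (hu : MemL12 u) : seminormSq s u ≤ (∫⁻ x, ‖u x‖ₑ ^ 2) + seminormSq t u := by
  rw [seminormSq_eq_lintegral_weight ⟨hs, hst.trans ht⟩ hu,
    seminormSq_eq_lintegral_weight ⟨hs.trans hst, ht⟩ hu, ← lintegral_enorm_sq_ft hu,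
    ← lintegral_add_left ((continuous_ft hu.1).measurable.enorm.pow_const 2)]
  refine lintegral_mono fun ξ => ?_
  rw [ofReal_weight_mul, ofReal_weight_mul, ← one_add_mul]
  gcongr
  rw [← ENNReal.ofReal_one, ← ENNReal.ofReal_add zero_le_one (weight_nonneg _)]
  exact ENNReal.ofReal_le_ofReal (weight_le hs hst ξ)

theorem MemL12.lintegral_enorm_sq_ne_top {u : Rn N → ℝ} (hu : MemL12 u) :
    ∫⁻ x, ‖u x‖ₑ ^ 2 ≠ ⊤ := by
  have h := (lintegral_sq_lt_top hu.2).ne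
  rw [← lintegral_norm_sq_ft hu] at h
  rw [← lintegral_enorm_sq_ft hu]
  convert h using 3 with ξ
  rw [ENNReal.ofReal_pow (norm_nonneg _), ofReal_norm]

theorem IsTestFunction.energyOn_ne_top {φ : Rn N → ℝ} (hφ : IsTestFunction φ) (m : Measure ℝ)
    [IsFiniteMeasure m] {S : Set ℝ} (hS : MeasurableSet S) (hS1 : S ⊆ Icc 0 1) :
    energyOn m S φ ≠ ⊤ := by
  have h := hφ.memL12.lintegral_enorm_sq_ne_top
  have h' := hφ.seminormSq_one_lt_top.ne
  refine ne_top_of_le_ne_top (b := ((∫⁻ x, ‖φ x‖ₑ ^ 2) + seminormSq 1 φ) * m S) (by finiteness) ?_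
  rw [← setLIntegral_const]
  exact setLIntegral_mono' hS fun s hs =>
    seminormSq_le_add (hS1 hs).1 (hS1 hs).2 le_rfl hφ.memL12

theorem MemX.exists_approx {μp : Measure ℝ} {u : Rn N → ℝ} (hu : MemX μp u) {ε : ℝ≥0∞}
    (hε : 0 < ε) {K : Set (Rn N)} (hK : IsCompact K) :
    ∃ φ, IsTestFunction φ ∧ normXSq μp (u - φ) ≤ ε ∧
      eLpNorm (u - φ) 2 (volume.restrict K) ≤ ε := by
  obtain ⟨-, φ, hφ, h1, h2⟩ := hu
  obtain ⟨n, hn1, hn2⟩ :=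
    ((h1.eventually_le_const hε).and ((h2 K hK).eventually_le_const hε)).exists
  exact ⟨φ n, hφ n, hn1, hn2⟩

theorem memX_of_forall_exists {μp : Measure ℝ} {u : Rn N → ℝ} (hu : AEStronglyMeasurable u volume)
    (h : ∀ ε : ℝ≥0∞, 0 < ε → ∀ K : Set (Rn N), IsCompact K → ∃ φ, IsTestFunction φ ∧
      normXSq μp (u - φ) ≤ ε ∧ eLpNorm (u - φ) 2 (volume.restrict K) ≤ ε) : MemX μp u := by
  have h0 : Tendsto (fun n : ℕ => ((n : ℝ≥0∞) + 1)⁻¹) atTop (𝓝 0) := by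
    have := (tendsto_add_atTop_iff_nat 1).2 ENNReal.tendsto_inv_nat_nhds_zero
    simpa using this
  choose φ hφ h1 h2 using fun n : ℕ => h ((n : ℝ≥0∞) + 1)⁻¹ (ENNReal.inv_pos.2 (by finiteness))
    (Metric.closedBall 0 n) (isCompact_closedBall _ _)
  refine ⟨hu, φ, hφ, tendsto_of_tendsto_of_tendsto_of_le_of_le tendsto_const_nhds h0
    (fun _ => zero_le) h1, fun K hK => ?_⟩
  obtain ⟨r, hr⟩ := hK.isBounded.subset_closedBall 0
  obtain ⟨n0, hn0⟩ := exists_nat_ge r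
  refine tendsto_of_tendsto_of_tendsto_of_le_of_le' tendsto_const_nhds h0
    (Eventually.of_forall fun _ => zero_le) ?_
  filter_upwards [eventually_ge_atTop n0] with n hn
  refine (eLpNorm_mono_measure _ (Measure.restrict_mono (hr.trans
    (Metric.closedBall_subset_closedBall ?_)) le_rfl)).trans (h2 n)
  exact hn0.trans (by exact_mod_cast hn)

theorem MemXOn.memL12 {μp : Measure ℝ} {Ω : Set (Rn N)} (hΩb : Bornology.IsBounded Ω)
    {u : Rn N → ℝ} (hu : MemXOn μp Ω u) : MemL12 u := by
  have hK : IsCompact (closure Ω) := hΩb.isCompact_closure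
  obtain ⟨φ, hφ, -, h2⟩ := hu.1.exists_approx one_pos hK
  have h3 : MemLp (u - φ) 2 (volume.restrict (closure Ω)) :=
    ⟨(hu.1.1.sub hφ.1.continuous.aestronglyMeasurable).restrict, h2.trans_lt ENNReal.one_lt_top⟩
  have h4 : MemLp u 2 (volume.restrict (closure Ω)) := by
    simpa using h3.add (hφ.memL12.2.restrict (closure Ω))
  have h5 : (closure Ω).indicator u =ᵐ[volume] u := by
    filter_upwards [hu.2] with x hx
    by_cases hxc : x ∈ closure Ω
    · simp [hxc]
    · simp [hxc, hx fun h => hxc (subset_closure h)]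
  have : IsFiniteMeasure (volume.restrict (closure Ω)) := ⟨by simpa using hK.measure_lt_top⟩
  refine ⟨?_, ?_⟩
  · rw [← integrable_congr h5, integrable_indicator_iff hK.measurableSet]
    exact h4.integrable (by norm_num)
  · rw [← memLp_congr_ae h5, memLp_indicator_iff_restrict hK.measurableSet]
    exact h4

theorem MemXOn.normXSq_ne_top {μp : Measure ℝ} [IsFiniteMeasure μp] {Ω : Set (Rn N)}
    (hΩb : Bornology.IsBounded Ω) {u : Rn N → ℝ} (hu : MemXOn μp Ω u) : normXSq μp u ≠ ⊤ := by
  obtain ⟨φ, hφ, h1, -⟩ := hu.1.exists_approx one_pos isCompact_empty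
  have h2 := hφ.energyOn_ne_top μp measurableSet_Icc subset_rfl
  have h3 := energyOn_add_le μp measurableSet_Icc subset_rfl ((hu.memL12 hΩb).sub hφ.memL12)
    hφ.memL12
  rw [sub_add_cancel] at h3
  have h4 : energyOn μp (Icc 0 1) (u - φ) ≠ ⊤ := ne_top_of_le_ne_top ENNReal.one_ne_top h1
  exact ne_top_of_le_ne_top (by finiteness) h3

theorem eLpNorm_two_eq {α F : Type*} [MeasurableSpace α] [NormedAddCommGroup F] (f : α → F)
    (m : Measure α) : eLpNorm f 2 m = (∫⁻ x, ‖f x‖ₑ ^ 2 ∂m) ^ (1 / 2 : ℝ) := by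
  rw [eLpNorm_eq_lintegral_rpow_enorm_toReal (by norm_num) (by norm_num)]
  simp

/-- The space `X(Ω)` is closed under limits in energy and in `L²`. -/
theorem memXOn_of_forall_exists {μp : Measure ℝ} [IsFiniteMeasure μp] {Ω : Set (Rn N)}
    (hΩb : Bornology.IsBounded Ω) {w : Rn N → ℝ} (hw : MemL12 w)
    (h0 : ∀ᵐ x ∂volume, x ∉ Ω → w x = 0)
    (h : ∀ ε : ℝ≥0∞, 0 < ε → ∃ v, MemXOn μp Ω v ∧ normXSq μp (w - v) ≤ ε ∧
      ∫⁻ x, ‖(w - v) x‖ₑ ^ 2 ≤ ε) : MemXOn μp Ω w := by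
  refine ⟨memX_of_forall_exists hw.1.1 fun ε hε K hK => ?_, h0⟩
  have hε2 : 0 < ε / 2 := ENNReal.half_pos hε.ne'
  have hε4 : 0 < ε / 2 / 2 := ENNReal.half_pos hε2.ne'
  obtain ⟨v, hv, hv1, hv2⟩ := h (min (ε / 2 / 2) ((ε / 2) ^ 2))
    (lt_min hε4 (by positivity))
  obtain ⟨φ, hφ, hφ1, hφ2⟩ := hv.1.exists_approx hε4 hK
  have hvL := hv.memL12 hΩb
  have e : w - φ = (w - v) + (v - φ) := by abel
  refine ⟨φ, hφ, ?_, ?_⟩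
  · rw [e]
    refine (energyOn_add_le μp measurableSet_Icc subset_rfl (hw.sub hvL)
      (hvL.sub hφ.memL12)).trans ?_
    refine (add_le_add (mul_le_mul_right (hv1.trans (min_le_left _ _)) 2)
      (mul_le_mul_right hφ1 2)).trans_eq ?_
    rw [ENNReal.mul_div_cancel two_ne_zero ENNReal.ofNat_ne_top, ENNReal.add_halves]
  · rw [e]
    refine (eLpNorm_add_le (hw.sub hvL).1.1.restrict (hvL.sub hφ.memL12).1.1.restrict
      (by norm_num)).trans ?_
    have h5 : eLpNorm (w - v) 2 (volume.restrict K) ≤ ε / 2 := by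
      refine (eLpNorm_mono_measure _ Measure.restrict_le_self).trans ?_
      rw [eLpNorm_two_eq, ← ENNReal.rpow_le_rpow_iff (z := 2) two_pos, ← ENNReal.rpow_mul]
      norm_num
      exact hv2.trans (min_le_right _ _)
    refine (add_le_add h5 (hφ2.trans ENNReal.half_le_self)).trans_eq (ENNReal.add_halves ε)

theorem normXSq_zero (μp : Measure ℝ) : normXSq μp (0 : Rn N → ℝ) = 0 := by
  have h : ∀ s ∈ Icc (0 : ℝ) 1, seminormSq s (0 : Rn N → ℝ) = 0 := fun s hs => by
    have h2 : MemL12 (0 : Rn N → ℝ) := ⟨integrable_zero _ _ _, MemLp.zero⟩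
    rw [seminormSq_eq_lintegral_weight hs h2]
    have h3 : ft (0 : Rn N → ℝ) = 0 := by
      simpa using ft_smul 0 (0 : Rn N → ℝ)
    simp [h3]
  rw [normXSq, energyOn, setLIntegral_congr_fun measurableSet_Icc h]
  simp

theorem IsTestFunction.memXOn (μp : Measure ℝ) {Ω : Set (Rn N)} {φ : Rn N → ℝ}
    (hφ : IsTestFunction φ) (h0 : tsupport φ ⊆ Ω) : MemXOn μp Ω φ := by
  refine ⟨memX_of_forall_exists hφ.1.continuous.aestronglyMeasurable fun ε hε K hK =>
    ⟨φ, hφ, ?_, ?_⟩, ae_of_all _ fun x hx => image_eq_zero_of_notMem_tsupport fun h => hx (h0 h)⟩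
  · simp [normXSq_zero]
  · simp

theorem MemXOn.add {μp : Measure ℝ} [IsFiniteMeasure μp] {Ω : Set (Rn N)}
    (hΩb : Bornology.IsBounded Ω) {u v : Rn N → ℝ} (hu : MemXOn μp Ω u) (hv : MemXOn μp Ω v) :
    MemXOn μp Ω (u + v) := by
  have huL := hu.memL12 hΩb
  have hvL := hv.memL12 hΩb
  refine ⟨memX_of_forall_exists (huL.add hvL).1.1 fun ε hε K hK => ?_, ?_⟩
  · have hε2 : 0 < ε / 2 := ENNReal.half_pos hε.ne'
    have hε4 : 0 < ε / 2 / 2 := ENNReal.half_pos hε2.ne'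
    obtain ⟨φ, hφ, hφ1, hφ2⟩ := hu.1.exists_approx hε4 hK
    obtain ⟨ψ, hψ, hψ1, hψ2⟩ := hv.1.exists_approx hε4 hK
    have e : u + v - (φ + ψ) = (u - φ) + (v - ψ) := by abel
    refine ⟨φ + ψ, hφ.add hψ, ?_, ?_⟩
    · rw [e]
      refine (energyOn_add_le μp measurableSet_Icc subset_rfl (huL.sub hφ.memL12)
        (hvL.sub hψ.memL12)).trans ?_
      refine (add_le_add (mul_le_mul_right hφ1 2) (mul_le_mul_right hψ1 2)).trans_eq ?_
      rw [ENNReal.mul_div_cancel two_ne_zero ENNReal.ofNat_ne_top, ENNReal.add_halves]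
    · rw [e]
      refine (eLpNorm_add_le (huL.sub hφ.memL12).1.1.restrict (hvL.sub hψ.memL12).1.1.restrict
        (by norm_num)).trans ?_
      refine (add_le_add (hφ2.trans ENNReal.half_le_self)
        (hψ2.trans ENNReal.half_le_self)).trans_eq (ENNReal.add_halves ε)
  · filter_upwards [hu.2, hv.2] with x hx hx' hxΩ
    simp [hx hxΩ, hx' hxΩ]

theorem MemXOn.smul {μp : Measure ℝ} [IsFiniteMeasure μp] {Ω : Set (Rn N)}
    (hΩb : Bornology.IsBounded Ω) {u : Rn N → ℝ} (hu : MemXOn μp Ω u) (c : ℝ) :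
    MemXOn μp Ω (c • u) := by
  have huL := hu.memL12 hΩb
  refine ⟨memX_of_forall_exists (huL.smul c).1.1 fun ε hε K hK => ?_, ?_⟩
  · have hpos : 0 < 1 + c ^ 2 := by positivity
    have hε' : 0 < ε / ENNReal.ofReal (1 + c ^ 2) :=
      ENNReal.div_pos hε.ne' ENNReal.ofReal_ne_top
    obtain ⟨φ, hφ, hφ1, hφ2⟩ := hu.1.exists_approx hε' hK
    have hmul : ENNReal.ofReal (1 + c ^ 2) * (ε / ENNReal.ofReal (1 + c ^ 2)) = ε :=
      ENNReal.mul_div_cancel (by simpa using hpos) ENNReal.ofReal_ne_top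
    have e : c • u - c • φ = c • (u - φ) := (smul_sub _ _ _).symm
    refine ⟨c • φ, hφ.smul c, ?_, ?_⟩
    · rw [e, normXSq, energyOn_smul μp measurableSet_Icc subset_rfl (huL.sub hφ.memL12)]
      refine (mul_le_mul' (ENNReal.ofReal_le_ofReal ?_) hφ1).trans_eq hmul
      linarith
    · rw [e, eLpNorm_const_smul]
      refine (mul_le_mul' ?_ hφ2).trans_eq hmul
      rw [Real.enorm_eq_ofReal_abs]
      refine ENNReal.ofReal_le_ofReal (abs_le.2 ⟨?_, ?_⟩) <;>
        nlinarith [sq_nonneg (c - 1), sq_nonneg (c + 1)]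
  · filter_upwards [hu.2] with x hx hxΩ
    simp [hx hxΩ]

end Space

section Form

variable {N : ℕ}

/-- The hypotheses under which the form of the operator is coercive on `X(Ω)`. -/
structure Admissible (μp μm : Measure ℝ) (sbar : ℝ) (Ω : Set (Rn N)) : Prop where
  dim_ne_zero : N ≠ 0
  isOpen : IsOpen Ω
  isBounded : Bornology.IsBounded Ω
  nonempty : Ω.Nonempty
  order_pos : 0 < sbar
  order_le_one : sbar ≤ 1
  mass_ne_zero : μp (Icc sbar 1) ≠ 0
  dominated : ∀ u, MemXOn μp Ω u → energyOn μm (Ico 0 sbar) u ≤ 2⁻¹ * normXSq μp u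
  poincare : ∃ c : ℝ, 0 < c ∧ ∀ u, MemXOn μp Ω u →
    ENNReal.ofReal c * ∫⁻ x, ‖u x‖ₑ ^ 2 ≤ normXSq μp u

theorem Admissible.Ico_subset {μp μm : Measure ℝ} {sbar : ℝ} {Ω : Set (Rn N)}
    (A : Admissible μp μm sbar Ω) : Ico 0 sbar ⊆ Icc (0 : ℝ) 1 :=
  fun _ hs => ⟨hs.1, hs.2.le.trans A.order_le_one⟩

/-- The space `X(Ω)` as a space of functions. -/
def domX (μp : Measure ℝ) [IsFiniteMeasure μp] {Ω : Set (Rn N)} (hΩb : Bornology.IsBounded Ω) :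
    Submodule ℝ (Rn N → ℝ) where
  carrier := {u | MemXOn μp Ω u}
  add_mem' hu hv := hu.add hΩb hv
  zero_mem' := IsTestFunction.memXOn μp (φ := 0) ⟨contDiff_const, HasCompactSupport.zero⟩
    (by simp [tsupport])
  smul_mem' c _ hu := hu.smul hΩb c

/-- The inclusion of `X(Ω)` in `L²(Ω)`. -/
noncomputable def toL2 (μp : Measure ℝ) [IsFiniteMeasure μp] {Ω : Set (Rn N)}
    (hΩb : Bornology.IsBounded Ω) : domX μp hΩb →ₗ[ℝ] Lp ℝ 2 (volume.restrict Ω) where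
  toFun u := ((u.2.memL12 hΩb).2.restrict Ω).toLp u.1
  map_add' _ _ := rfl
  map_smul' _ _ := rfl

variable {μp μm : Measure ℝ} [IsFiniteMeasure μp] {sbar : ℝ} {Ω : Set (Rn N)}

theorem toL2_ae_eq (hΩb : Bornology.IsBounded Ω) (u : domX μp hΩb) :
    (toL2 μp hΩb u : Rn N → ℝ) =ᵐ[volume.restrict Ω] u.1 :=
  MemLp.coeFn_toLp ((u.2.memL12 hΩb).2.restrict Ω)

theorem inner_toL2 (hΩb : Bornology.IsBounded Ω) (u v : domX μp hΩb) :
    inner ℝ (toL2 μp hΩb u) (toL2 μp hΩb v) = ∫ x in Ω, u.1 x * v.1 x := by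
  rw [L2.inner_def]
  refine integral_congr_ae ?_
  filter_upwards [toL2_ae_eq hΩb u, toL2_ae_eq hΩb v] with x hx hx'
  rw [hx, hx']
  simp [mul_comm]

theorem lintegral_restrict_enorm_sq {u : Rn N → ℝ} (hΩ : MeasurableSet Ω)
    (h0 : ∀ᵐ x ∂volume, x ∉ Ω → u x = 0) :
    ∫⁻ x in Ω, ‖u x‖ₑ ^ 2 = ∫⁻ x, ‖u x‖ₑ ^ 2 := by
  rw [← lintegral_indicator hΩ]
  refine lintegral_congr_ae (h0.mono fun x hx => ?_)
  by_cases hxΩ : x ∈ Ω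
  · simp [hxΩ]
  · simp [hxΩ, hx hxΩ]

theorem ofReal_norm_sq_Lp {α F : Type*} [MeasurableSpace α] [NormedAddCommGroup F]
    {m : Measure α} (f : Lp F 2 m) : ENNReal.ofReal (‖f‖ ^ 2) = ∫⁻ x, ‖f x‖ₑ ^ 2 ∂m := by
  rw [ENNReal.ofReal_pow (norm_nonneg _), Lp.norm_def, ENNReal.ofReal_toReal (Lp.eLpNorm_ne_top f),
    eLpNorm_two_eq, ← ENNReal.rpow_natCast, ← ENNReal.rpow_mul]
  norm_num

theorem ofReal_norm_toL2_sq (hΩ : MeasurableSet Ω) (hΩb : Bornology.IsBounded Ω)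
    (u : domX μp hΩb) : ENNReal.ofReal (‖toL2 μp hΩb u‖ ^ 2) = ∫⁻ x, ‖u.1 x‖ₑ ^ 2 := by
  rw [ofReal_norm_sq_Lp, ← lintegral_restrict_enorm_sq hΩ u.2.2]
  refine lintegral_congr_ae ?_
  filter_upwards [toL2_ae_eq hΩb u] with x hx
  rw [hx]

theorem eq_zero_of_toL2_eq_zero (hΩ : MeasurableSet Ω) (hΩb : Bornology.IsBounded Ω)
    {u : domX μp hΩb} (h : toL2 μp hΩb u = 0) : u.1 =ᵐ[volume] 0 := by
  have h1 := toL2_ae_eq hΩb u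
  rw [h] at h1
  have h2 := (ae_restrict_iff' hΩ).1 (h1.symm.trans (Lp.coeFn_zero _ _ _))
  filter_upwards [h2, u.2.2] with x hx hx'
  by_cases hxΩ : x ∈ Ω
  exacts [hx hxΩ, hx' hxΩ]

theorem toL2_eq_zero_iff (hΩ : MeasurableSet Ω) (hΩb : Bornology.IsBounded Ω)
    {u : domX μp hΩb} : toL2 μp hΩb u = 0 ↔ u.1 =ᵐ[volume] 0 := by
  refine ⟨eq_zero_of_toL2_eq_zero hΩ hΩb, fun h => ?_⟩
  exact Lp.ext ((toL2_ae_eq hΩb u).trans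
    (EventuallyEq.trans (ae_restrict_of_ae h) (Lp.coeFn_zero _ _ _).symm))

/-- Energies are lower semicontinuous with respect to convergence in `L²`. -/
theorem specEnergy_sub_le_of_tendsto (ν : Measure (ℝ × Rn N)) (hΩ : MeasurableSet Ω)
    (hΩv : volume Ω ≠ ⊤) {u : ℕ → Rn N → ℝ} (hu : ∀ n, MemL12 (u n))
    (hu0 : ∀ n, ∀ᵐ x ∂volume, x ∉ Ω → u n x = 0) {w v : Rn N → ℝ} (hw : MemL12 w)
    (hw0 : ∀ᵐ x ∂volume, x ∉ Ω → w x = 0) (hv : MemL12 v)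
    (hlim : Tendsto (fun n => ∫⁻ x, ‖(u n - w) x‖ₑ ^ 2) atTop (𝓝 0)) {ε : ℝ≥0∞}
    (h : ∀ᶠ n in atTop, specEnergy ν (v - u n) ≤ ε) : specEnergy ν (v - w) ≤ ε := by
  have hft : ∀ ξ, Tendsto (fun n => ft (u n) ξ) atTop (𝓝 (ft w ξ)) := by
    intro ξ
    rw [tendsto_iff_edist_tendsto_0]
    have h1 : Tendsto (fun n => volume Ω * ∫⁻ x, ‖(u n - w) x‖ₑ ^ 2) atTop (𝓝 0) := by
      simpa using ENNReal.Tendsto.const_mul hlim (Or.inr hΩv)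
    have h2 : Tendsto (fun n => ‖ft (u n - w) ξ‖ₑ ^ 2) atTop (𝓝 0) := by
      refine tendsto_of_tendsto_of_tendsto_of_le_of_le tendsto_const_nhds h1
        (fun _ => zero_le) fun n => enorm_ft_sq_le hΩ ((hu n).sub hw).1.1 ?_ ξ
      filter_upwards [hu0 n, hw0] with x hx hx' hxΩ
      simp [hx hxΩ, hx' hxΩ]
    have h3 := (ENNReal.continuous_rpow_const (y := (1 / 2 : ℝ))).tendsto 0 |>.comp h2
    rw [ENNReal.zero_rpow_of_pos (by norm_num)] at h3
    refine h3.congr fun n => ?_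
    rw [Function.comp_apply, ← ENNReal.rpow_natCast, ← ENNReal.rpow_mul, edist_eq_enorm_sub,
      ft_sub (hu n).1 hw.1]
    norm_num
  have hmeas : ∀ n, Measurable fun z : ℝ × Rn N =>
      ENNReal.ofReal (weight z * ‖ft (v - u n) z.2‖ ^ 2) :=
    fun n => (measurable_specEnergy_integrand (hv.sub (hu n)).1).ennreal_ofReal
  have hpt : ∀ z : ℝ × Rn N, liminf (fun n => ENNReal.ofReal (weight z * ‖ft (v - u n) z.2‖ ^ 2))
      atTop = ENNReal.ofReal (weight z * ‖ft (v - w) z.2‖ ^ 2) := by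
    intro z
    refine Tendsto.liminf_eq ((ENNReal.continuous_ofReal.tendsto _).comp
      (Tendsto.const_mul _ (Tendsto.pow (Tendsto.norm ?_) 2)))
    rw [ft_sub hv.1 hw.1]
    simp_rw [ft_sub hv.1 (hu _).1]
    exact tendsto_const_nhds.sub (hft z.2)
  have h4 := lintegral_liminf_le (μ := ν) (u := atTop) hmeas
  simp_rw [hpt] at h4
  exact h4.trans (liminf_le_of_frequently_le' h.frequently)

namespace Admissible

theorem energyOn_ne_top (A : Admissible μp μm sbar Ω) {u : Rn N → ℝ} (hu : MemXOn μp Ω u) :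
    energyOn μm (Ico 0 sbar) u ≠ ⊤ := by
  have := hu.normXSq_ne_top A.isBounded
  exact ne_top_of_le_ne_top (by finiteness) (A.dominated u hu)

variable [IsFiniteMeasure μm]

theorem signedForm_eq (A : Admissible μp μm sbar Ω) {u v : Rn N → ℝ} (hu : MemXOn μp Ω u)
    (hv : MemXOn μp Ω v) : signedForm μp μm sbar u v =
      specForm ((μp.restrict (Icc 0 1)).prod volume) u v -
        specForm ((μm.restrict (Ico 0 sbar)).prod volume) u v := by
  have huL := hu.memL12 A.isBounded
  have hvL := hv.memL12 A.isBounded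
  rw [signedForm, integral_seminormForm_eq_specForm μp measurableSet_Icc subset_rfl huL hvL
    (hu.normXSq_ne_top A.isBounded) (hv.normXSq_ne_top A.isBounded),
    integral_seminormForm_eq_specForm μm measurableSet_Ico A.Ico_subset huL hvL
    (A.energyOn_ne_top hu) (A.energyOn_ne_top hv)]

theorem specEnergy_ne_top (A : Admissible μp μm sbar Ω) {u : Rn N → ℝ} (hu : MemXOn μp Ω u) :
    specEnergy ((μp.restrict (Icc 0 1)).prod volume) u ≠ ⊤ ∧
      specEnergy ((μm.restrict (Ico 0 sbar)).prod volume) u ≠ ⊤ := by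
  have huL := hu.memL12 A.isBounded
  rw [← energyOn_eq_specEnergy μp measurableSet_Icc subset_rfl huL,
    ← energyOn_eq_specEnergy μm measurableSet_Ico A.Ico_subset huL]
  exact ⟨hu.normXSq_ne_top A.isBounded, A.energyOn_ne_top hu⟩

theorem signedForm_comm (A : Admissible μp μm sbar Ω) {u v : Rn N → ℝ} (hu : MemXOn μp Ω u)
    (hv : MemXOn μp Ω v) : signedForm μp μm sbar u v = signedForm μp μm sbar v u := by
  rw [A.signedForm_eq hu hv, A.signedForm_eq hv hu, specForm_comm, specForm_comm _ u v]

theorem signedForm_add_left (A : Admissible μp μm sbar Ω) {u v w : Rn N → ℝ}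
    (hu : MemXOn μp Ω u) (hv : MemXOn μp Ω v) (hw : MemXOn μp Ω w) :
    signedForm μp μm sbar (u + v) w = signedForm μp μm sbar u w + signedForm μp μm sbar v w := by
  rw [A.signedForm_eq (hu.add A.isBounded hv) hw, A.signedForm_eq hu hw, A.signedForm_eq hv hw]
  have h1 := A.specEnergy_ne_top hu
  have h2 := A.specEnergy_ne_top hv
  have h3 := A.specEnergy_ne_top hw
  have h4 := (hu.memL12 A.isBounded).1
  have h5 := (hv.memL12 A.isBounded).1
  have h6 := (hw.memL12 A.isBounded).1
  rw [specForm_add_left h4 h5 h6 h1.1 h2.1 h3.1, specForm_add_left h4 h5 h6 h1.2 h2.2 h3.2]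
  ring

theorem signedForm_smul_left (A : Admissible μp μm sbar Ω) (c : ℝ) {u w : Rn N → ℝ}
    (hu : MemXOn μp Ω u) (hw : MemXOn μp Ω w) :
    signedForm μp μm sbar (c • u) w = c * signedForm μp μm sbar u w := by
  rw [A.signedForm_eq (hu.smul A.isBounded c) hw, A.signedForm_eq hu hw, specForm_smul_left,
    specForm_smul_left]
  ring

theorem signedForm_self (A : Admissible μp μm sbar Ω) {u : Rn N → ℝ} (hu : MemXOn μp Ω u) :
    signedForm μp μm sbar u u =
      (normXSq μp u).toReal - (energyOn μm (Ico 0 sbar) u).toReal := by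
  have huL := hu.memL12 A.isBounded
  rw [A.signedForm_eq hu hu, specForm_self _ huL.1, specForm_self _ huL.1, normXSq,
    ← energyOn_eq_specEnergy μp measurableSet_Icc subset_rfl huL,
    ← energyOn_eq_specEnergy μm measurableSet_Ico A.Ico_subset huL]

theorem signedForm_self_le (A : Admissible μp μm sbar Ω) {u : Rn N → ℝ} (hu : MemXOn μp Ω u) :
    signedForm μp μm sbar u u ≤ (normXSq μp u).toReal := by
  rw [A.signedForm_self hu]
  linarith [@ENNReal.toReal_nonneg (energyOn μm (Ico 0 sbar) u)]

theorem normXSq_le (A : Admissible μp μm sbar Ω) {u : Rn N → ℝ} (hu : MemXOn μp Ω u) :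
    (normXSq μp u).toReal ≤ 2 * signedForm μp μm sbar u u := by
  have h1 := hu.normXSq_ne_top A.isBounded
  have h := ENNReal.toReal_mono (by finiteness) (A.dominated u hu)
  rw [ENNReal.toReal_mul, ENNReal.toReal_inv] at h
  rw [A.signedForm_self hu]
  norm_num at h ⊢
  linarith

theorem normXSq_le_ofReal (A : Admissible μp μm sbar Ω) {u : Rn N → ℝ} (hu : MemXOn μp Ω u) :
    normXSq μp u ≤ ENNReal.ofReal (2 * signedForm μp μm sbar u u) := by
  rw [← ENNReal.ofReal_toReal (hu.normXSq_ne_top A.isBounded)]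
  exact ENNReal.ofReal_le_ofReal (A.normXSq_le hu)

theorem exists_coercive (A : Admissible μp μm sbar Ω) : ∃ c : ℝ, 0 < c ∧
    ∀ u : domX μp A.isBounded, c * ‖toL2 μp A.isBounded u‖ ^ 2 ≤
      signedForm μp μm sbar u.1 u.1 := by
  obtain ⟨c, hc, h⟩ := A.poincare
  refine ⟨c / 2, by positivity, fun u => ?_⟩
  have h1 := h u.1 u.2
  rw [← ofReal_norm_toL2_sq A.isOpen.measurableSet, ← ENNReal.ofReal_mul hc.le] at h1
  have h2 := ENNReal.toReal_mono (u.2.normXSq_ne_top A.isBounded) h1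
  rw [ENNReal.toReal_ofReal (by positivity)] at h2
  linarith [A.normXSq_le u.2]

end Admissible

end Form

section Existence

variable {N : ℕ} {Ω : Set (Rn N)}

theorem integral_mul_eq_zero_of_disjoint {α : Type*} [MeasurableSpace α] (m : Measure α)
    {f g : α → ℝ} (h : ∀ x, f x = 0 ∨ g x = 0) : ∫ x, f x * g x ∂m = 0 := by
  rw [← integral_zero α ℝ]
  congr 1
  funext x
  exact mul_eq_zero.2 (h x)

/-- A nonempty open set supports infinitely many nontrivial test functions with pairwise disjoint
supports. -/
theorem exists_seq_testFunction (hN : N ≠ 0) (hΩo : IsOpen Ω) (hΩn : Ω.Nonempty) :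
    ∃ φ : ℕ → Rn N → ℝ, (∀ n, IsTestFunction (φ n)) ∧ (∀ n, tsupport (φ n) ⊆ Ω) ∧
      (∀ i j, i ≠ j → ∀ x, φ i x = 0 ∨ φ j x = 0) ∧ ∀ n, ¬ φ n =ᵐ[volume] 0 := by
  have : Nonempty (Fin N) := ⟨⟨0, Nat.pos_of_ne_zero hN⟩⟩
  have hinf : Ω.Infinite := by
    obtain ⟨x, hx⟩ := hΩn
    exact infinite_of_mem_nhds x (hΩo.mem_nhds hx)
  have := hinf.to_subtype
  obtain ⟨U, hUi, hUo, hUd⟩ := exists_seq_infinite_isOpen_pairwise_disjoint Ω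
  choose x hx using fun n => (hUi n).nonempty
  have hopen : ∀ n, IsOpen ((↑) '' U n : Set (Rn N)) := fun n =>
    hΩo.isOpenMap_subtype_val _ (hUo n)
  choose φ h1 h2 h3 _ h5 using fun n => exists_contDiff_tsupport_subset (n := ⊤)
    ((hopen n).mem_nhds (mem_image_of_mem _ (hx n)))
  refine ⟨φ, fun n => ⟨h3 n, h2 n⟩, fun n => (h1 n).trans (Subtype.coe_image_subset _ _),
    fun i j hij y => ?_, fun n hn => ?_⟩
  · by_contra! hne
    have hi := h1 i (subset_tsupport _ hne.1)
    have hj := h1 j (subset_tsupport _ hne.2)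
    exact disjoint_left.1 ((disjoint_image_iff Subtype.val_injective).2 (hUd hij)) hi hj
  · have h6 := ((h3 n).continuous.ae_eq_iff_eq volume continuous_zero).1 hn
    have h7 := congrFun h6 (x n)
    rw [h5] at h7
    exact one_ne_zero h7

theorem exists_linearIndependent_toL2 (μp : Measure ℝ) [IsFiniteMeasure μp] (hN : N ≠ 0)
    (hΩo : IsOpen Ω) (hΩb : Bornology.IsBounded Ω) (hΩn : Ω.Nonempty) :
    ∃ f : ℕ → domX μp hΩb, LinearIndependent ℝ fun n => toL2 μp hΩb (f n) := by
  obtain ⟨φ, h1, h2, h3, h4⟩ := exists_seq_testFunction hN hΩo hΩn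
  refine ⟨fun n => ⟨φ n, (h1 n).memXOn μp (h2 n)⟩, linearIndependent_of_ne_zero_of_inner_eq_zero
    (fun n h => h4 n (eq_zero_of_toL2_eq_zero hΩo.measurableSet hΩb h)) fun i j hij => ?_⟩
  refine (inner_toL2 hΩb _ _).trans ?_
  exact integral_mul_eq_zero_of_disjoint _ (h3 i j hij)

/-- Finitely many linear conditions on an infinite dimensional space have a nontrivial solution. -/
theorem exists_apply_eq_zero_of_linearIndependent {V H : Type*} [AddCommGroup V] [Module ℝ V]
    [AddCommGroup H] [Module ℝ H] (J : V →ₗ[ℝ] H) {f : ℕ → V}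
    (hf : LinearIndependent ℝ fun n => J (f n)) (L : ℕ → V →ₗ[ℝ] ℝ) (k : ℕ) :
    ∃ u, (∀ j < k, L j u = 0) ∧ J u ≠ 0 := by
  let T : (Fin (k + 1) → ℝ) →ₗ[ℝ] V := Fintype.linearCombination ℝ fun i : Fin (k + 1) => f i
  let S : (Fin (k + 1) → ℝ) →ₗ[ℝ] (Fin k → ℝ) := LinearMap.pi fun j => L j ∘ₗ T
  have hker : LinearMap.ker S ≠ ⊥ := LinearMap.ker_ne_bot_of_finrank_lt (by simp)
  obtain ⟨c, hc, hc0⟩ := (LinearMap.ker S).exists_mem_ne_zero_of_ne_bot hker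
  refine ⟨T c, fun j hj => congrFun hc ⟨j, hj⟩, fun h => hc0 ?_⟩
  have hli := hf.comp (fun i : Fin (k + 1) => (i : ℕ)) Fin.val_injective
  funext i
  refine Fintype.linearIndependent_iff.1 hli c ?_ i
  rw [← h, Fintype.linearCombination_apply, map_sum]
  simp

variable {μp μm : Measure ℝ} [IsFiniteMeasure μp] [IsFiniteMeasure μm] {sbar : ℝ}

namespace Admissible

/-- The form of the operator on `X(Ω)`. -/
noncomputable def form (A : Admissible μp μm sbar Ω) :
    domX μp A.isBounded →ₗ[ℝ] domX μp A.isBounded →ₗ[ℝ] ℝ :=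
  LinearMap.mk₂ ℝ (fun u v => signedForm μp μm sbar u.1 v.1)
    (fun u v w => A.signedForm_add_left u.2 v.2 w.2)
    (fun c u w => A.signedForm_smul_left c u.2 w.2)
    (fun u v w => by
      rw [A.signedForm_comm u.2 (v + w).2, A.signedForm_comm u.2 v.2, A.signedForm_comm u.2 w.2]
      exact A.signedForm_add_left v.2 w.2 u.2)
    (fun c u w => by
      rw [A.signedForm_comm u.2 (c • w).2, A.signedForm_comm u.2 w.2]
      exact A.signedForm_smul_left c w.2 u.2)

theorem form_apply (A : Admissible μp μm sbar Ω) (u v : domX μp A.isBounded) :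
    A.form u v = signedForm μp μm sbar u.1 v.1 := rfl

theorem form_self_nonneg (A : Admissible μp μm sbar Ω) (u : domX μp A.isBounded) :
    0 ≤ A.form u u := by
  linarith [A.normXSq_le u.2, A.form_apply u u, @ENNReal.toReal_nonneg (normXSq μp u.1)]

theorem form_self_eq_zero (A : Admissible μp μm sbar Ω) {u : domX μp A.isBounded}
    (h : toL2 μp A.isBounded u = 0) : A.form u u = 0 := by
  refine le_antisymm ((A.signedForm_self_le u.2).trans_eq ?_) (A.form_self_nonneg u)
  have h1 := eq_zero_of_toL2_eq_zero A.isOpen.measurableSet A.isBounded h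
  rw [normXSq, energyOn_congr _ _ h1, ← normXSq, normXSq_zero, ENNReal.toReal_zero]

theorem exists_limit (A : Admissible μp μm sbar Ω) (u : ℕ → domX μp A.isBounded)
    (hu : Tendsto (fun p : ℕ × ℕ => A.form (u p.1 - u p.2) (u p.1 - u p.2)) atTop (𝓝 0)) :
    ∃ w, Tendsto (fun n => A.form (u n - w) (u n - w)) atTop (𝓝 0) := by
  have hΩ := A.isOpen.measurableSet
  have hΩv : volume Ω ≠ ⊤ := A.isBounded.measure_lt_top.ne
  obtain ⟨c, hc, hcoer⟩ := A.exists_coercive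
  obtain ⟨h, hh⟩ : ∃ h, Tendsto (fun n => toL2 μp A.isBounded (u n)) atTop (𝓝 h) := by
    refine cauchySeq_tendsto_of_complete (cauchySeq_iff_tendsto_dist_atTop_0.2 ?_)
    have h1 : Tendsto (fun p : ℕ × ℕ => √(c⁻¹ * A.form (u p.1 - u p.2) (u p.1 - u p.2)))
        atTop (𝓝 0) := by
      simpa using (hu.const_mul c⁻¹).sqrt
    refine squeeze_zero (fun _ => dist_nonneg) (fun p => ?_) h1
    rw [dist_eq_norm, ← map_sub]
    refine Real.le_sqrt_of_sq_le ?_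
    rw [inv_mul_eq_div, le_div_iff₀' hc]
    exact hcoer _
  set w : Rn N → ℝ := Ω.indicator h with hw
  have hw2 : MemLp w 2 := (memLp_indicator_iff_restrict hΩ).2 (Lp.memLp h)
  have hfin : IsFiniteMeasure (volume.restrict Ω) := ⟨by simpa using hΩv.lt_top⟩
  have hwL : MemL12 w :=
    ⟨(integrable_indicator_iff hΩ).2 ((Lp.memLp h).integrable (by norm_num)), hw2⟩
  have hw0 : ∀ᵐ x ∂volume, x ∉ Ω → w x = 0 := ae_of_all _ fun x hx => indicator_of_notMem hx _
  have huL : ∀ n, MemL12 (u n).1 := fun n => (u n).2.memL12 A.isBounded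
  have hL2 : Tendsto (fun n => ∫⁻ x, ‖((u n).1 - w) x‖ₑ ^ 2) atTop (𝓝 0) := by
    have h1 : Tendsto (fun n => ENNReal.ofReal (‖toL2 μp A.isBounded (u n) - h‖ ^ 2))
        atTop (𝓝 0) := by
      have := ENNReal.tendsto_ofReal ((tendsto_iff_norm_sub_tendsto_zero.1 hh).pow 2)
      simpa using this
    refine h1.congr fun n => ?_
    have h2 : ∀ᵐ x ∂volume, x ∉ Ω → ((u n).1 - w) x = 0 := by
      filter_upwards [(u n).2.2, hw0] with x hx hx' hxΩ
      simp [hx hxΩ, hx' hxΩ]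
    rw [ofReal_norm_sq_Lp, ← lintegral_restrict_enorm_sq hΩ h2]
    refine lintegral_congr_ae ?_
    filter_upwards [Lp.coeFn_sub (toL2 μp A.isBounded (u n)) h, toL2_ae_eq A.isBounded (u n),
      ae_restrict_mem hΩ] with x hx hx' hxΩ
    rw [hx, Pi.sub_apply, hx', Pi.sub_apply, hw, indicator_of_mem hxΩ]
  have hE : ∀ ε : ℝ≥0∞, 0 < ε → ∀ᶠ n in atTop, normXSq μp ((u n).1 - w) ≤ ε := by
    intro ε hε
    have h1 : Tendsto (fun p : ℕ × ℕ =>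
        ENNReal.ofReal (2 * A.form (u p.1 - u p.2) (u p.1 - u p.2))) atTop (𝓝 0) := by
      simpa using ENNReal.tendsto_ofReal (hu.const_mul 2)
    have h2 := h1.eventually_le_const hε
    rw [← prod_atTop_atTop_eq] at h2
    filter_upwards [h2.curry] with n hn
    rw [normXSq, energyOn_eq_specEnergy μp measurableSet_Icc subset_rfl ((huL n).sub hwL)]
    refine specEnergy_sub_le_of_tendsto _ hΩ hΩv huL (fun n => (u n).2.2) hwL hw0 (huL n) hL2 ?_
    filter_upwards [hn] with m hm
    rw [← energyOn_eq_specEnergy μp measurableSet_Icc subset_rfl ((huL n).sub (huL m))]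
    exact (A.normXSq_le_ofReal (u n - u m).2).trans hm
  have hsub : ∀ n, w - (u n).1 = (-1 : ℝ) • ((u n).1 - w) := fun n => by simp
  have hwX : MemXOn μp Ω w := by
    refine memXOn_of_forall_exists A.isBounded hwL hw0 fun ε hε => ?_
    obtain ⟨n, hn1, hn2⟩ := ((hE ε hε).and (hL2.eventually_le_const hε)).exists
    refine ⟨(u n).1, (u n).2, ?_, ?_⟩
    · rw [hsub, normXSq, energyOn_smul μp measurableSet_Icc subset_rfl ((huL n).sub hwL)]
      simpa [normXSq] using hn1
    · rw [hsub]
      simpa [enorm_sub_rev] using hn2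
  refine ⟨⟨w, hwX⟩, ?_⟩
  have h3 : Tendsto (fun n => normXSq μp ((u n).1 - w)) atTop (𝓝 0) :=
    ENNReal.tendsto_nhds_zero.2 hE
  have h4 := (ENNReal.tendsto_toReal ENNReal.zero_ne_top).comp h3
  refine squeeze_zero (fun n => A.form_self_nonneg _) (fun n => ?_) h4
  exact A.signedForm_self_le (u n - (⟨w, hwX⟩ : domX μp A.isBounded)).2

theorem exists_subseq_tendsto (A : Admissible μp μm sbar Ω) (u : ℕ → domX μp A.isBounded) (B : ℝ)
    (hB : ∀ n, A.form (u n) (u n) ≤ B) :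
    ∃ φ : ℕ → ℕ, StrictMono φ ∧ ∃ h, Tendsto (fun n => toL2 μp A.isBounded (u (φ n)))
      atTop (𝓝 h) := by
  have hΩ := A.isOpen.measurableSet
  obtain ⟨c, hc, hcoer⟩ := A.exists_coercive
  obtain ⟨φ, hφ, hlim⟩ := exists_subseq_cauchy_L2 hΩ A.isBounded μp A.order_pos A.mass_ne_zero
    (u := fun n => (u n).1) (fun n => (u n).2.memL12 A.isBounded) (fun n => (u n).2.2)
    (B := max (ENNReal.ofReal (B / c)) (ENNReal.ofReal (2 * B))) (by finiteness)
    (fun n => by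
      rw [← ofReal_norm_toL2_sq hΩ A.isBounded]
      refine le_max_of_le_left (ENNReal.ofReal_le_ofReal ?_)
      rw [le_div_iff₀' hc]
      exact (hcoer _).trans (hB n))
    (fun n => le_max_of_le_right ((A.normXSq_le_ofReal (u n).2).trans
      (ENNReal.ofReal_le_ofReal (mul_le_mul_of_nonneg_left (hB n) zero_le_two))))
  refine ⟨φ, hφ, cauchySeq_tendsto_of_complete (cauchySeq_iff_tendsto_dist_atTop_0.2 ?_)⟩
  have h1 := ((ENNReal.tendsto_toReal ENNReal.zero_ne_top).comp hlim).sqrt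
  simp only [ENNReal.toReal_zero, Real.sqrt_zero] at h1
  refine h1.congr fun p => ?_
  have h2 := ofReal_norm_toL2_sq hΩ A.isBounded (u (φ p.1) - u (φ p.2))
  rw [Function.comp_apply, dist_eq_norm, ← map_sub, ← Real.sqrt_sq (norm_nonneg _)]
  congr 1
  rw [← ENNReal.toReal_ofReal (sq_nonneg ‖_‖), h2]
  rfl

/-- The form of the operator on `X(Ω)`, with the compact inclusion in `L²(Ω)`. -/
noncomputable def compactForm (A : Admissible μp μm sbar Ω) :
    CompactForm (domX μp A.isBounded) (Lp ℝ 2 (volume.restrict Ω)) where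
  J := toL2 μp A.isBounded
  a := A.form
  symm u v := A.signedForm_comm u.2 v.2
  c := A.exists_coercive.choose
  c_pos := A.exists_coercive.choose_spec.1
  coercive := A.exists_coercive.choose_spec.2
  ker _ h := A.form_self_eq_zero h
  complete := A.exists_limit
  compact := A.exists_subseq_tendsto
  big e k := by
    obtain ⟨f, hf⟩ := exists_linearIndependent_toL2 μp A.dim_ne_zero A.isOpen A.isBounded
      A.nonempty
    exact exists_apply_eq_zero_of_linearIndependent _ hf (fun j => A.form.flip (e j)) k

end Admissible

/-- Test functions are dense in `L²(Ω)`. -/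
theorem eq_zero_of_inner_toL2_eq_zero (hΩo : IsOpen Ω) (hΩb : Bornology.IsBounded Ω)
    (h : Lp ℝ 2 (volume.restrict Ω)) (hh : ∀ u, inner ℝ (toL2 μp hΩb u) h = 0) : h = 0 := by
  have hΩ := hΩo.measurableSet
  have hfin : IsFiniteMeasure (volume.restrict Ω) := ⟨by simpa using hΩb.measure_lt_top⟩
  have hint : IntegrableOn h Ω := (Lp.memLp h).integrable (by norm_num)
  have h1 := hΩo.ae_eq_zero_of_integral_contDiff_smul_eq_zero (μ := volume)
    hint.locallyIntegrableOn fun g hg hgc hgs => by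
      have h2 := hh ⟨g, IsTestFunction.memXOn μp ⟨hg, hgc⟩ hgs⟩
      rw [L2.inner_def] at h2
      have h3 : ∫ x in Ω, g x • h x = 0 := by
        rw [← h2]
        refine integral_congr_ae ?_
        filter_upwards [toL2_ae_eq hΩb ⟨g, IsTestFunction.memXOn μp ⟨hg, hgc⟩ hgs⟩] with x hx
        rw [hx]
        simp [mul_comm]
      rw [← h3, setIntegral_eq_integral_of_forall_compl_eq_zero]
      intro x hx
      rw [image_eq_zero_of_notMem_tsupport fun h4 => hx (hgs h4), zero_smul]
  refine Lp.ext (EventuallyEq.trans ?_ (Lp.coeFn_zero _ _ _).symm)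
  exact (ae_restrict_iff' hΩ).2 h1

/-- If the negative part is small, the form is coercive, with a bound depending only on the set. -/
theorem exists_admissible (hN : N ≠ 0) (hΩo : IsOpen Ω) (hΩb : Bornology.IsBounded Ω)
    (hΩn : Ω.Nonempty) : ∃ γ₀ : ℝ, 0 < γ₀ ∧
      ∀ (μp μm : Measure ℝ) [IsFiniteMeasure μp] [IsFiniteMeasure μm] (sbar γ : ℝ),
        0 < sbar → sbar ≤ 1 → γ ≤ γ₀ → μp (Icc sbar 1) ≠ 0 →
        μm (Ico 0 sbar) ≤ ENNReal.ofReal γ * μp (Icc sbar 1) → Admissible μp μm sbar Ω := by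
  obtain ⟨C, hC, hbound⟩ := exists_seminormSq_le hN hΩo.measurableSet hΩb.measure_lt_top.ne
  refine ⟨(2 * C)⁻¹, by positivity, fun μp μm _ _ sbar γ h0 h1 hγ hp hm => ?_⟩
  have key : ∀ u, MemXOn μp Ω u → ∀ s, 0 ≤ s → s ≤ sbar →
      μp (Icc sbar 1) * seminormSq s u ≤ ENNReal.ofReal C * normXSq μp u := by
    intro u hu s hs0 hs
    have huL := hu.memL12 hΩb
    calc μp (Icc sbar 1) * seminormSq s u = ∫⁻ _t in Icc sbar 1, seminormSq s u ∂μp := by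
          rw [setLIntegral_const, mul_comm]
      _ ≤ ∫⁻ t in Icc sbar 1, ENNReal.ofReal C * seminormSq t u ∂μp :=
          setLIntegral_mono' measurableSet_Icc fun t ht =>
            hbound u huL hu.2 s t hs0 (hs.trans ht.1) ht.2
      _ = ENNReal.ofReal C * ∫⁻ t in Icc sbar 1, seminormSq t u ∂μp :=
          lintegral_const_mul' _ _ ENNReal.ofReal_ne_top
      _ ≤ ENNReal.ofReal C * normXSq μp u :=
          mul_le_mul_right (lintegral_mono_set (Icc_subset_Icc_left h0.le)) _
  have hptop : μp (Icc sbar 1) ≠ ⊤ := measure_ne_top _ _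
  refine ⟨hN, hΩo, hΩb, hΩn, h0, h1, hp, fun u hu => ?_,
    (μp (Icc sbar 1)).toReal / C, div_pos (ENNReal.toReal_pos hp hptop) hC, fun u hu => ?_⟩
  · calc energyOn μm (Ico 0 sbar) u
        ≤ ∫⁻ _s in Ico 0 sbar, (μp (Icc sbar 1))⁻¹ * (ENNReal.ofReal C * normXSq μp u) ∂μm := by
          refine setLIntegral_mono' measurableSet_Ico fun s hs => ?_
          rw [← ENNReal.mul_le_iff_le_inv hp hptop]
          exact key u hu s hs.1 hs.2.le
      _ = (μp (Icc sbar 1))⁻¹ * (ENNReal.ofReal C * normXSq μp u) * μm (Ico 0 sbar) :=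
          setLIntegral_const _ _
      _ ≤ (μp (Icc sbar 1))⁻¹ * (ENNReal.ofReal C * normXSq μp u) *
          (ENNReal.ofReal (2 * C)⁻¹ * μp (Icc sbar 1)) := by
          refine mul_le_mul_right (hm.trans ?_) _
          exact mul_le_mul_left (ENNReal.ofReal_le_ofReal hγ) _
      _ = ((μp (Icc sbar 1))⁻¹ * μp (Icc sbar 1)) *
          (ENNReal.ofReal C * ENNReal.ofReal (2 * C)⁻¹) * normXSq μp u := by ring
      _ = 2⁻¹ * normXSq μp u := by
          rw [ENNReal.inv_mul_cancel hp hptop, one_mul, ← ENNReal.ofReal_mul hC.le]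
          congr 1
          rw [mul_inv, mul_left_comm, mul_inv_cancel₀ hC.ne', mul_one,
            ENNReal.ofReal_inv_of_pos two_pos]
          simp
  · have h2 := key u hu 0 le_rfl h0.le
    have h3 : seminormSq 0 u = ∫⁻ x, ‖u x‖ₑ ^ 2 := by
      rw [seminormSq, if_pos rfl]
      refine lintegral_congr fun x => ?_
      rw [← sq_abs, ENNReal.ofReal_pow (abs_nonneg _), Real.enorm_eq_ofReal_abs]
    rw [h3] at h2
    rw [ENNReal.ofReal_div_of_pos hC, ENNReal.ofReal_toReal hptop, ENNReal.div_eq_inv_mul,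
      mul_assoc]
    have hC0 : ENNReal.ofReal C ≠ 0 := by simpa using hC
    rw [ENNReal.inv_mul_le_iff hC0 ENNReal.ofReal_ne_top]
    exact h2

end Existence

section Rayleigh

variable {N : ℕ} {Ω : Set (Rn N)} {μp μm : Measure ℝ} [IsFiniteMeasure μp] [IsFiniteMeasure μm]
  {sbar : ℝ}

namespace Admissible

theorem rayleigh_eq (A : Admissible μp μm sbar Ω) (u : domX μp A.isBounded) :
    rayleigh μp μm sbar Ω u.1 = A.form u u / ‖toL2 μp A.isBounded u‖ ^ 2 := by
  rw [rayleigh, form_apply, A.signedForm_self u.2, ← real_inner_self_eq_norm_sq, inner_toL2]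
  simp only [sq]
  rfl

theorem isEigenfunction_iff (A : Admissible μp μm sbar Ω) (l : ℝ) (u : domX μp A.isBounded) :
    IsEigenfunction μp μm sbar Ω l u.1 ↔
      ∀ v, A.form u v = l * inner ℝ (toL2 μp A.isBounded u) (toL2 μp A.isBounded v) := by
  refine ⟨fun h v => ?_, fun h => ⟨u.2, fun v hv => ?_⟩⟩
  · rw [inner_toL2]
    exact h.2 v.1 v.2
  · exact (h ⟨v, hv⟩).trans (by rw [inner_toL2])

end Admissible

end Rayleigh

theorem theorem1p3 (N : ℕ) (Ω : Set (Rn N)) (hΩo : IsOpen Ω) (hΩb : Bornology.IsBounded Ω)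
    (hΩn : Ω.Nonempty) (hΩL : HasLipschitzBoundary Ω) :
    ∃ γ₀ : ℝ, 0 < γ₀ ∧
      ∀ (μp μm : Measure ℝ) [IsFiniteMeasure μp] [IsFiniteMeasure μm] (sbar ssharp γ : ℝ),
        0 < sbar → sbar ≤ 1 → 0 ≤ γ → γ ≤ γ₀ →
        0 < μp (Icc sbar 1) →
        μm (Icc sbar 1) = 0 →
        μm (Ico 0 sbar) ≤ ENNReal.ofReal γ * μp (Icc sbar 1) →
        ssharp ∈ Icc sbar 1 → 0 < μp (Icc ssharp 1) → 2 * ssharp < N →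
        -- `lam k` and `e k` are the eigenvalue and the eigenfunction number `k + 1`
        ∃ (lam : ℕ → ℝ) (e : ℕ → Rn N → ℝ),
          (∀ k, IsEigenvalue μp μm sbar Ω (lam k)) ∧
          (∀ k, 0 < lam k) ∧ Monotone lam ∧ Tendsto lam atTop atTop ∧
          -- each eigenvalue is a constrained minimum of the Rayleigh quotient
          (∀ k, IsLeast (rayleigh μp μm sbar Ω ''
            {u | u ∈ orthSpace μp μm sbar Ω e k ∧ ¬ u =ᵐ[volume] 0}) (lam k)) ∧
          -- the minimum is attained at an eigenfunction
          (∀ k, e k ∈ orthSpace μp μm sbar Ω e k ∧ ¬ e k =ᵐ[volume] 0 ∧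
            IsEigenfunction μp μm sbar Ω (lam k) (e k) ∧
            rayleigh μp μm sbar Ω (e k) = lam k) ∧
          -- orthonormal basis of `L²(Ω)`
          (∃ b : HilbertBasis ℕ ℝ (Lp ℝ 2 (volume.restrict Ω)),
            ∀ k, (b k : Rn N → ℝ) =ᵐ[volume.restrict Ω] e k) ∧
          -- orthogonal basis of `X(Ω)`
          (∀ i j, i ≠ j → signedForm μp μm sbar (e i) (e j) = 0) ∧
          (∀ f, MemXOn μp Ω f → Tendsto (fun n => normXSq μp
            (f - ∑ j ∈ Finset.range n,
              (signedForm μp μm sbar f (e j) / signedForm μp μm sbar (e j) (e j)) • e j))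
            atTop (𝓝 0)) ∧
          -- finite multiplicity
          (∀ k, {j | lam j = lam k}.Finite) ∧
          (∀ k h, (∀ i < k, lam i < lam k) → (∀ j ∈ Finset.Icc k (k + h), lam j = lam k) →
            lam k < lam (k + h + 1) →
            ∀ φ, IsEigenfunction μp μm sbar Ω (lam k) φ →
              ∃ c : ℕ → ℝ, φ =ᵐ[volume] ∑ j ∈ Finset.Icc k (k + h), c j • e j) := by
  rcases eq_or_ne N 0 with rfl | hN
  · refine ⟨1, one_pos, fun μp μm _ _ sbar ssharp γ h0 _ _ _ _ _ _ hs _ hlt => ?_⟩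
    rw [Nat.cast_zero] at hlt
    linarith [hs.1]
  obtain ⟨γ₀, hγ₀, hadm⟩ := exists_admissible hN hΩo hΩb hΩn
  refine ⟨γ₀, hγ₀, fun μp μm _ _ sbar ssharp γ h0 h1 _ hγ hp _ hm _ _ _ => ?_⟩
  have A := hadm μp μm sbar γ h0 h1 hγ hp.ne' hm
  have hΩ := hΩo.measurableSet
  set F := A.compactForm with hF
  have ha : ∀ u v, F.a u v = signedForm μp μm sbar u.1 v.1 := fun u v => rfl
  have hJ : ∀ u, F.J u = toL2 μp A.isBounded u := fun u => rfl
  have hne : ∀ k, ¬ (F.eig k).1 =ᵐ[volume] 0 := fun k h => by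
    have h2 := F.norm_J_eig k
    rw [hJ, (toL2_eq_zero_iff hΩ A.isBounded).2 h, norm_zero] at h2
    exact zero_ne_one h2
  have heig : ∀ k, IsEigenfunction μp μm sbar Ω (F.lam k) (F.eig k).1 := fun k =>
    (A.isEigenfunction_iff _ _).2 (F.apply_eig k)
  have hmem : ∀ k, (F.eig k).1 ∈ orthSpace μp μm sbar Ω (fun k => (F.eig k).1) k := fun k =>
    ⟨(F.eig k).2, F.eig_mem k⟩
  have hray : ∀ k, rayleigh μp μm sbar Ω (F.eig k).1 = F.lam k := fun k => by
    rw [A.rayleigh_eq, ← hJ, F.norm_J_eig k, one_pow, div_one]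
    rfl
  refine ⟨F.lam, fun k => (F.eig k).1, fun k => ⟨_, heig k, hne k⟩, F.lam_pos, F.lam_mono,
    F.tendsto_lam, fun k => ⟨⟨_, ⟨hmem k, hne k⟩, hray k⟩, ?_⟩,
    fun k => ⟨hmem k, hne k, heig k, hray k⟩, ?_, fun i j hij => F.apply_eig_eig hij, ?_,
    F.finite_lam_eq, ?_⟩
  · rintro _ ⟨u, ⟨⟨hu, hu'⟩, hu0⟩, rfl⟩
    have h2 := F.lam_mul_le (k := k) (u := ⟨u, hu⟩) (F.mem_orth.2 hu')
    have h3 : F.J ⟨u, hu⟩ ≠ 0 := fun h => hu0 (eq_zero_of_toL2_eq_zero hΩ A.isBounded h)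
    refine le_of_le_of_eq ?_ (A.rayleigh_eq ⟨u, hu⟩).symm
    rw [le_div_iff₀ (by rw [← hJ]; positivity)]
    exact h2
  · obtain ⟨b, hb⟩ := F.exists_hilbertBasis
      (eq_zero_of_inner_toL2_eq_zero A.isOpen A.isBounded)
    exact ⟨b, fun k => by rw [hb k]; exact toL2_ae_eq A.isBounded _⟩
  · intro f hf
    have h2 := F.tendsto_sub_partialSum ⟨f, hf⟩
    have h3 := ENNReal.tendsto_ofReal (h2.const_mul 2)
    rw [mul_zero, ENNReal.ofReal_zero] at h3
    refine tendsto_of_tendsto_of_tendsto_of_le_of_le tendsto_const_nhds h3 (fun _ => zero_le)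
      fun n => ?_
    have h4 := A.normXSq_le_ofReal ((⟨f, hf⟩ : domX μp A.isBounded) - F.partialSum ⟨f, hf⟩ n).2
    have h5 : ((⟨f, hf⟩ : domX μp A.isBounded) - F.partialSum ⟨f, hf⟩ n).1 =
        f - ∑ j ∈ Finset.range n, (signedForm μp μm sbar f (F.eig j).1 /
          signedForm μp μm sbar (F.eig j).1 (F.eig j).1) • (F.eig j).1 := by
      simp [CompactForm.partialSum, ha]
    rw [h5] at h4
    refine h4.trans_eq ?_
    rw [ha, h5]
  · intro k h hlt _ hgt φ hφ
    have h2 := F.J_eq_sum_of_isEigenvector hlt hgt (φ := ⟨φ, hφ.1⟩)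
      ((A.isEigenfunction_iff _ ⟨φ, hφ.1⟩).1 hφ)
    refine ⟨fun j => F.a ⟨φ, hφ.1⟩ (F.eig j) / F.a (F.eig j) (F.eig j), ?_⟩
    have h3 := eq_zero_of_toL2_eq_zero hΩ A.isBounded (u := ⟨φ, hφ.1⟩ - ∑ j ∈ Finset.Icc k (k + h),
      (F.a ⟨φ, hφ.1⟩ (F.eig j) / F.a (F.eig j) (F.eig j)) • F.eig j) (by
        rw [← hJ, map_sub, h2, sub_self])
    filter_upwards [h3] with x hx
    simpa [sub_eq_zero] using hx
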